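/- Fix $\alpha>0$. For $a>1$ let $\tilde\lambda=\mathbb R$, oriented from left to right, and let $\lambda=\lambda_a$ be a contour in the open lower half-plane consisting of the two vertical half-lines $\{\operatorname{Re}\zeta=\pm w\}$ going down to $-i\infty$ ($w=w_a>0$), joined by a rectifiable cap $\{x+i\varphi(x):-w\le x\le w\}$, where $\varphi=\varphi_a<0$ is continuous on $[-w,w]$ and differentiable off finitely many points with integrable derivative, and where the cap meets the imaginary axis at $\theta=-i(1-1/a^2)$. Orient $\lambda$ upwards along $\operatorname{Re}\zeta=w$, then from right to left along the cap, then downwards along $\operatorname{Re}\zeta=-w$, so that all poles of $\zeta\mapsto\Gamma\left(\frac a\alpha(1-i\zeta)\right)$ lie in the region to the left of $\lambda$. Suppose that for all sufficiently large $a$ the $2\times2$ matrix function $U(\zeta)=U(\zeta;a)$ solves the following Riemann–Hilbert problem: (i) $U$ is analytic in $\mathbb C\setminus(\lambda\cup\tilde\lambda)$; (ii) $U^+(\zeta)=U^-(\zeta)J_U(\zeta)$ for $\zeta\in\lambda\cup\tilde\lambda$, where $U^{+}$ and $U^{-}$ are the pointwise boundary values from the left and from the right side of the contours, respectively, and $$J_U(\zeta)=\begin{pmatrix}1&-1_{\tilde\lambda}(\zeta)\,\Gamma\left(\frac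 a\alpha(1-i\zeta)\right)^{-1}e^{-\frac{a^2}{2\alpha}\left(\zeta^2+\frac12\right)}\\-1_{\lambda}(\zeta)\,\Gamma\left(\frac a\alpha(1-i\zeta)\right)e^{\frac{a^2}{2\alpha}\left(\zeta^2+\frac12\right)}&1\end{pmatrix};$$ (iii) $U(\zeta)\to I$ as $\zeta\to\infty$, $\zeta\in\mathbb C\setminus(\lambda\cup\tilde\lambda)$. Let $U_1(a)$ be defined by $U(\zeta)=I+\frac{U_1(a)}{\zeta}+O\left(\frac1{\zeta^2}\right)$ as $\zeta\to\infty$, $\zeta\in\mathbb C\setminus(\lambda\cup\tilde\lambda)$. Then, as $a\to+\infty$, $$(U_1(a))_{1,1}=O\left(e^{-\frac{a^2}{2\alpha}}\right),\qquad (U_1(a))_{2,2}=O\left(e^{-\frac{a^2}{2\alpha}}\right),$$ $$(U_1(a))_{2,1}=\frac1{2\pi i}\int_\lambda\Gamma\left(\tfrac a\alpha(1-is)\right)e^{\frac{a^2}{2\alpha}\left(s^2+\frac12\right)}\,ds+O\left(e^{-\frac{a^2}{2\alpha}}\right),$$ $$(U_1(a))_{1,2}=\frac1{2\pi i}\int_{-\infty}^{+\infty}\Gamma\left(\tfrac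 a\alpha(1-is)\right)^{-1}e^{-\frac{a^2}{2\alpha}\left(s^2+\frac12\right)}\,ds+O\left(e^{-\frac{a^2}{2\alpha}}\right),$$ where both integrals converge absolutely for all sufficiently large $a$. -/

import Mathlib

open Filter Topology Asymptotics MeasureTheory Set

noncomputable section

namespace GapRH

/-- The contour `lambda`: two vertical half-lines `Re ζ = ± w` going down to `-i∞`, joined by a cap
`ζ = x + i φ(x)`, `-w ≤ x ≤ w`, where `φ` is continuous on `[-w, w]`, differentiable off finitely
many interior points, with integrable derivative (so the cap is rectifiable). The whole contour
lies below the real line. It is oriented upwards along `Re ζ = w`, then from right to left along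
the cap, then downwards along `Re ζ = -w`. -/
structure LambdaContour where
  w : ℝ
  w_pos : 0 < w
  φ : ℝ → ℝ
  continuousOn : ContinuousOn φ (Icc (-w) w)
  differentiable : ∃ S : Set ℝ, S.Finite ∧ ∀ x ∈ Ioo (-w) w \ S, DifferentiableAt ℝ φ x
  integrable_deriv : IntervalIntegrable (deriv φ) volume (-w) w
  neg : ∀ x ∈ Icc (-w) w, φ x < 0

namespace LambdaContour

/-- The set of points of the contour. -/
def carrier (L : LambdaContour) : Set ℂ :=
  {ζ | |ζ.re| = L.w ∧ ζ.im ≤ L.φ ζ.re} ∪ {ζ | |ζ.re| ≤ L.w ∧ ζ.im = L.φ ζ.re}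

/-- The region enclosed by the contour (to the left of it). -/
def inner (L : LambdaContour) : Set ℂ := {ζ | |ζ.re| < L.w ∧ ζ.im < L.φ ζ.re}

/-- The contour meets the imaginary axis at `θ = -i (1 - 1/a²)`. -/
def CrossesAtTheta (L : LambdaContour) (a : ℝ) : Prop := L.φ 0 = -(1 - 1 / a ^ 2)

/-- The contour integral `∫ f(s) ds` along the oriented contour. -/
def integral (L : LambdaContour) (f : ℂ → ℂ) : ℂ :=
  (∫ y in Iic (L.φ L.w), f (L.w + y * Complex.I) * Complex.I)
    - (∫ x in (-L.w)..L.w, f (x + L.φ x * Complex.I) * (1 + deriv L.φ x * Complex.I))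
    - (∫ y in Iic (L.φ (-L.w)), f (-L.w + y * Complex.I) * Complex.I)

/-- Absolute convergence of the contour integral. -/
def IntegrableAlong (L : LambdaContour) (f : ℂ → ℂ) : Prop :=
  IntegrableOn (fun y : ℝ => f (L.w + y * Complex.I) * Complex.I) (Iic (L.φ L.w)) ∧
  IntervalIntegrable
    (fun x : ℝ => f (x + L.φ x * Complex.I) * (1 + deriv L.φ x * Complex.I)) volume (-L.w) L.w ∧
  IntegrableOn (fun y : ℝ => f (-L.w + y * Complex.I) * Complex.I) (Iic (L.φ (-L.w)))

end LambdaContour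

/-- The contour `lambda tilde`: the real line, oriented from left to right. -/
def realLine : Set ℂ := {ζ | ζ.im = 0}

/-- The union of both contours. -/
def sigma (L : LambdaContour) : Set ℂ := L.carrier ∪ realLine

/-- The union of the two regions lying to the left of the oriented contours: the upper half-plane
and the region enclosed by `lambda`. -/
def plusSide (L : LambdaContour) : Set ℂ := {ζ | 0 < ζ.im} ∪ L.inner

/-- The region lying to the right of both contours: the points off the contours below the real line
and outside of the region enclosed by `lambda`. -/
def minusSide (L : LambdaContour) : Set ℂ := {ζ | ζ.im < 0 ∧ ζ ∉ L.inner ∧ ζ ∉ L.carrier}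

/-- `Γ((a/α)(1 - iζ)) exp((a²/(2α)) (ζ² + 1/2))`. -/
def gammaExp (α a : ℝ) (ζ : ℂ) : ℂ :=
  Complex.Gamma ((a / α) * (1 - Complex.I * ζ)) *
    Complex.exp ((a ^ 2 / (2 * α)) * (ζ ^ 2 + 1 / 2))

/-- `Γ((a/α)(1 - iζ))⁻¹ exp(-(a²/(2α)) (ζ² + 1/2))`. -/
def gammaInvExp (α a : ℝ) (ζ : ℂ) : ℂ :=
  (Complex.Gamma ((a / α) * (1 - Complex.I * ζ)))⁻¹ *
    Complex.exp (-(a ^ 2 / (2 * α)) * (ζ ^ 2 + 1 / 2))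

/-- The jump matrix. -/
def jump (α a : ℝ) (L : LambdaContour) (ζ : ℂ) : Matrix (Fin 2) (Fin 2) ℂ :=
  !![1, -realLine.indicator (gammaInvExp α a) ζ;
     -L.carrier.indicator (gammaExp α a) ζ, 1]

/-- The filter `ζ → ∞`, `ζ` off the contours. -/
def atInfinity (L : LambdaContour) : Filter ℂ := Bornology.cobounded ℂ ⊓ 𝓟 (sigma L)ᶜ

/-- `U` solves the Riemann–Hilbert problem with jump matrix `jump α a L`; the boundary values are
pointwise limits from the left and from the right side of the contours. -/
structure IsSolution (α a : ℝ) (L : LambdaContour) (U : ℂ → Matrix (Fin 2) (Fin 2) ℂ) : Prop where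
  analytic : ∀ i j, DifferentiableOn ℂ (fun ζ => U ζ i j) (sigma L)ᶜ
  jump : ∀ s ∈ sigma L, ∃ Up Um : Matrix (Fin 2) (Fin 2) ℂ,
    Tendsto U (𝓝[plusSide L] s) (𝓝 Up) ∧ Tendsto U (𝓝[minusSide L] s) (𝓝 Um) ∧
      Up = Um * jump α a L s
  infinity : Tendsto U (atInfinity L) (𝓝 1)

/-- `U(ζ) = I + U₁/ζ + O(1/ζ²)` as `ζ → ∞` off the contours. -/
def HasExpansion (L : LambdaContour) (U : ℂ → Matrix (Fin 2) (Fin 2) ℂ)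
    (U₁ : Matrix (Fin 2) (Fin 2) ℂ) : Prop :=
  ∀ i j, (fun ζ : ℂ => U ζ i j - ((1 : Matrix (Fin 2) (Fin 2) ℂ) i j + U₁ i j / ζ))
    =O[atInfinity L] fun ζ : ℂ => 1 / ζ ^ 2

end GapRH

end

/-!
Row `i` of a solution `U` is a pair `(u₁, u₂)`, and the jump relation touches only `u₁` on `λ` and
only `u₂` on `ℝ`, with `u₁⁺ = u₁⁻ - Γ e^{…} u₂` on `λ` and `u₂⁺ = u₂⁻ - Γ⁻¹ e^{-…} u₁` on `ℝ`. So
`u₂` continues holomorphically across `λ` to a function `G` on the lower half-plane, and `u₁`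
continues across `ℝ`; inside `λ` the function `F = u₁ + Γ e^{…} G` continues `u₁` and is meromorphic
in the whole plane, with simple poles at the poles `p_k = -i (1 + k α/a)` of the Gamma factor only
(`exists_isRowExtension`). The cap of `λ` is removable because a continuous function that is
holomorphic off the graph of a continuous function of bounded variation is holomorphic, by a
Riemann sum version of Morera's theorem (`rectIntegral_eq_zero_of_graph`,
`differentiableOn_of_carrier`).

With `r_k` the residue of the Gamma factor at `p_k` and `δ_j` the entries of the identity matrix,
this yields the coupled system
* `F(ζ) = δ₁ + ∑ r_k G(p_k) / (ζ - p_k)` (`eq_add_tsum_of_simple_poles`), and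
* `G(ζ) = δ₂ - (2πi)⁻¹ ∫_ℝ Γ⁻¹ e^{-…} F(s) / (s - ζ) ds` below the real line
  (`eq_add_integral_of_half_planes`).

The poles lie at distance at least `1` from the real line, so each equation is controlled by a single
number: `R = ∑ |r_k|` and `β = (2π)⁻¹ ∫_ℝ |Γ⁻¹ e^{-…}|`. Both are `O(e^{-a²/(4α)})`
(`tsum_norm_gammaRes_le`, `integral_norm_gammaInvExp_le`). Hence `G(p_k)` is bounded, `F - δ₁ = O(R)`
on `ℝ` and `G(p_k) - δ₂ = O(β)`. The coefficients of `1/ζ` are `∑ r_k G(p_k)` and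
`(2πi)⁻¹ ∫_ℝ Γ⁻¹ e^{-…} F`, so they are `δ₂ ∑ r_k` and `δ₁ (2πi)⁻¹ ∫_ℝ Γ⁻¹ e^{-…}` up to
`O(R β) = O(e^{-a²/(2α)})` (`IsRowExtension.norm_coeff_sub_le`). Finally `2πi ∑ r_k` is the integral
along `λ`, by the residue theorem (`integral_gammaExp`).
-/

noncomputable section

namespace GapRH

open Complex (I)

/-! ### Integrals over rectangles, and the removability of graphs -/

/-- The integral of `h` over the boundary of the rectangle `[u, v] × [y₀, y₁]`, oriented
counterclockwise when `u ≤ v` and `y₀ ≤ y₁`. -/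
def rectIntegral (h : ℂ → ℂ) (u v y₀ y₁ : ℝ) : ℂ :=
  (∫ x in u..v, h (x + y₀ * I)) - (∫ x in u..v, h (x + y₁ * I)) +
    I * (∫ y in y₀..y₁, h (v + y * I)) - I * ∫ y in y₀..y₁, h (u + y * I)

lemma rectIntegral_swap_re (h : ℂ → ℂ) (u v y₀ y₁ : ℝ) :
    rectIntegral h v u y₀ y₁ = -rectIntegral h u v y₀ y₁ := by
  simp only [rectIntegral, intervalIntegral.integral_symm u v]
  ring

lemma rectIntegral_swap_im (h : ℂ → ℂ) (u v y₀ y₁ : ℝ) :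
    rectIntegral h u v y₁ y₀ = -rectIntegral h u v y₀ y₁ := by
  simp only [rectIntegral, intervalIntegral.integral_symm y₀ y₁]
  ring

lemma intervalIntegrable_horizontal {h : ℂ → ℂ} {u v y₀ y₁ y s t : ℝ}
    (hc : ContinuousOn h (Icc u v ×ℂ Icc y₀ y₁)) (hy : y ∈ Icc y₀ y₁) (hs : s ∈ Icc u v)
    (ht : t ∈ Icc u v) : IntervalIntegrable (fun x : ℝ => h (x + y * I)) volume s t := by
  apply ContinuousOn.intervalIntegrable
  refine hc.comp (by fun_prop) fun x hx => ?_
  have := uIcc_subset_Icc hs ht hx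
  simpa [Complex.mem_reProdIm] using And.intro this hy

lemma intervalIntegrable_vertical {h : ℂ → ℂ} {u v y₀ y₁ x s t : ℝ}
    (hc : ContinuousOn h (Icc u v ×ℂ Icc y₀ y₁)) (hx : x ∈ Icc u v) (hs : s ∈ Icc y₀ y₁)
    (ht : t ∈ Icc y₀ y₁) : IntervalIntegrable (fun y : ℝ => h (x + y * I)) volume s t := by
  apply ContinuousOn.intervalIntegrable
  refine hc.comp (by fun_prop) fun y hy => ?_
  have := uIcc_subset_Icc hs ht hy
  simpa [Complex.mem_reProdIm] using And.intro hx this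

lemma rectIntegral_add_re {h : ℂ → ℂ} {u v y₀ y₁ s : ℝ}
    (hc : ContinuousOn h (Icc u v ×ℂ Icc y₀ y₁)) (hs : s ∈ Icc u v) (hy : y₀ ≤ y₁) :
    rectIntegral h u v y₀ y₁ = rectIntegral h u s y₀ y₁ + rectIntegral h s v y₀ y₁ := by
  have huv : u ≤ v := hs.1.trans hs.2
  have e (y : ℝ) (hy : y ∈ Icc y₀ y₁) := intervalIntegral.integral_add_adjacent_intervals
    (intervalIntegrable_horizontal hc hy (left_mem_Icc.2 huv) hs)
    (intervalIntegrable_horizontal hc hy hs (right_mem_Icc.2 huv))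
  simp only [rectIntegral, ← e y₀ (left_mem_Icc.2 hy), ← e y₁ (right_mem_Icc.2 hy)]
  ring

lemma rectIntegral_add_im {h : ℂ → ℂ} {u v y₀ y₁ s : ℝ}
    (hc : ContinuousOn h (Icc u v ×ℂ Icc y₀ y₁)) (hs : s ∈ Icc y₀ y₁) (huv : u ≤ v) :
    rectIntegral h u v y₀ y₁ = rectIntegral h u v y₀ s + rectIntegral h u v s y₁ := by
  have hy : y₀ ≤ y₁ := hs.1.trans hs.2
  have e (x : ℝ) (hx : x ∈ Icc u v) := intervalIntegral.integral_add_adjacent_intervals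
    (intervalIntegrable_vertical hc hx (left_mem_Icc.2 hy) hs)
    (intervalIntegrable_vertical hc hx hs (right_mem_Icc.2 hy))
  simp only [rectIntegral, ← e u (left_mem_Icc.2 huv), ← e v (right_mem_Icc.2 huv)]
  ring

lemma rectIntegral_eq_zero {h : ℂ → ℂ} {u v y₀ y₁ : ℝ} (huv : u ≤ v) (hy : y₀ ≤ y₁)
    (hc : ContinuousOn h (Icc u v ×ℂ Icc y₀ y₁))
    (hd : ∀ z ∈ Ioo u v ×ℂ Ioo y₀ y₁, DifferentiableAt ℂ h z) : rectIntegral h u v y₀ y₁ = 0 := by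
  have := Complex.integral_boundary_rect_eq_zero_of_continuousOn_of_differentiableOn h
    (u + y₀ * I) (v + y₁ * I) (by simpa [uIcc_of_le, huv, hy] using hc)
    (fun z hz => (hd z (by simpa [huv, hy] using hz)).differentiableWithinAt)
  simpa [rectIntegral] using this

lemma rectIntegral_sub {f g : ℂ → ℂ} {u v y₀ y₁ : ℝ} (huv : u ≤ v) (hy : y₀ ≤ y₁)
    (hf : ContinuousOn f (Icc u v ×ℂ Icc y₀ y₁)) (hg : ContinuousOn g (Icc u v ×ℂ Icc y₀ y₁)) :
    rectIntegral (fun z => f z - g z) u v y₀ y₁ =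
      rectIntegral f u v y₀ y₁ - rectIntegral g u v y₀ y₁ := by
  have hu := left_mem_Icc.2 huv
  have hv := right_mem_Icc.2 huv
  have h0 := left_mem_Icc.2 hy
  have h1 := right_mem_Icc.2 hy
  simp only [rectIntegral]
  rw [intervalIntegral.integral_sub (intervalIntegrable_horizontal hf h0 hu hv)
      (intervalIntegrable_horizontal hg h0 hu hv),
    intervalIntegral.integral_sub (intervalIntegrable_horizontal hf h1 hu hv)
      (intervalIntegrable_horizontal hg h1 hu hv),
    intervalIntegral.integral_sub (intervalIntegrable_vertical hf hu h0 h1)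
      (intervalIntegrable_vertical hg hu h0 h1),
    intervalIntegral.integral_sub (intervalIntegrable_vertical hf hv h0 h1)
      (intervalIntegrable_vertical hg hv h0 h1)]
  ring

lemma norm_rectIntegral_le {h : ℂ → ℂ} {u v y₀ y₁ ε : ℝ} (huv : u ≤ v) (hy : y₀ ≤ y₁)
    (hb : ∀ z ∈ Icc u v ×ℂ Icc y₀ y₁, ‖h z‖ ≤ ε) :
    ‖rectIntegral h u v y₀ y₁‖ ≤ ε * (2 * (v - u) + 2 * (y₁ - y₀)) := by
  have hor (y : ℝ) (hy : y ∈ Icc y₀ y₁) : ‖∫ x in u..v, h (x + y * I)‖ ≤ ε * (v - u) := by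
    rw [← abs_of_nonneg (sub_nonneg.2 huv)]
    refine intervalIntegral.norm_integral_le_of_norm_le_const fun x hx => hb _ ?_
    rw [uIoc_of_le huv] at hx
    simpa [Complex.mem_reProdIm] using And.intro (Ioc_subset_Icc_self hx) hy
  have ver (x : ℝ) (hx : x ∈ Icc u v) : ‖I * ∫ y in y₀..y₁, h (x + y * I)‖ ≤ ε * (y₁ - y₀) := by
    rw [norm_mul, Complex.norm_I, one_mul, ← abs_of_nonneg (sub_nonneg.2 hy)]
    refine intervalIntegral.norm_integral_le_of_norm_le_const fun y hy' => hb _ ?_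
    rw [uIoc_of_le hy] at hy'
    simpa [Complex.mem_reProdIm] using And.intro hx (Ioc_subset_Icc_self hy')
  have h1 := hor y₀ (left_mem_Icc.2 hy)
  have h2 := hor y₁ (right_mem_Icc.2 hy)
  have h3 := ver u (left_mem_Icc.2 huv)
  have h4 := ver v (right_mem_Icc.2 huv)
  unfold rectIntegral
  refine (norm_sub_le _ _).trans ?_
  have := norm_add_le ((∫ x in u..v, h (x + y₀ * I)) - (∫ x in u..v, h (x + y₁ * I)))
    (I * (∫ y in y₀..y₁, h (v + y * I)))
  have := norm_sub_le (∫ x in u..v, h (x + y₀ * I)) (∫ x in u..v, h (x + y₁ * I))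
  linarith

lemma norm_rectIntegral_le_of_sub_const {h : ℂ → ℂ} {u v y₀ y₁ ε : ℝ} {c : ℂ} (huv : u ≤ v)
    (hy : y₀ ≤ y₁) (hc : ContinuousOn h (Icc u v ×ℂ Icc y₀ y₁))
    (hb : ∀ z ∈ Icc u v ×ℂ Icc y₀ y₁, ‖h z - c‖ ≤ ε) :
    ‖rectIntegral h u v y₀ y₁‖ ≤ ε * (2 * (v - u) + 2 * (y₁ - y₀)) := by
  have h0 : rectIntegral (fun _ => c) u v y₀ y₁ = 0 :=
    rectIntegral_eq_zero huv hy continuousOn_const fun _ _ => differentiableAt_const _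
  have := rectIntegral_sub huv hy hc (continuousOn_const (c := c))
  rw [h0, sub_zero] at this
  rw [← this]
  exact norm_rectIntegral_le huv hy hb

/-- Morera's theorem in terms of `rectIntegral`, with the corners in increasing order. -/
lemma differentiableOn_of_rectIntegral_eq_zero {h : ℂ → ℂ} {D : Set ℂ} (hD : IsOpen D)
    (hc : ContinuousOn h D)
    (H : ∀ u v y₀ y₁ : ℝ, u ≤ v → y₀ ≤ y₁ → Icc u v ×ℂ Icc y₀ y₁ ⊆ D →
      rectIntegral h u v y₀ y₁ = 0) : DifferentiableOn ℂ h D := by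
  refine (Complex.isConservativeOn_and_continuousOn_iff_isDifferentiableOn hD).1 ⟨?_, hc⟩
  intro z w hzw
  rw [← add_eq_zero_iff_eq_neg, Complex.wedgeIntegral_add_wedgeIntegral_eq]
  change rectIntegral h z.re w.re z.im w.im = 0
  unfold Complex.Rectangle at hzw
  rcases le_total z.re w.re with h1 | h1 <;> rcases le_total z.im w.im with h2 | h2 <;>
    simp only [uIcc_of_le, uIcc_of_ge, h1, h2] at hzw
  · exact H _ _ _ _ h1 h2 hzw
  · rw [rectIntegral_swap_im, H _ _ _ _ h1 h2 hzw, neg_zero]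
  · rw [rectIntegral_swap_re, H _ _ _ _ h1 h2 hzw, neg_zero]
  · rw [rectIntegral_swap_re, rectIntegral_swap_im, H _ _ _ _ h1 h2 hzw, neg_zero, neg_zero]

/-- Cauchy's theorem on a rectangle for a function that is holomorphic off the graph of a function
`φ` of bounded variation (here: with increments controlled by the integral of `g`). Only the
integrals over the cells of a thin covering of the graph survive; the oscillation of `h` on a cell
is small, and the perimeters of the cells add up to a bounded quantity. -/
lemma rectIntegral_eq_zero_of_graph {h : ℂ → ℂ} {u v y₀ y₁ : ℝ} {φ g : ℝ → ℝ} (huv : u ≤ v)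
    (hy : y₀ ≤ y₁) (hc : ContinuousOn h (Icc u v ×ℂ Icc y₀ y₁))
    (hd : ∀ z ∈ Ioo u v ×ℂ Ioo y₀ y₁, z.im ≠ φ z.re → DifferentiableAt ℂ h z)
    (hφ : ContinuousOn φ (Icc u v)) (hg : IntervalIntegrable g volume u v) (hg0 : ∀ x, 0 ≤ g x)
    (hosc : ∀ s ∈ Icc u v, ∀ t ∈ Icc u v, s ≤ t → |φ t - φ s| ≤ ∫ x in s..t, g x) :
    rectIntegral h u v y₀ y₁ = 0 := by
  have hK : IsCompact (Icc u v ×ℂ Icc y₀ y₁) := isCompact_Icc.reProdIm isCompact_Icc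
  have gint : ∀ s ∈ Icc u v, ∀ t ∈ Icc u v, IntervalIntegrable g volume s t := fun s hs t ht =>
    hg.mono_set (by rw [uIcc_of_le huv]; exact uIcc_subset_Icc hs ht)
  have key : ∀ ε > 0, ∃ δ > 0, ∀ s ∈ Icc u v, ∀ t ∈ Icc u v, s ≤ t → t - s < δ →
      ‖rectIntegral h s t y₀ y₁‖ ≤ ε * (2 * (t - s) + 2 * ∫ x in s..t, g x) := by
    intro ε hε
    obtain ⟨δ₁, hδ₁, H₁⟩ := Metric.uniformContinuousOn_iff.1
      (hK.uniformContinuousOn_of_continuous hc) ε hε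
    obtain ⟨δ₂, hδ₂, H₂⟩ := Metric.uniformContinuousOn_iff.1
      (isCompact_Icc.uniformContinuousOn_of_continuous hφ) (δ₁ / 2) (by positivity)
    refine ⟨min δ₂ (δ₁ / 2), by positivity, fun s hs t ht hst hlt => ?_⟩
    have hsub : Icc s t ⊆ Icc u v := Icc_subset_Icc hs.1 ht.2
    obtain ⟨p, hp, hpm⟩ := isCompact_Icc.exists_isMinOn ⟨s, left_mem_Icc.2 hst⟩ (hφ.mono hsub)
    obtain ⟨q, hq, hqm⟩ := isCompact_Icc.exists_isMaxOn ⟨s, left_mem_Icc.2 hst⟩ (hφ.mono hsub)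
    rw [isMinOn_iff] at hpm
    rw [isMaxOn_iff] at hqm
    have hpq : φ p ≤ φ q := hpm q hq
    -- The graph over `[s, t]` lies in the strip between `m` and `M`.
    set m := max y₀ (min (φ p) y₁) with hm
    set M := max y₀ (min (φ q) y₁) with hM
    have hmM : m ≤ M := by rw [hm, hM]; gcongr
    have hm0 : y₀ ≤ m := le_max_left _ _
    have hM1 : M ≤ y₁ := max_le hy (min_le_right _ _)
    have hMm : M - m ≤ φ q - φ p := by
      rw [hm, hM]
      rcases max_cases y₀ (min (φ p) y₁) with h1 | h1 <;>
      rcases max_cases y₀ (min (φ q) y₁) with h2 | h2 <;>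
      rcases min_cases (φ p) y₁ with h3 | h3 <;>
      rcases min_cases (φ q) y₁ with h4 | h4 <;> linarith
    have hosc' : φ q - φ p ≤ ∫ x in s..t, g x := by
      have mono : ∀ a b, s ≤ a → a ≤ b → b ≤ t → ∫ x in a..b, g x ≤ ∫ x in s..t, g x :=
        fun a b h1 h2 h3 => intervalIntegral.integral_mono_interval h1 h2 h3
          (Eventually.of_forall hg0) (gint s hs t ht)
      rcases le_total p q with h1 | h1
      · exact ((le_abs_self _).trans (hosc p (hsub hp) q (hsub hq) h1)).trans
          (mono p q hp.1 h1 hq.2)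
      · exact ((neg_abs_le _).trans' (neg_le_neg (hosc q (hsub hq) p (hsub hp) h1)) |>.trans'
          (neg_le_neg (mono q p hq.1 h1 hp.2)) |> fun h => by linarith)
    have hc' : ContinuousOn h (Icc s t ×ℂ Icc y₀ y₁) :=
      hc.mono (fun z hz => ⟨hsub hz.1, hz.2⟩)
    have hcm : ∀ a b, y₀ ≤ a → b ≤ y₁ → ContinuousOn h (Icc s t ×ℂ Icc a b) := fun a b ha hb =>
      hc'.mono (fun z hz => ⟨hz.1, Icc_subset_Icc ha hb hz.2⟩)
    have split : rectIntegral h s t y₀ y₁ = rectIntegral h s t m M := by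
      rw [rectIntegral_add_im hc' (s := m) ⟨hm0, hmM.trans hM1⟩ hst,
        rectIntegral_add_im (hcm m y₁ hm0 le_rfl) (s := M) ⟨hmM, hM1⟩ hst,
        rectIntegral_eq_zero hst hm0 (hcm y₀ m le_rfl (hmM.trans hM1)) ?_,
        rectIntegral_eq_zero hst hM1 (hcm M y₁ (hm0.trans hmM) le_rfl) ?_, zero_add, add_zero]
      · intro z hz
        have hz1 : z.re ∈ Ioo s t := hz.1
        have hz2 : z.im ∈ Ioo M y₁ := hz.2
        refine hd z ⟨Ioo_subset_Ioo hs.1 ht.2 hz1, ⟨(hm0.trans hmM).trans_lt hz2.1, hz2.2⟩⟩ ?_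
        have h1 := hqm z.re (Ioo_subset_Icc_self hz1)
        have h2 : min (φ q) y₁ < z.im := (le_max_right _ _).trans_lt hz2.1
        rcases min_lt_iff.1 h2 with h2 | h2
        · linarith
        · exact absurd h2 (not_lt.2 hz2.2.le)
      · intro z hz
        have hz1 : z.re ∈ Ioo s t := hz.1
        have hz2 : z.im ∈ Ioo y₀ m := hz.2
        refine hd z ⟨Ioo_subset_Ioo hs.1 ht.2 hz1, ⟨hz2.1, hz2.2.trans_le (hmM.trans hM1)⟩⟩ ?_
        have h1 := hpm z.re (Ioo_subset_Icc_self hz1)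
        rcases lt_max_iff.1 hz2.2 with h2 | h2
        · exact absurd h2 (not_lt.2 hz2.1.le)
        · have := h2.trans_le (min_le_left _ _)
          linarith
    have hpqd : φ q - φ p < δ₁ / 2 := by
      have h1 : dist q p < δ₂ := by
        rw [Real.dist_eq, abs_lt]
        have := hlt.trans_le (min_le_left _ _)
        constructor <;> linarith [hp.1, hp.2, hq.1, hq.2]
      have := H₂ q (hsub hq) p (hsub hp) h1
      rw [Real.dist_eq] at this
      exact (le_abs_self _).trans_lt this
    rw [split]
    refine (norm_rectIntegral_le_of_sub_const (c := h (s + m * I)) (ε := ε) hst hmM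
      (hcm m M hm0 hM1) ?_).trans ?_
    · intro z hz
      have hz1 : z.re ∈ Icc s t := hz.1
      have hz2 : z.im ∈ Icc m M := hz.2
      rw [← dist_eq_norm]
      refine (H₁ z ⟨hsub hz1, ⟨hm0.trans hz2.1, hz2.2.trans hM1⟩⟩ _ ?_ ?_).le
      · simpa [Complex.mem_reProdIm] using And.intro hs ⟨hm0, hmM.trans hM1⟩
      · rw [dist_eq_norm]
        refine (Complex.norm_le_abs_re_add_abs_im _).trans_lt ?_
        have e1 : |z.re - s| < δ₁ / 2 := by
          have := hlt.trans_le (min_le_right _ _)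
          rw [abs_lt]; constructor <;> linarith [hz1.1, hz1.2]
        have e2 : |z.im - m| < δ₁ / 2 := by
          rw [abs_lt]; constructor <;> linarith [hz2.1, hz2.2]
        simp only [Complex.sub_re, Complex.sub_im, Complex.add_re, Complex.add_im,
          Complex.ofReal_re, Complex.ofReal_im, Complex.mul_re, Complex.mul_im, Complex.I_re,
          Complex.I_im]
        ring_nf at e1 e2 ⊢
        linarith
    · gcongr
      exact hMm.trans hosc'
  have bound : ∀ ε > 0, ‖rectIntegral h u v y₀ y₁‖ ≤
      ε * (2 * (v - u) + 2 * ∫ x in u..v, g x) := by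
    intro ε hε
    obtain ⟨δ, hδ, H⟩ := key ε hε
    have step : ∀ n : ℕ, ∀ t ∈ Icc u v, t - u ≤ n * (δ / 2) →
        ‖rectIntegral h u t y₀ y₁‖ ≤ ε * (2 * (t - u) + 2 * ∫ x in u..t, g x) := by
      intro n
      induction n with
      | zero =>
        intro t ht h0
        exact H u (left_mem_Icc.2 huv) t ht ht.1 (by simp at h0; linarith)
      | succ n ih =>
        intro t ht h0
        push_cast at h0
        rcases lt_or_ge (t - u) δ with h1 | h1
        · exact H u (left_mem_Icc.2 huv) t ht ht.1 h1
        · have hs : t - δ / 2 ∈ Icc u v := ⟨by linarith, by linarith [ht.2]⟩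
          have hus : t - δ / 2 ∈ Icc u t := ⟨hs.1, by linarith⟩
          have hct : ContinuousOn h (Icc u t ×ℂ Icc y₀ y₁) :=
            hc.mono fun z hz => ⟨Icc_subset_Icc le_rfl ht.2 hz.1, hz.2⟩
          have h2 := ih _ hs (by linarith)
          have h3 := H _ hs t ht (by linarith) (by linarith)
          rw [rectIntegral_add_re hct hus hy]
          have h4 := intervalIntegral.integral_add_adjacent_intervals
            (gint u (left_mem_Icc.2 huv) _ hs) (gint _ hs t ht)
          refine (norm_add_le _ _).trans ((add_le_add h2 h3).trans (le_of_eq ?_))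
          rw [← h4]
          ring
    obtain ⟨n, hn⟩ := exists_nat_ge ((v - u) / (δ / 2))
    exact step n v (right_mem_Icc.2 huv) ((div_le_iff₀ (by positivity)).1 hn)
  have hlim : Tendsto (fun ε : ℝ => ε * (2 * (v - u) + 2 * ∫ x in u..v, g x)) (𝓝[>] 0) (𝓝 0) := by
    have : Tendsto (fun ε : ℝ => ε * (2 * (v - u) + 2 * ∫ x in u..v, g x)) (𝓝 0) (𝓝 (0 * _)) :=
      tendsto_id.mul_const _
    rw [zero_mul] at this
    exact this.mono_left nhdsWithin_le_nhds
  have := ge_of_tendsto hlim (eventually_mem_nhdsWithin.mono fun ε hε => bound ε hε)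
  exact norm_le_zero_iff.1 this

/-- A horizontal line is removable for continuous functions that are holomorphic off it. -/
lemma differentiableOn_of_horizontal_line {h : ℂ → ℂ} {D : Set ℂ} (hD : IsOpen D) (c : ℝ)
    (hc : ContinuousOn h D) (hd : ∀ z ∈ D, z.im ≠ c → DifferentiableAt ℂ h z) :
    DifferentiableOn ℂ h D := by
  refine differentiableOn_of_rectIntegral_eq_zero hD hc fun u v y₀ y₁ huv hy hsub => ?_
  refine rectIntegral_eq_zero_of_graph (φ := fun _ => c) (g := fun _ => 0) huv hy (hc.mono hsub)
    (fun z hz hne => hd z (hsub ⟨Ioo_subset_Icc_self hz.1, Ioo_subset_Icc_self hz.2⟩) hne)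
    continuousOn_const (by simp) (fun _ => le_rfl) (by simp)

/-- The integral of `1 / (s - ζ)` over a rectangle around `ζ`. On the sides other than the left one
`log (s - ζ)` is a primitive, on the left side `log (ζ - s)` is. -/
lemma rectIntegral_inv_sub {u v y₀ y₁ : ℝ} {ζ : ℂ} (hu : u < ζ.re) (hv : ζ.re < v)
    (h0 : y₀ < ζ.im) (h1 : ζ.im < y₁) :
    rectIntegral (fun s => 1 / (s - ζ)) u v y₀ y₁ = 2 * Real.pi * I := by
  have hor (y : ℝ) (hy : y ≠ ζ.im) : ∫ x in u..v, 1 / ((x + y * I : ℂ) - ζ) =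
      Complex.log (v + y * I - ζ) - Complex.log (u + y * I - ζ) := by
    refine intervalIntegral.integral_eq_sub_of_hasDerivAt
      (f := fun x : ℝ => Complex.log (x + y * I - ζ)) (fun x _ => ?_) ?_
    · have hs : (x + y * I - ζ : ℂ) ∈ Complex.slitPlane := by
        right; simpa [sub_eq_zero] using hy
      simpa using ((Complex.hasDerivAt_log hs).comp (x : ℂ)
        (((hasDerivAt_id (x : ℂ)).add_const (y * I)).sub_const ζ)).comp_ofReal
    · apply ContinuousOn.intervalIntegrable
      refine continuousOn_const.div (by fun_prop) fun x _ h => hy ?_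
      have := congrArg Complex.im h
      simpa [sub_eq_zero] using this
  have verR : I * ∫ y in y₀..y₁, 1 / ((v + y * I : ℂ) - ζ) =
      Complex.log (v + y₁ * I - ζ) - Complex.log (v + y₀ * I - ζ) := by
    rw [← intervalIntegral.integral_const_mul]
    refine intervalIntegral.integral_eq_sub_of_hasDerivAt
      (f := fun y : ℝ => Complex.log (v + y * I - ζ)) (fun y _ => ?_) ?_
    · have hs : (v + y * I - ζ : ℂ) ∈ Complex.slitPlane := by
        left; simpa using hv
      have := ((Complex.hasDerivAt_log hs).comp (y : ℂ)
        ((((hasDerivAt_id (y : ℂ)).mul_const I).const_add (v : ℂ)).sub_const ζ)).comp_ofReal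
      simpa [div_eq_mul_inv, mul_comm] using this
    · apply ContinuousOn.intervalIntegrable
      refine continuousOn_const.mul (continuousOn_const.div (by fun_prop) fun x _ h => hv.ne ?_)
      have := congrArg Complex.re h
      simp at this
      linarith
  have verL : I * ∫ y in y₀..y₁, 1 / ((u + y * I : ℂ) - ζ) =
      Complex.log (-(u + y₁ * I - ζ)) - Complex.log (-(u + y₀ * I - ζ)) := by
    rw [← intervalIntegral.integral_const_mul]
    refine intervalIntegral.integral_eq_sub_of_hasDerivAt
      (f := fun y : ℝ => Complex.log (-(u + y * I - ζ))) (fun y _ => ?_) ?_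
    · have hs : (-(u + y * I - ζ) : ℂ) ∈ Complex.slitPlane := by
        left; simpa using hu
      have := ((Complex.hasDerivAt_log hs).comp (y : ℂ)
        ((((hasDerivAt_id (y : ℂ)).mul_const I).const_add (u : ℂ)).sub_const ζ).fun_neg).comp_ofReal
      refine this.congr_deriv ?_
      rw [inv_neg, neg_mul_neg, one_mul, one_div, mul_comm]
    · apply ContinuousOn.intervalIntegrable
      refine continuousOn_const.mul (continuousOn_const.div (by fun_prop) fun x _ h => hu.ne' ?_)
      have := congrArg Complex.re h
      simp at this
      linarith
  have logneg (z : ℂ) (hz : z.im ≠ 0) : Complex.log (-z) =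
      Complex.log z + (if 0 < z.im then -1 else 1) * Real.pi * I := by
    rcases lt_or_gt_of_ne hz with h | h
    · apply Complex.ext
      · simp [Complex.log_re, h.le.not_gt]
      · simp [Complex.log_im, Complex.arg_neg_eq_arg_add_pi_of_im_neg h, h.le.not_gt]
    · apply Complex.ext
      · simp [Complex.log_re, h]
      · simp [Complex.log_im, Complex.arg_neg_eq_arg_sub_pi_of_im_pos h, h, sub_eq_add_neg]
  unfold rectIntegral
  rw [hor y₀ h0.ne, hor y₁ h1.ne', verR, verL,
    logneg (u + y₁ * I - ζ) (by simpa [sub_eq_zero] using h1.ne'),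
    logneg (u + y₀ * I - ζ) (by simpa [sub_eq_zero] using h0.ne)]
  simp [h1, h0.le.not_gt]
  ring

/-! ### Partial fractions -/

/-- Finitely many singularities, each of order less than one, can be removed. -/
lemma exists_differentiableOn_extension {Ω S : Set ℂ} (hΩ : IsOpen Ω) (hS : S.Finite) {g : ℂ → ℂ}
    (hd : DifferentiableOn ℂ g (Ω \ S))
    (hres : ∀ p ∈ S, Tendsto (fun z => (z - p) * g z) (𝓝[≠] p) (𝓝 0)) :
    ∃ E : ℂ → ℂ, DifferentiableOn ℂ E Ω ∧ ∀ z ∈ Ω \ S, E z = g z := by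
  induction S, hS using Set.Finite.induction_on generalizing g with
  | empty => exact ⟨g, by simpa using hd, fun _ _ => rfl⟩
  | @insert p S hpS hS ih =>
    by_cases hp : p ∈ Ω
    · have hopen : IsOpen (Ω \ S) := hΩ.sdiff hS.isClosed
      have hd' : DifferentiableOn ℂ (Function.update g p (limUnder (𝓝[≠] p) g)) (Ω \ S) := by
        refine Complex.differentiableOn_update_limUnder_of_isLittleO
          (hopen.mem_nhds ⟨hp, hpS⟩) (hd.mono fun z hz => ⟨hz.1.1, ?_⟩) ?_
        · rintro (h | h)
          exacts [hz.2 h, hz.1.2 h]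
        · refine (isLittleO_iff_tendsto' ?_).2 ?_
          · filter_upwards [self_mem_nhdsWithin] with z hz h
            exact absurd (inv_eq_zero.1 h) (sub_ne_zero.2 hz)
          · have h1 := hres p (mem_insert _ _)
            have h2 : Tendsto (fun z => (z - p) * g p) (𝓝[≠] p) (𝓝 0) := by
              have : Tendsto (fun z : ℂ => (z - p) * g p) (𝓝 p) (𝓝 ((p - p) * g p)) :=
                (tendsto_id.sub_const p).mul_const _
              simpa using this.mono_left nhdsWithin_le_nhds
            simpa [div_eq_mul_inv, mul_comm, mul_sub] using h1.sub h2
      obtain ⟨E, hE, hEg⟩ := ih hd' fun q hq => by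
        have hqp : q ≠ p := fun h => hpS (h ▸ hq)
        refine (hres q (mem_insert_of_mem _ hq)).congr' ?_
        filter_upwards [nhdsWithin_le_nhds (isOpen_ne.mem_nhds hqp)] with z hz
        rw [Function.update_of_ne hz]
      refine ⟨E, hE, fun z hz => ?_⟩
      have hzp : z ≠ p := fun h => hz.2 (h ▸ mem_insert _ _)
      rw [hEg z ⟨hz.1, fun h => hz.2 (mem_insert_of_mem _ h)⟩, Function.update_of_ne hzp]
    · have he : Ω \ insert p S = Ω \ S := by
        ext z
        refine ⟨fun h => ⟨h.1, fun h' => h.2 (mem_insert_of_mem _ h')⟩, fun h => ⟨h.1, ?_⟩⟩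
        rintro (h' | h')
        exacts [hp (h' ▸ h.1), h.2 h']
      rw [he] at hd ⊢
      exact ih hd fun q hq => hres q (mem_insert_of_mem _ hq)

/-- The poles `-i (1 + κ k)`, `k = 0, 1, 2, …`. -/
def pole (κ : ℝ) (k : ℕ) : ℂ := (-(1 + κ * k) : ℝ) * I

lemma pole_re (κ : ℝ) (k : ℕ) : (pole κ k).re = 0 := by simp [pole]

lemma pole_im (κ : ℝ) (k : ℕ) : (pole κ k).im = -(1 + κ * k) := by simp [pole]

lemma norm_pole {κ : ℝ} (hκ : 0 < κ) (k : ℕ) : ‖pole κ k‖ = 1 + κ * k := by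
  rw [pole, norm_mul, Complex.norm_I, mul_one, Complex.norm_real, norm_neg, Real.norm_of_nonneg]
  positivity

lemma pole_injective {κ : ℝ} (hκ : 0 < κ) : Function.Injective (pole κ) := by
  intro j k h
  have := congrArg Complex.im h
  simp only [pole_im, neg_inj, add_right_inj] at this
  exact_mod_cast mul_left_cancel₀ hκ.ne' this

lemma tendsto_norm_sub_pole {κ : ℝ} (hκ : 0 < κ) (ζ : ℂ) :
    Tendsto (fun k => ‖ζ - pole κ k‖) atTop atTop := by
  refine tendsto_atTop_mono (f := fun k : ℕ => (1 + κ * k) - ‖ζ‖) (fun k => ?_) ?_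
  · rw [← norm_pole hκ, norm_sub_rev]
    exact norm_sub_norm_le _ _
  · exact tendsto_atTop_add_const_right _ _
      (tendsto_atTop_add_const_left _ _ (tendsto_natCast_atTop_atTop.const_mul_atTop hκ))

lemma tendsto_pole_cobounded {κ : ℝ} (hκ : 0 < κ) :
    Tendsto (pole κ) atTop (Bornology.cobounded ℂ) := by
  rw [← tendsto_norm_atTop_iff_cobounded]
  simpa using tendsto_norm_sub_pole hκ 0

lemma summable_div_sub_pole {κ : ℝ} (hκ : 0 < κ) {q : ℕ → ℂ} (hq : Summable fun k => ‖q k‖)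
    (ζ : ℂ) : Summable fun k => q k / (ζ - pole κ k) := by
  refine Summable.of_norm_bounded_eventually_nat hq ?_
  filter_upwards [(tendsto_norm_sub_pole hκ ζ).eventually_ge_atTop 1] with k hk
  rw [norm_div]
  exact div_le_self (norm_nonneg _) hk

/-- Subtracting the first principal parts leaves a function that is holomorphic further down. -/
lemma exists_holomorphic_of_simple_poles {κ : ℝ} (hκ : 0 < κ) {F : ℂ → ℂ} {q : ℕ → ℂ}
    (hd : DifferentiableOn ℂ F (range (pole κ))ᶜ)
    (hres : ∀ k, Tendsto (fun z => (z - pole κ k) * F z) (𝓝[≠] pole κ k) (𝓝 (q k))) (N : ℕ) :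
    ∃ E : ℂ → ℂ, DifferentiableOn ℂ E {z | -(1 + κ * (N + 1)) < z.im} ∧
      ∀ z, -(1 + κ * (N + 1)) < z.im → z ∉ range (pole κ) →
        E z = F z - ∑ k ∈ Finset.range (N + 1), q k / (z - pole κ k) := by
  have hΩ : IsOpen {z : ℂ | -(1 + κ * (N + 1)) < z.im} :=
    isOpen_lt continuous_const Complex.continuous_im
  have hsub : ∀ z : ℂ, -(1 + κ * (N + 1)) < z.im →
      z ∉ pole κ '' (Finset.range (N + 1) : Set ℕ) → z ∉ range (pole κ) := by
    rintro _ hz hz' ⟨k, rfl⟩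
    refine hz' ⟨k, ?_, rfl⟩
    rw [pole_im] at hz
    have : (k : ℝ) < N + 1 := lt_of_mul_lt_mul_left (by linarith) hκ.le
    simp only [Finset.coe_range, mem_Iio]
    exact_mod_cast this
  have h1 : DifferentiableOn ℂ (fun z => F z - ∑ k ∈ Finset.range (N + 1), q k / (z - pole κ k))
      ({z | -(1 + κ * (N + 1)) < z.im} \ pole κ '' (Finset.range (N + 1) : Set ℕ)) := by
    refine (hd.mono fun z hz => hsub z hz.1 hz.2).sub ?_
    refine DifferentiableOn.fun_sum fun k hk => ?_
    refine (differentiableOn_const _).div (differentiableOn_id.sub_const _) fun z hz h => ?_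
    exact hz.2 ⟨k, by simpa using hk, (sub_eq_zero.1 h).symm⟩
  have h2 : ∀ p ∈ pole κ '' (Finset.range (N + 1) : Set ℕ), Tendsto (fun z => (z - p) *
      (F z - ∑ k ∈ Finset.range (N + 1), q k / (z - pole κ k))) (𝓝[≠] p) (𝓝 0) := by
    rintro _ ⟨j, hj, rfl⟩
    have hsum : Tendsto (fun z => ∑ k ∈ Finset.range (N + 1),
        (z - pole κ j) * (q k / (z - pole κ k))) (𝓝[≠] pole κ j)
        (𝓝 (∑ k ∈ Finset.range (N + 1), if j = k then q k else 0)) := by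
      refine tendsto_finsetSum _ fun k _ => ?_
      split_ifs with hjk
      · subst hjk
        refine tendsto_const_nhds.congr' ?_
        filter_upwards [self_mem_nhdsWithin] with z hz
        rw [mul_div_cancel₀ _ (sub_ne_zero.2 hz)]
      · have hne : pole κ j - pole κ k ≠ 0 := sub_ne_zero.2 fun h => hjk (pole_injective hκ h)
        have : Tendsto (fun z => (z - pole κ j) * (q k / (z - pole κ k))) (𝓝 (pole κ j))
            (𝓝 ((pole κ j - pole κ j) * (q k / (pole κ j - pole κ k)))) :=
          (tendsto_id.sub_const _).mul (tendsto_const_nhds.div (tendsto_id.sub_const _) hne)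
        rw [sub_self, zero_mul] at this
        exact this.mono_left nhdsWithin_le_nhds
    have hj' : j ∈ Finset.range (N + 1) := by simpa using hj
    rw [Finset.sum_ite_eq, if_pos hj'] at hsum
    have := (hres j).sub hsum
    simpa [mul_sub, Finset.mul_sum] using this
  obtain ⟨E, hE, hEg⟩ := exists_differentiableOn_extension hΩ ((Finset.finite_toSet _).image _) h1 h2
  exact ⟨E, hE, fun z hz hz' => hEg z ⟨hz, fun h => hz' (image_subset_range _ _ h)⟩⟩

/-- Partial fraction expansion of a function with simple poles at `-i (1 + κ k)` and summable
residues, which is close to `δ` on large squares avoiding the poles. It follows from the maximum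
modulus principle on these squares. -/
lemma eq_add_tsum_of_simple_poles {κ : ℝ} (hκ : 0 < κ) {F : ℂ → ℂ} {q : ℕ → ℂ} {δ : ℂ}
    (hq : Summable fun k => ‖q k‖) (hd : DifferentiableOn ℂ F (range (pole κ))ᶜ)
    (hres : ∀ k, Tendsto (fun z => (z - pole κ k) * F z) (𝓝[≠] pole κ k) (𝓝 (q k)))
    (hinf : ∀ ε > 0, ∀ᶠ N : ℕ in atTop, ∀ z : ℂ, max |z.re| |z.im| = 1 + κ * (N + 1 / 2) →
      ‖F z - δ‖ ≤ ε) {ζ : ℂ} (hζ : ζ ∉ range (pole κ)) :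
    F ζ = δ + ∑' k, q k / (ζ - pole κ k) := by
  -- `S N` bounds the first `N + 1` principal parts on the square with half-side `1 + κ (N + 1/2)`,
  -- whose points are at distance at least `κ (N + 1/2 - k)` from the `k`-th pole.
  set S : ℕ → ℝ := fun N => ∑' k, if k ≤ N then ‖q k‖ / (κ * (N + 1 / 2 - k)) else 0 with hSdef
  have hterm : ∀ N k : ℕ, k ≤ N → κ / 2 ≤ κ * ((N : ℝ) + 1 / 2 - k) := fun N k hk => by
    have : (k : ℝ) ≤ N := by exact_mod_cast hk
    nlinarith
  have hS : Tendsto S atTop (𝓝 0) := by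
    have : Tendsto S atTop (𝓝 (∑' _ : ℕ, (0 : ℝ))) := by
      refine tendsto_tsum_of_dominated_convergence (bound := fun k => ‖q k‖ * (2 / κ))
        (hq.mul_right _) (fun k => ?_) (Eventually.of_forall fun N k => ?_)
      · have h1 : Tendsto (fun N : ℕ => ‖q k‖ / (κ * ((N : ℝ) + 1 / 2 - k))) atTop (𝓝 0) := by
          refine tendsto_const_nhds.div_atTop (Tendsto.const_mul_atTop hκ ?_)
          exact tendsto_atTop_add_const_right _ _
            (tendsto_atTop_add_const_right _ _ tendsto_natCast_atTop_atTop)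
        refine h1.congr' ?_
        filter_upwards [eventually_ge_atTop k] with N hN
        rw [if_pos hN]
      · split_ifs with hk
        · have h0 := hterm N k hk
          have h1 : 0 < κ * ((N : ℝ) + 1 / 2 - k) := lt_of_lt_of_le (by positivity) h0
          rw [Real.norm_of_nonneg (by positivity), div_eq_mul_inv]
          gcongr
          rw [show 2 / κ = (κ / 2)⁻¹ by field_simp]
          exact inv_anti₀ (by positivity) h0
        · rw [norm_zero]; positivity
    simpa using this
  have hlim : Tendsto (fun N : ℕ => F ζ - ∑ k ∈ Finset.range (N + 1), q k / (ζ - pole κ k)) atTop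
      (𝓝 δ) := by
    rw [Metric.tendsto_atTop']
    intro ε hε
    have hbig : ∀ᶠ N : ℕ in atTop, ‖ζ‖ < 1 + κ * ((N : ℝ) + 1 / 2) :=
      (tendsto_atTop_add_const_left _ _ (Tendsto.const_mul_atTop hκ
        (tendsto_atTop_add_const_right _ _ tendsto_natCast_atTop_atTop))).eventually_gt_atTop _
    obtain ⟨N₀, hN₀⟩ := eventually_atTop.1
      ((hinf (ε / 3) (by positivity)).and ((hS.eventually_lt_const (show 0 < ε / 3 by positivity)).and
        hbig))
    refine ⟨N₀, fun N hN => ?_⟩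
    obtain ⟨h1, h2, h3⟩ := hN₀ N hN.le
    set ρ := 1 + κ * ((N : ℝ) + 1 / 2) with hρ
    have hρ0 : 0 < ρ := by positivity
    obtain ⟨E, hE, hEF⟩ := exists_holomorphic_of_simple_poles hκ hd hres N
    have hρN : -(1 + κ * ((N : ℝ) + 1)) < -ρ := by rw [hρ]; nlinarith
    have hcl : Icc (-ρ) ρ ×ℂ Icc (-ρ) ρ ⊆ {z : ℂ | -(1 + κ * ((N : ℝ) + 1)) < z.im} :=
      fun z hz => hρN.trans_le hz.2.1
    have hζim := (Complex.abs_im_le_norm ζ).trans_lt h3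
    have hζre := (Complex.abs_re_le_norm ζ).trans_lt h3
    rw [abs_lt] at hζim hζre
    have hmax : ‖E ζ - δ‖ ≤ ε / 3 + S N := by
      refine Complex.norm_le_of_forall_mem_frontier_norm_le
        (U := Ioo (-ρ) ρ ×ℂ Ioo (-ρ) ρ) (f := fun z => E z - δ)
        (Bornology.IsBounded.reProdIm (Metric.isBounded_Ioo _ _) (Metric.isBounded_Ioo _ _)) ?_ ?_
        (subset_closure ⟨hζre, hζim⟩)
      · refine (DifferentiableOn.sub_const (hE.mono ?_) δ).diffContOnCl
        rw [Complex.closure_reProdIm, closure_Ioo (by linarith)]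
        exact hcl
      · intro z hz
        have hzm : max |z.re| |z.im| = ρ := by
          rw [Complex.frontier_reProdIm, closure_Ioo (by linarith), frontier_Ioo (by linarith)] at hz
          rcases hz with ⟨hz1, hz2⟩ | ⟨hz1, hz2⟩
          · have h1 : z.re ∈ Icc (-ρ) ρ := hz1
            have h2 : |z.im| = ρ := by
              rcases hz2 with h | h
              · rw [h, abs_neg, abs_of_pos hρ0]
              · rw [mem_singleton_iff.1 h, abs_of_pos hρ0]
            rw [h2]
            exact max_eq_right (abs_le.2 h1)
          · have h1 : z.im ∈ Icc (-ρ) ρ := hz2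
            have h2 : |z.re| = ρ := by
              rcases hz1 with h | h
              · rw [h, abs_neg, abs_of_pos hρ0]
              · rw [mem_singleton_iff.1 h, abs_of_pos hρ0]
            rw [h2]
            exact max_eq_left (abs_le.2 h1)
        have hzn : ρ ≤ ‖z‖ := by
          rw [← hzm]
          exact max_le (Complex.abs_re_le_norm z) (Complex.abs_im_le_norm z)
        have hzp : ∀ k : ℕ, κ * ((N : ℝ) + 1 / 2 - k) ≤ ‖z - pole κ k‖ := fun k => by
          have := norm_sub_norm_le z (pole κ k)
          rw [norm_pole hκ] at this
          rw [hρ] at hzn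
          linarith
        have hzim : -ρ ≤ z.im := by
          have := (le_max_right |z.re| |z.im|).trans hzm.le
          exact (abs_le.1 this).1
        have hzr : z ∉ range (pole κ) := by
          rintro ⟨k, rfl⟩
          rw [pole_re, pole_im, abs_zero, abs_neg, abs_of_nonneg (by positivity),
            max_eq_right (by positivity), hρ, add_right_inj] at hzm
          have h5 : (k : ℝ) = N + 1 / 2 := mul_left_cancel₀ hκ.ne' hzm
          have h6 : ((2 * k : ℕ) : ℝ) = ((2 * N + 1 : ℕ) : ℝ) := by push_cast; linarith
          have h7 : 2 * k = 2 * N + 1 := by exact_mod_cast h6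
          omega
        have hsum : ‖∑ k ∈ Finset.range (N + 1), q k / (z - pole κ k)‖ ≤ S N := by
          refine (norm_sum_le _ _).trans ?_
          rw [hSdef]
          simp only
          rw [tsum_eq_sum (s := Finset.range (N + 1))]
          · refine Finset.sum_le_sum fun k hk => ?_
            have hk' : k ≤ N := Nat.lt_succ_iff.1 (Finset.mem_range.1 hk)
            rw [if_pos hk', norm_div]
            have h0 := hterm N k hk'
            have h1 : 0 < κ * ((N : ℝ) + 1 / 2 - k) := lt_of_lt_of_le (by positivity) h0
            exact div_le_div_of_nonneg_left (norm_nonneg _) h1 (hzp k)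
          · intro k hk
            rw [if_neg fun h => hk (Finset.mem_range.2 (Nat.lt_succ_of_le h))]
        rw [hEF z (hρN.trans_le hzim) hzr, sub_right_comm]
        refine (norm_sub_le _ _).trans (add_le_add (h1 z hzm) hsum)
    rw [dist_eq_norm, ← hEF ζ (hρN.trans hζim.1) hζ]
    linarith
  have hsum := (summable_div_sub_pole hκ hq ζ).hasSum.tendsto_sum_nat.comp (tendsto_add_atTop_nat 1)
  have := tendsto_nhds_unique hlim (hsum.const_sub (F ζ))
  rw [this]
  ring

/-! ### Cauchy's formula for a pair of half-planes -/

/-- The boundary of the rectangle `[u, v] × [y₀, y₁]`. -/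
def rectBoundary (u v y₀ y₁ : ℝ) : Set ℂ :=
  {z | z.re ∈ Icc u v ∧ z.im ∈ Icc y₀ y₁ ∧ (z.re = u ∨ z.re = v ∨ z.im = y₀ ∨ z.im = y₁)}

lemma rectIntegral_congr {f g : ℂ → ℂ} {u v y₀ y₁ : ℝ} (huv : u ≤ v) (hy : y₀ ≤ y₁)
    (h : EqOn f g (rectBoundary u v y₀ y₁)) :
    rectIntegral f u v y₀ y₁ = rectIntegral g u v y₀ y₁ := by
  unfold rectIntegral
  congr 1
  · congr 1
    · congr 1 <;>
      · refine intervalIntegral.integral_congr fun x hx => h ?_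
        rw [uIcc_of_le huv] at hx
        refine ⟨by simpa using hx, by simpa using hy, by simp⟩
    · congr 1
      refine intervalIntegral.integral_congr fun x hx => h ?_
      rw [uIcc_of_le hy] at hx
      refine ⟨by simpa using huv, by simpa using hx, by simp⟩
  · congr 1
    refine intervalIntegral.integral_congr fun x hx => h ?_
    rw [uIcc_of_le hy] at hx
    refine ⟨by simpa using huv, by simpa using hx, by simp⟩

lemma rectIntegral_add {f g : ℂ → ℂ} {u v y₀ y₁ : ℝ} (huv : u ≤ v) (hy : y₀ ≤ y₁)
    (hf : ContinuousOn f (rectBoundary u v y₀ y₁)) (hg : ContinuousOn g (rectBoundary u v y₀ y₁)) :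
    rectIntegral (fun z => f z + g z) u v y₀ y₁ =
      rectIntegral f u v y₀ y₁ + rectIntegral g u v y₀ y₁ := by
  have hor {f : ℂ → ℂ} (hf : ContinuousOn f (rectBoundary u v y₀ y₁)) (y : ℝ)
      (hy' : y = y₀ ∨ y = y₁) : IntervalIntegrable (fun x : ℝ => f (x + y * I)) volume u v := by
    refine ContinuousOn.intervalIntegrable (hf.comp (by fun_prop) fun x hx => ?_)
    rw [uIcc_of_le huv] at hx
    refine ⟨by simpa using hx, ?_, by simpa using Or.inr (Or.inr hy')⟩
    rcases hy' with rfl | rfl <;> simpa using hy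
  have ver {f : ℂ → ℂ} (hf : ContinuousOn f (rectBoundary u v y₀ y₁)) (x : ℝ)
      (hx' : x = u ∨ x = v) : IntervalIntegrable (fun y : ℝ => f (x + y * I)) volume y₀ y₁ := by
    refine ContinuousOn.intervalIntegrable (hf.comp (by fun_prop) fun y hy' => ?_)
    rw [uIcc_of_le hy] at hy'
    refine ⟨?_, by simpa using hy', by simp; tauto⟩
    rcases hx' with rfl | rfl <;> simpa using huv
  simp only [rectIntegral]
  rw [intervalIntegral.integral_add (hor hf y₀ (Or.inl rfl)) (hor hg y₀ (Or.inl rfl)),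
    intervalIntegral.integral_add (hor hf y₁ (Or.inr rfl)) (hor hg y₁ (Or.inr rfl)),
    intervalIntegral.integral_add (ver hf u (Or.inl rfl)) (ver hg u (Or.inl rfl)),
    intervalIntegral.integral_add (ver hf v (Or.inr rfl)) (ver hg v (Or.inr rfl))]
  ring

lemma rectIntegral_const_mul (c : ℂ) (f : ℂ → ℂ) (u v y₀ y₁ : ℝ) :
    rectIntegral (fun z => c * f z) u v y₀ y₁ = c * rectIntegral f u v y₀ y₁ := by
  simp only [rectIntegral, intervalIntegral.integral_const_mul]
  ring

/-- Cauchy's integral formula for a rectangle. -/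
lemma rectIntegral_div_sub {G : ℂ → ℂ} {u v y₀ y₁ : ℝ} {ζ : ℂ}
    (hc : ContinuousOn G (Icc u v ×ℂ Icc y₀ y₁))
    (hd : DifferentiableOn ℂ G (Ioo u v ×ℂ Ioo y₀ y₁)) (hu : u < ζ.re) (hv : ζ.re < v)
    (h0 : y₀ < ζ.im) (h1 : ζ.im < y₁) :
    rectIntegral (fun s => G s / (s - ζ)) u v y₀ y₁ = 2 * Real.pi * I * G ζ := by
  have huv := (hu.trans hv).le
  have hy := (h0.trans h1).le
  have hint : Ioo u v ×ℂ Ioo y₀ y₁ ∈ 𝓝 ζ :=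
    (isOpen_Ioo.reProdIm isOpen_Ioo).mem_nhds ⟨⟨hu, hv⟩, ⟨h0, h1⟩⟩
  have hcl : Icc u v ×ℂ Icc y₀ y₁ ∈ 𝓝 ζ := mem_of_superset hint fun z hz =>
    ⟨Ioo_subset_Icc_self hz.1, Ioo_subset_Icc_self hz.2⟩
  have hz : rectIntegral (dslope G ζ) u v y₀ y₁ = 0 := by
    refine rectIntegral_eq_zero huv hy
      ((continuousOn_dslope hcl).2 ⟨hc, hd.differentiableAt hint⟩) fun z hz => ?_
    exact ((Complex.differentiableOn_dslope hint).2 hd).differentiableAt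
      ((isOpen_Ioo.reProdIm isOpen_Ioo).mem_nhds hz)
  have hne : ∀ z ∈ rectBoundary u v y₀ y₁, z ≠ ζ := by
    rintro z ⟨_, _, h⟩ rfl
    rcases h with h | h | h | h <;> linarith
  have hinv : ContinuousOn (fun s => 1 / (s - ζ)) (rectBoundary u v y₀ y₁) :=
    continuousOn_const.div (by fun_prop) fun z hz => sub_ne_zero.2 (hne z hz)
  have hsub : rectBoundary u v y₀ y₁ ⊆ Icc u v ×ℂ Icc y₀ y₁ := fun z hz => ⟨hz.1, hz.2.1⟩
  rw [rectIntegral_congr (g := fun s => dslope G ζ s + G ζ * (1 / (s - ζ))) huv hy,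
    rectIntegral_add huv hy, hz, rectIntegral_const_mul, rectIntegral_inv_sub hu hv h0 h1]
  · ring
  · exact ((continuousOn_dslope hcl).2 ⟨hc, hd.differentiableAt hint⟩).mono hsub
  · exact continuousOn_const.mul hinv
  · intro z hz
    simp only
    have := sub_ne_zero.2 (hne z hz)
    rw [dslope_of_ne _ (hne z hz), slope_def_field]
    field_simp
    ring

lemma exists_norm_sub_le_of_tendsto {G : ℂ → ℂ} {T : Set ℂ} {δ : ℂ}
    (h : Tendsto G (Bornology.cobounded ℂ ⊓ 𝓟 T) (𝓝 δ)) {ε : ℝ} (hε : 0 < ε) :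
    ∃ r : ℝ, ∀ z ∈ T, r ≤ ‖z‖ → ‖G z - δ‖ ≤ ε := by
  have := h.eventually (Metric.closedBall_mem_nhds δ hε)
  obtain ⟨r, _, hr⟩ := (hasBasis_cobounded_norm.inf_principal T).eventually_iff.1 this
  refine ⟨r, fun z hz hrz => ?_⟩
  simpa [dist_eq_norm] using hr ⟨hrz, hz⟩

/-- Let `G` be continuous on the closed lower half-plane and `H` on the closed upper one, both
holomorphic inside and with the same limit `δ` at infinity. Then `G` is, in the lower half-plane,
the constant `δ` plus the Cauchy integral of its jump `H - G` across the real line. -/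
lemma eq_add_integral_of_half_planes {G H : ℂ → ℂ} {δ ζ : ℂ}
    (hG : ContinuousOn G {z | z.im ≤ 0}) (hGd : DifferentiableOn ℂ G {z | z.im < 0})
    (hGi : Tendsto G (Bornology.cobounded ℂ ⊓ 𝓟 {z | z.im ≤ 0}) (𝓝 δ))
    (hH : ContinuousOn H {z | 0 ≤ z.im}) (hHd : DifferentiableOn ℂ H {z | 0 < z.im})
    (hHi : Tendsto H (Bornology.cobounded ℂ ⊓ 𝓟 {z | 0 ≤ z.im}) (𝓝 δ)) (hζ : ζ.im < 0)
    (hint : Integrable fun s : ℝ => (H s - G s) / (s - ζ)) :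
    G ζ = δ + 1 / (2 * Real.pi * I) * ∫ s : ℝ, (H s - G s) / (s - ζ) := by
  have hpi : (2 * Real.pi * I : ℂ) ≠ 0 := by simp [Real.pi_ne_zero]
  have hlim : Tendsto (fun R : ℝ => ∫ s in (-R)..R, (H s - G s) / (s - ζ)) atTop
      (𝓝 (∫ s : ℝ, (H s - G s) / (s - ζ))) :=
    intervalIntegral_tendsto_integral hint tendsto_neg_atTop_atBot tendsto_id
  have hlim' : Tendsto (fun R : ℝ => ∫ s in (-R)..R, (H s - G s) / (s - ζ)) atTop
      (𝓝 (2 * Real.pi * I * (G ζ - δ))) := by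
    rw [Metric.tendsto_atTop]
    intro ε hε
    obtain ⟨r₁, hr₁⟩ := exists_norm_sub_le_of_tendsto hGi (show 0 < ε / 20 by positivity)
    obtain ⟨r₂, hr₂⟩ := exists_norm_sub_le_of_tendsto hHi (show 0 < ε / 20 by positivity)
    refine ⟨max (max r₁ r₂) (2 * ‖ζ‖ + 1), fun R hR => ?_⟩
    have hR1 : r₁ ≤ R := (le_max_left _ _).trans ((le_max_left _ _).trans hR)
    have hR2 : r₂ ≤ R := (le_max_right _ _).trans ((le_max_left _ _).trans hR)
    have hR3 : 2 * ‖ζ‖ + 1 ≤ R := (le_max_right _ _).trans hR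
    have hζ0 := norm_nonneg ζ
    have hR0 : 0 < R := by linarith
    have hre := abs_le.1 (Complex.abs_re_le_norm ζ)
    have him := abs_le.1 (Complex.abs_im_le_norm ζ)
    -- Both kernels are at most `ε / (10 R)` on the sides off the real line.
    have hker : ∀ (K : ℂ → ℂ) (T : Set ℂ) (r : ℝ), r ≤ R →
        (∀ z ∈ T, r ≤ ‖z‖ → ‖K z - δ‖ ≤ ε / 20) → ∀ z ∈ T, R ≤ ‖z‖ →
        ‖(K z - δ) / (z - ζ)‖ ≤ ε / (10 * R) := by
      intro K T r hr hK z hz hzR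
      have h1 := hK z hz (hr.trans hzR)
      have h2 : R / 2 ≤ ‖z - ζ‖ := by
        have := norm_sub_norm_le z ζ
        linarith
      rw [norm_div, div_le_div_iff₀ (by linarith) (by positivity)]
      nlinarith
    have hG' : ContinuousOn (fun z => G z - δ) (Icc (-R) R ×ℂ Icc (-R) 0) :=
      (hG.mono fun z hz => hz.2.2).sub continuousOn_const
    have hH' : ContinuousOn (fun z => (H z - δ) / (z - ζ)) (Icc (-R) R ×ℂ Icc 0 R) := by
      refine ((hH.mono fun z hz => hz.2.1).sub continuousOn_const).div (by fun_prop) ?_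
      rintro z hz h
      rw [sub_eq_zero] at h
      have : 0 ≤ z.im := hz.2.1
      rw [h] at this
      linarith
    have hlow := rectIntegral_div_sub (ζ := ζ) hG' (DifferentiableOn.sub_const
      (hGd.mono fun z hz => hz.2.2) δ) (by linarith) (by linarith) (by linarith) hζ
    have hup : rectIntegral (fun z => (H z - δ) / (z - ζ)) (-R) R 0 R = 0 := by
      refine rectIntegral_eq_zero (by linarith) hR0.le hH' fun z hz => ?_
      have hz0 : 0 < z.im := hz.2.1
      refine DifferentiableAt.div (DifferentiableAt.sub_const (hHd.differentiableAt
        ((isOpen_lt continuous_const Complex.continuous_im).mem_nhds hz0)) _) (by fun_prop) ?_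
      rw [sub_ne_zero]
      rintro rfl
      linarith
    have hGR : IntervalIntegrable (fun x : ℝ => (G x - δ) / (x - ζ)) volume (-R) R := by
      refine ContinuousOn.intervalIntegrable (ContinuousOn.div ((hG.comp (by fun_prop)
        fun x _ => by simp).sub continuousOn_const) (by fun_prop) ?_)
      intro x _ h
      have := congrArg Complex.im h
      simp at this
      linarith
    have hHR : IntervalIntegrable (fun x : ℝ => (H x - δ) / (x - ζ)) volume (-R) R := by
      refine ContinuousOn.intervalIntegrable (ContinuousOn.div ((hH.comp (by fun_prop)
        fun x _ => by simp).sub continuousOn_const) (by fun_prop) ?_)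
      intro x _ h
      have := congrArg Complex.im h
      simp at this
      linarith
    have hdiff : ∫ s in (-R)..R, (H s - G s) / (s - ζ) =
        (∫ s in (-R)..R, (H s - δ) / (s - ζ)) - ∫ s in (-R)..R, (G s - δ) / (s - ζ) := by
      rw [← intervalIntegral.integral_sub hHR hGR]
      congr 1
      ext s
      ring
    have hor : ∀ (K : ℂ → ℂ) (y : ℝ), |y| = R →
        (∀ z : ℂ, z.im = y → R ≤ ‖z‖ → ‖(K z - δ) / (z - ζ)‖ ≤ ε / (10 * R)) →
        ‖∫ x in (-R)..R, (K (x + y * I) - δ) / ((x + y * I) - ζ)‖ ≤ ε / 5 := by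
      intro K y hy hK
      have := intervalIntegral.norm_integral_le_of_norm_le_const (a := -R) (b := R)
        (f := fun x : ℝ => (K (x + y * I) - δ) / ((x + y * I) - ζ)) (C := ε / (10 * R))
        fun x _ => hK _ (by simp) (by
          rw [← hy]
          simpa using Complex.abs_im_le_norm (x + y * I))
      rw [abs_of_pos (by linarith)] at this
      refine this.trans (le_of_eq ?_)
      field_simp
      ring
    have hver : ∀ (K : ℂ → ℂ) (x y₀ y₁ : ℝ), |x| = R → y₀ ≤ y₁ → y₁ - y₀ = R →
        (∀ z : ℂ, z.im ∈ Icc y₀ y₁ → R ≤ ‖z‖ → ‖(K z - δ) / (z - ζ)‖ ≤ ε / (10 * R)) →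
        ‖I * ∫ y in y₀..y₁, (K (x + y * I) - δ) / ((x + y * I) - ζ)‖ ≤ ε / 10 := by
      intro K x y₀ y₁ hx hy hyR hK
      rw [norm_mul, Complex.norm_I, one_mul]
      have := intervalIntegral.norm_integral_le_of_norm_le_const (a := y₀) (b := y₁)
        (f := fun y : ℝ => (K (x + y * I) - δ) / ((x + y * I) - ζ)) (C := ε / (10 * R))
        fun y hy' => hK _ (by
          rw [uIoc_of_le hy] at hy'
          simpa using Ioc_subset_Icc_self hy') (by
          rw [← hx]
          simpa using Complex.abs_re_le_norm (x + y * I))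
      rw [hyR, abs_of_pos hR0] at this
      refine this.trans (le_of_eq ?_)
      field_simp
    have hkG := hker G _ r₁ hR1 hr₁
    have hkH := hker H _ r₂ hR2 hr₂
    -- The two horizontal sides contribute at most `ε / 5` each, the four vertical ones `ε / 10` each.
    have e1 := hor G (-R) (by simp [abs_of_pos hR0])
      fun z hz => hkG z (by simp [hz, hR0.le])
    have e2 := hver G R (-R) 0 (abs_of_pos hR0) (by linarith) (by ring)
      fun z hz => hkG z hz.2
    have e3 := hver G (-R) (-R) 0 (by simp [abs_of_pos hR0]) (by linarith) (by ring)
      fun z hz => hkG z hz.2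
    have e4 := hor H R (abs_of_pos hR0) fun z hz => hkH z (by simp [hz, hR0.le])
    have e5 := hver H R 0 R (abs_of_pos hR0) hR0.le (by ring) fun z hz => hkH z hz.1
    have e6 := hver H (-R) 0 R (by simp [abs_of_pos hR0]) hR0.le (by ring) fun z hz => hkH z hz.1
    simp only [rectIntegral, Complex.ofReal_zero, zero_mul, add_zero] at hlow hup
    set a1 := ∫ x in (-R)..R, (G (x + (-R : ℝ) * I) - δ) / ((x + (-R : ℝ) * I) - ζ)
    set a2 := I * ∫ y in (-R)..0, (G (R + y * I) - δ) / ((R + y * I) - ζ)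
    set a3 := I * ∫ y in (-R)..0, (G ((-R : ℝ) + y * I) - δ) / (((-R : ℝ) + y * I) - ζ)
    set a4 := ∫ x in (-R)..R, (H (x + R * I) - δ) / ((x + R * I) - ζ)
    set a5 := I * ∫ y in (0 : ℝ)..R, (H (R + y * I) - δ) / ((R + y * I) - ζ)
    set a6 := I * ∫ y in (0 : ℝ)..R, (H ((-R : ℝ) + y * I) - δ) / (((-R : ℝ) + y * I) - ζ)
    rw [hdiff, dist_eq_norm, ← hlow]
    have : (∫ s in (-R)..R, (H s - δ) / (s - ζ)) - (∫ s in (-R)..R, (G s - δ) / (s - ζ)) -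
        (a1 - (∫ s in (-R)..R, (G s - δ) / (s - ζ)) + a2 - a3) =
        -a1 + -a2 + a3 + a4 + -a5 + a6 := by
      linear_combination hup
    rw [this]
    have n1 := norm_add_le (-a1 + -a2 + a3 + a4 + -a5) a6
    have n2 := norm_add_le (-a1 + -a2 + a3 + a4) (-a5)
    have n3 := norm_add_le (-a1 + -a2 + a3) a4
    have n4 := norm_add_le (-a1 + -a2) a3
    have n5 := norm_add_le (-a1) (-a2)
    rw [norm_neg] at n2 n5
    rw [norm_neg] at n5
    linarith
  rw [tendsto_nhds_unique hlim hlim', one_div_mul_eq_div, mul_div_cancel_left₀ _ hpi]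
  ring

/-! ### Bounds for the Gamma factors -/

lemma half_le_Gamma {x : ℝ} (hx : 1 ≤ x) : 1 / 2 ≤ Real.Gamma x := by
  have h2 : ∀ y : ℝ, 2 ≤ y → 1 ≤ Real.Gamma y := fun y hy => by
    have := Real.Gamma_strictMonoOn_Ici.monotoneOn (mem_Ici.2 le_rfl) (mem_Ici.2 hy) hy
    rwa [Real.Gamma_two] at this
  rcases le_total 2 x with h | h
  · linarith [h2 x h]
  · have h3 := h2 (x + 1) (by linarith)
    rw [Real.Gamma_add_one (by linarith)] at h3
    have : 0 < Real.Gamma x := Real.Gamma_pos_of_pos (by linarith)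
    nlinarith

lemma sinh_le_mul_exp {t : ℝ} : Real.sinh t ≤ t * Real.exp t := by
  have h1 := Real.add_one_le_exp (-2 * t)
  have h2 : Real.exp (-t) = Real.exp (-2 * t) * Real.exp t := by rw [← Real.exp_add]; ring_nf
  rw [Real.sinh_eq, h2]
  nlinarith [Real.exp_pos t]

/-- The reflection formula gives `|Γ(1 + iy)|² = πy / sinh πy`. -/
lemma norm_Gamma_one_add_mul_I_inv_le (y : ℝ) :
    ‖(Complex.Gamma (1 + y * I))⁻¹‖ ≤ Real.exp (Real.pi * |y| / 2) := by
  have hpos : 0 < ‖Complex.Gamma (1 + y * I)‖ :=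
    norm_pos_iff.2 (Complex.Gamma_ne_zero_of_re_pos (by simp))
  rcases eq_or_ne y 0 with rfl | hy
  · simp
  have hy' : (y * I : ℂ) ≠ 0 := by simp [hy]
  have hconj : ‖Complex.Gamma (1 - y * I)‖ = ‖Complex.Gamma (1 + y * I)‖ := by
    rw [← RCLike.norm_conj (Complex.Gamma (1 + y * I)), ← Complex.Gamma_conj]
    congr 2
    simp [sub_eq_add_neg]
  have hsin : ‖Complex.sin (Real.pi * (y * I))‖ = Real.sinh (Real.pi * |y|) := by
    rw [← mul_assoc, Complex.sin_mul_I, norm_mul, Complex.norm_I, mul_one, ← Complex.ofReal_mul,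
      ← Complex.ofReal_sinh, Complex.norm_real, Real.norm_eq_abs, Real.abs_sinh, abs_mul,
      abs_of_pos Real.pi_pos]
  have hyp : 0 < |y| := abs_pos.2 hy
  have hs : 0 < Real.sinh (Real.pi * |y|) := Real.sinh_pos_iff.2 (by positivity)
  have hsq : ‖Complex.Gamma (1 + y * I)‖ ^ 2 * Real.sinh (Real.pi * |y|) = Real.pi * |y| := by
    have h := congrArg norm (Complex.Gamma_mul_Gamma_one_sub (y * I))
    rw [norm_mul, norm_div, hsin, hconj, Complex.norm_real, Real.norm_of_nonneg Real.pi_pos.le,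
      eq_div_iff hs.ne'] at h
    have h2 : ‖Complex.Gamma (1 + y * I)‖ = |y| * ‖Complex.Gamma (y * I)‖ := by
      rw [add_comm, Complex.Gamma_add_one _ hy', norm_mul]
      simp
    nth_rewrite 1 [sq, h2]
    linear_combination |y| * h
  have hle := @sinh_le_mul_exp (Real.pi * |y|)
  rw [norm_inv, inv_le_comm₀ hpos (Real.exp_pos _), ← Real.exp_neg]
  refine le_of_sq_le_sq ?_ hpos.le
  have he : Real.exp (-(Real.pi * |y| / 2)) ^ 2 * Real.exp (Real.pi * |y|) = 1 := by
    rw [sq, ← Real.exp_add, ← Real.exp_add, ← Real.exp_zero]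
    ring_nf
  have h3 : 1 ≤ ‖Complex.Gamma (1 + y * I)‖ ^ 2 * Real.exp (Real.pi * |y|) := by
    have h4 : Real.pi * |y| * 1 ≤
        Real.pi * |y| * (‖Complex.Gamma (1 + y * I)‖ ^ 2 * Real.exp (Real.pi * |y|)) := by
      nlinarith [sq_nonneg ‖Complex.Gamma (1 + y * I)‖]
    exact le_of_mul_le_mul_left h4 (by positivity)
  rw [← he] at h3
  exact le_of_mul_le_mul_right h3 (Real.exp_pos _)

/-- For fixed imaginary part, `|Γ(x + iy)| / Γ(x)` is smallest at `x = 1` among `x ≥ 1`; this follows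
from the integral representation of the Beta function. -/
lemma norm_inv_Gamma_le {z : ℂ} (hz : 1 ≤ z.re) :
    ‖(Complex.Gamma z)⁻¹‖ ≤ Real.exp (Real.pi * |z.im| / 2) / Real.Gamma z.re := by
  rcases hz.eq_or_lt with h | h
  · have : z = 1 + z.im * I := by
      apply Complex.ext <;> simp [h.symm]
    rw [← h, Real.Gamma_one, div_one]
    have h' := norm_Gamma_one_add_mul_I_inv_le z.im
    rwa [← this] at h'
  set x := z.re with hx
  set y := z.im with hy
  have hx1 : 0 < x - 1 := by linarith
  -- The integrand `t ^ (iy) (1 - t) ^ (x - 2)` of `B(1 + iy, x - 1)` has modulus `(1 - t) ^ (x - 2)`.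
  have hbeta := Complex.betaIntegral_eq_Gamma_mul_div (1 + y * I) ((x - 1 : ℝ) : ℂ)
    (by simp) (by simpa using h)
  have hz' : (1 + y * I + (x - 1 : ℝ) : ℂ) = z := by
    apply Complex.ext <;> simp [hx, hy]
  have hle : ‖Complex.betaIntegral (1 + y * I) ((x - 1 : ℝ) : ℂ)‖ ≤ 1 / (x - 1) := by
    have hval : ∫ t in (0 : ℝ)..1, (1 - t) ^ (x - 2) = 1 / (x - 1) := by
      rw [intervalIntegral.integral_comp_sub_left (fun t => t ^ (x - 2)), sub_self, sub_zero,
        integral_rpow (Or.inl (by linarith))]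
      rw [show x - 2 + 1 = x - 1 by ring, Real.one_rpow, Real.zero_rpow hx1.ne', sub_zero]
    rw [← hval, Complex.betaIntegral]
    refine intervalIntegral.norm_integral_le_of_norm_le zero_le_one ?_ ?_
    · have hne : ∀ᵐ t : ℝ, t ≠ 1 := by
        simp [ae_iff]
      filter_upwards [hne] with t ht1 ht
      have h1 : 0 < 1 - t := by
        have := lt_of_le_of_ne ht.2 ht1
        linarith
      rw [norm_mul, Complex.norm_cpow_eq_rpow_re_of_pos ht.1, ← Complex.ofReal_one,
        ← Complex.ofReal_sub, Complex.norm_cpow_eq_rpow_re_of_pos h1]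
      simp only [Complex.sub_re, Complex.ofReal_re, Complex.ofReal_one, Complex.one_re,
        Complex.add_re, Complex.mul_re, Complex.I_re, Complex.I_im, Complex.ofReal_im]
      rw [show (1 + (y * 0 - 0 * 1) - 1 : ℝ) = 0 by ring, Real.rpow_zero, one_mul,
        show x - 1 - 1 = x - 2 by ring]
    · have := (intervalIntegral.intervalIntegrable_rpow' (a := 0) (b := 1) (r := x - 2)
        (by linarith)).comp_sub_left 1
      simpa using this.symm
  rw [hbeta, hz', Complex.Gamma_ofReal, norm_div, norm_mul, Complex.norm_real,
    Real.norm_of_nonneg (Real.Gamma_pos_of_pos hx1).le] at hle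
  have hG1 : 0 < ‖Complex.Gamma (1 + y * I)‖ :=
    norm_pos_iff.2 (Complex.Gamma_ne_zero_of_re_pos (by simp))
  have hGz : 0 < ‖Complex.Gamma z‖ :=
    norm_pos_iff.2 (Complex.Gamma_ne_zero_of_re_pos (by linarith))
  have hrec : Real.Gamma x = (x - 1) * Real.Gamma (x - 1) := by
    rw [← Real.Gamma_add_one hx1.ne', sub_add_cancel]
  have hGx : 0 < Real.Gamma x := Real.Gamma_pos_of_pos (by linarith)
  have h1 := norm_Gamma_one_add_mul_I_inv_le y
  rw [norm_inv] at h1 ⊢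
  rw [div_le_div_iff₀ hGz hx1] at hle
  have h2 : ‖Complex.Gamma z‖⁻¹ ≤ ‖Complex.Gamma (1 + y * I)‖⁻¹ / Real.Gamma x := by
    rw [div_eq_mul_inv, ← mul_inv]
    refine inv_anti₀ (by positivity) ?_
    rw [hrec]
    linarith
  exact h2.trans (by gcongr)

lemma norm_inv_Gamma_le_two_mul {z : ℂ} (hz : 1 ≤ z.re) :
    ‖(Complex.Gamma z)⁻¹‖ ≤ 2 * Real.exp (Real.pi * |z.im| / 2) := by
  refine (norm_inv_Gamma_le hz).trans ?_
  have := half_le_Gamma hz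
  rw [div_le_iff₀ (by linarith)]
  nlinarith [Real.exp_pos (Real.pi * |z.im| / 2)]

/-- The reflection formula bounds `Γ` in the left half-plane, away from the poles. -/
lemma norm_Gamma_le_of_re_nonpos {z : ℂ} (hz : z.re ≤ 0) :
    ‖Complex.Gamma z‖ ≤
      2 * Real.pi * Real.exp (Real.pi * |z.im| / 2) / ‖Complex.sin (Real.pi * z)‖ := by
  have h1 : 1 ≤ (1 - z).re := by simpa using hz
  have h2 : Complex.Gamma (1 - z) ≠ 0 := Complex.Gamma_ne_zero_of_re_pos (by linarith)
  have h3 : Complex.Gamma z = Real.pi / Complex.sin (Real.pi * z) * (Complex.Gamma (1 - z))⁻¹ := by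
    rw [← Complex.Gamma_mul_Gamma_one_sub, mul_inv_cancel_right₀ h2]
  have h4 := norm_inv_Gamma_le_two_mul h1
  simp only [Complex.sub_im, Complex.one_im, zero_sub, abs_neg] at h4
  rw [h3, norm_mul, norm_div, Complex.norm_real, Real.norm_of_nonneg Real.pi_pos.le]
  refine (mul_le_mul_of_nonneg_left h4 (by positivity)).trans (le_of_eq ?_)
  ring

lemma norm_sin_sq (z : ℂ) :
    ‖Complex.sin z‖ ^ 2 = Real.sin z.re ^ 2 + Real.sinh z.im ^ 2 := by
  have h : Complex.sin z = ((Real.sin z.re * Real.cosh z.im : ℝ) : ℂ) +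
      ((Real.cos z.re * Real.sinh z.im : ℝ) : ℂ) * I := by
    rw [Complex.sin_eq z]; push_cast; ring
  rw [← Complex.normSq_eq_norm_sq, h, Complex.normSq_add_mul_I]
  have h1 := Real.cosh_sq z.im
  have h2 := Real.sin_sq_add_cos_sq z.re
  linear_combination (Real.sin z.re ^ 2) * h1 + (Real.sinh z.im ^ 2) * h2

lemma abs_sinh_le_norm_sin (z : ℂ) : |Real.sinh z.im| ≤ ‖Complex.sin z‖ := by
  refine abs_le_of_sq_le_sq ?_ (norm_nonneg _)
  rw [norm_sin_sq]
  nlinarith [sq_nonneg (Real.sin z.re)]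

lemma one_le_norm_sin {z : ℂ} (N : ℕ) (hz : z.re = -(Real.pi * (N + 1 / 2))) :
    1 ≤ ‖Complex.sin z‖ := by
  have h : Real.sin z.re ^ 2 = 1 := by
    have h0 : Real.cos (Real.pi * (N + 1 / 2)) = 0 := by
      rw [Real.cos_eq_zero_iff]
      exact ⟨N, by push_cast; ring⟩
    have := Real.sin_sq_add_cos_sq (Real.pi * (N + 1 / 2))
    rw [hz, Real.sin_neg]
    rw [h0] at this
    linarith
  have := norm_sin_sq z
  rw [h] at this
  nlinarith [sq_nonneg (Real.sinh z.im), norm_nonneg (Complex.sin z)]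

/-- The residue of `Γ` at `-k` is `(-1)^k / k!`. -/
lemma tendsto_add_mul_Gamma (k : ℕ) :
    Tendsto (fun z : ℂ => (z + k) * Complex.Gamma z) (𝓝[≠] (-k)) (𝓝 ((-1) ^ k / k.factorial)) := by
  induction k with
  | zero => simpa using Complex.tendsto_self_mul_Gamma_nhds_zero
  | succ k ih =>
    have hshift : Tendsto (fun z : ℂ => z + 1) (𝓝[≠] (-((k + 1 : ℕ) : ℂ))) (𝓝[≠] (-(k : ℂ))) := by
      refine tendsto_nhdsWithin_iff.2 ⟨?_, ?_⟩
      · have : Tendsto (fun z : ℂ => z + 1) (𝓝 (-((k + 1 : ℕ) : ℂ)))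
            (𝓝 (-((k + 1 : ℕ) : ℂ) + 1)) := tendsto_id.add_const 1
        have e : -((k + 1 : ℕ) : ℂ) + 1 = -(k : ℂ) := by push_cast; ring
        rw [e] at this
        exact this.mono_left nhdsWithin_le_nhds
      · filter_upwards [self_mem_nhdsWithin] with z hz h
        refine hz ?_
        simp only [mem_singleton_iff] at h ⊢
        push_cast
        linear_combination h
    have hne : (-((k + 1 : ℕ) : ℂ)) ≠ 0 := by
      rw [neg_ne_zero]; exact_mod_cast k.succ_ne_zero
    have h1 := (ih.comp hshift).div (tendsto_id.mono_left nhdsWithin_le_nhds) hne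
    have hval : (-1 : ℂ) ^ k / k.factorial / (-((k + 1 : ℕ) : ℂ)) =
        (-1) ^ (k + 1) / (k + 1).factorial := by
      rw [Nat.factorial_succ, Nat.cast_mul, pow_succ]
      have : (k.factorial : ℂ) ≠ 0 := by exact_mod_cast k.factorial_ne_zero
      have : ((k + 1 : ℕ) : ℂ) ≠ 0 := by exact_mod_cast k.succ_ne_zero
      field_simp
    rw [hval] at h1
    refine h1.congr' ?_
    filter_upwards [nhdsWithin_le_nhds (isOpen_ne.mem_nhds hne)] with z hz
    have hz : z ≠ 0 := hz
    simp only [Pi.div_apply, Function.comp_apply, id_eq]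
    rw [Complex.Gamma_add_one z hz]
    push_cast
    field_simp
    ring

/-- The residue of `gammaExp α a` at `pole (α / a) k`. -/
def gammaRes (α a : ℝ) (k : ℕ) : ℂ :=
  I * (α / a) * ((-1) ^ k / k.factorial) *
    Complex.exp ((a ^ 2 / (2 * α)) * (pole (α / a) k ^ 2 + 1 / 2))

lemma gammaArg_re (α a : ℝ) (ζ : ℂ) :
    ((a / α : ℂ) * (1 - I * ζ)).re = a / α * (1 + ζ.im) := by
  rw [← Complex.ofReal_div, Complex.re_ofReal_mul]; simp

lemma gammaArg_im (α a : ℝ) (ζ : ℂ) : ((a / α : ℂ) * (1 - I * ζ)).im = -(a / α * ζ.re) := by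
  rw [← Complex.ofReal_div, Complex.im_ofReal_mul]; simp

lemma gammaArg_eq_neg_iff {α a : ℝ} (hα : 0 < α) (ha : 0 < a) (ζ : ℂ) (k : ℕ) :
    (a / α : ℂ) * (1 - I * ζ) = -k ↔ ζ = pole (α / a) k := by
  have hα' : (α : ℂ) ≠ 0 := by exact_mod_cast hα.ne'
  have ha' : (a : ℂ) ≠ 0 := by exact_mod_cast ha.ne'
  unfold pole
  push_cast
  constructor
  · intro h
    field_simp at h ⊢
    linear_combination (I) * h + (a * ζ) * Complex.I_sq
  · rintro rfl
    field_simp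
    linear_combination (a + α * k) * Complex.I_sq

lemma norm_exp_quadratic (α a : ℝ) (ζ : ℂ) :
    ‖Complex.exp ((a ^ 2 / (2 * α)) * (ζ ^ 2 + 1 / 2))‖ =
      Real.exp (a ^ 2 / (2 * α) * (ζ.re ^ 2 - ζ.im ^ 2 + 1 / 2)) := by
  rw [Complex.norm_exp]
  congr 1
  have : (a ^ 2 / (2 * α) : ℂ) = ((a ^ 2 / (2 * α) : ℝ) : ℂ) := by push_cast; ring
  rw [this, Complex.re_ofReal_mul]
  congr 1
  simp [sq]

lemma differentiableAt_gammaExp {α a : ℝ} (hα : 0 < α) (ha : 0 < a) {ζ : ℂ}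
    (hζ : ζ ∉ range (pole (α / a))) : DifferentiableAt ℂ (gammaExp α a) ζ := by
  unfold gammaExp
  refine DifferentiableAt.mul ?_ (by fun_prop)
  refine DifferentiableAt.comp ζ (g := Complex.Gamma)
    (Complex.differentiableAt_Gamma _ fun k h => hζ ?_) (by fun_prop)
  exact ⟨k, ((gammaArg_eq_neg_iff hα ha ζ k).1 h).symm⟩

lemma differentiableOn_gammaExp {α a : ℝ} (hα : 0 < α) (ha : 0 < a) :
    DifferentiableOn ℂ (gammaExp α a) (range (pole (α / a)))ᶜ :=
  fun _ hζ => (differentiableAt_gammaExp hα ha hζ).differentiableWithinAt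

lemma tendsto_sub_pole_mul_gammaExp {α a : ℝ} (hα : 0 < α) (ha : 0 < a) (k : ℕ) :
    Tendsto (fun ζ => (ζ - pole (α / a) k) * gammaExp α a ζ) (𝓝[≠] pole (α / a) k)
      (𝓝 (gammaRes α a k)) := by
  have hα' : (α : ℂ) ≠ 0 := by exact_mod_cast hα.ne'
  have ha' : (a : ℂ) ≠ 0 := by exact_mod_cast ha.ne'
  have harg : Tendsto (fun ζ : ℂ => (a / α : ℂ) * (1 - I * ζ)) (𝓝[≠] pole (α / a) k)
      (𝓝[≠] (-k)) := by
    refine tendsto_nhdsWithin_iff.2 ⟨?_, ?_⟩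
    · have hc : Continuous fun ζ : ℂ => (a / α : ℂ) * (1 - I * ζ) := by fun_prop
      have := hc.tendsto (pole (α / a) k)
      rw [(gammaArg_eq_neg_iff hα ha _ k).2 rfl] at this
      exact this.mono_left nhdsWithin_le_nhds
    · filter_upwards [self_mem_nhdsWithin] with ζ hζ h
      exact hζ ((gammaArg_eq_neg_iff hα ha _ k).1 h)
  have hexp : Tendsto (fun ζ : ℂ => I * (α / a) *
      Complex.exp ((a ^ 2 / (2 * α)) * (ζ ^ 2 + 1 / 2))) (𝓝[≠] pole (α / a) k)
      (𝓝 (I * (α / a) *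
        Complex.exp ((a ^ 2 / (2 * α)) * (pole (α / a) k ^ 2 + 1 / 2)))) := by
    refine (Continuous.tendsto ?_ _).mono_left nhdsWithin_le_nhds
    fun_prop
  have := ((tendsto_add_mul_Gamma k).comp harg).mul hexp
  refine (this.congr fun ζ => ?_).trans (le_of_eq ?_)
  · simp only [Function.comp_apply, gammaExp]
    have e : ((a / α : ℂ) * (1 - I * ζ) + k) * (I * (α / a)) = ζ - pole (α / a) k := by
      unfold pole
      push_cast
      field_simp
      linear_combination (-a * ζ) * Complex.I_sq
    linear_combination (Complex.Gamma ((a / α : ℂ) * (1 - I * ζ)) *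
      Complex.exp ((a ^ 2 / (2 * α)) * (ζ ^ 2 + 1 / 2))) * e
  · unfold gammaRes
    ring_nf

lemma norm_gammaRes_le {α a : ℝ} (hα : 0 < α) (ha : 0 < a) (k : ℕ) :
    ‖gammaRes α a k‖ ≤ α / a * Real.exp (-(a ^ 2 / (4 * α))) * (1 / k.factorial) := by
  have h1 : ‖Complex.exp ((a ^ 2 / (2 * α)) * (pole (α / a) k ^ 2 + 1 / 2))‖ ≤
      Real.exp (-(a ^ 2 / (4 * α))) := by
    rw [norm_exp_quadratic, Real.exp_le_exp, pole_re, pole_im]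
    have h2 : 0 ≤ α / a * k := by positivity
    have h3 : -(a ^ 2 / (4 * α)) = a ^ 2 / (2 * α) * (-1 / 2) := by field_simp; norm_num
    rw [h3]
    refine mul_le_mul_of_nonneg_left ?_ (by positivity)
    nlinarith
  unfold gammaRes
  rw [norm_mul, norm_mul, norm_mul, Complex.norm_I, one_mul, norm_div, norm_div, norm_pow, norm_neg,
    norm_one, one_pow, Complex.norm_real, Complex.norm_real, Complex.norm_natCast,
    Real.norm_of_nonneg hα.le, Real.norm_of_nonneg ha.le, mul_right_comm]
  gcongr

lemma summable_one_div_factorial : Summable fun k : ℕ => (1 / k.factorial : ℝ) := by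
  simpa using Real.summable_pow_div_factorial 1

lemma summable_norm_gammaRes {α a : ℝ} (hα : 0 < α) (ha : 0 < a) :
    Summable fun k => ‖gammaRes α a k‖ :=
  Summable.of_nonneg_of_le (fun _ => norm_nonneg _) (norm_gammaRes_le hα ha)
    (summable_one_div_factorial.mul_left _)

/-- The total mass of the residues; the factor `e^{-a²/(4α)}` is the size of the exponential at the
first pole `-i`. -/
lemma tsum_norm_gammaRes_le {α a : ℝ} (hα : 0 < α) (ha : 1 ≤ a) :
    ∑' k, ‖gammaRes α a k‖ ≤ α * Real.exp 1 * Real.exp (-(a ^ 2 / (4 * α))) := by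
  have ha0 : 0 < a := by linarith
  have he : ∑' k : ℕ, (1 / k.factorial : ℝ) = Real.exp 1 := by
    rw [Real.exp_eq_exp_ℝ, NormedSpace.exp_eq_tsum_div]
    simp
  refine ((summable_norm_gammaRes hα ha0).tsum_le_tsum (norm_gammaRes_le hα ha0)
    (summable_one_div_factorial.mul_left _)).trans ?_
  rw [tsum_mul_left, he, mul_right_comm α]
  have : α / a ≤ α := div_le_self hα.le ha
  gcongr

lemma norm_gammaExp_le {α a : ℝ} (hα : 0 < α) (ha : 0 < a) {ζ : ℂ} (hζ : ζ.im ≤ -1) {m : ℝ}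
    (hm : 0 < m) (hsin : m ≤ ‖Complex.sin (Real.pi * ((a / α : ℂ) * (1 - I * ζ)))‖) :
    ‖gammaExp α a ζ‖ ≤ 2 * Real.pi * Real.exp (Real.pi * (a / α * |ζ.re|) / 2) / m *
      Real.exp (a ^ 2 / (2 * α) * (ζ.re ^ 2 - ζ.im ^ 2 + 1 / 2)) := by
  unfold gammaExp
  rw [norm_mul, norm_exp_quadratic]
  refine mul_le_mul_of_nonneg_right ?_ (Real.exp_pos _).le
  refine (norm_Gamma_le_of_re_nonpos ?_).trans ?_
  · rw [gammaArg_re]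
    exact mul_nonpos_of_nonneg_of_nonpos (by positivity) (by linarith)
  · rw [gammaArg_im, abs_neg, abs_mul, abs_of_pos (show 0 < a / α by positivity)]
    gcongr

/-- On the horizontal lines half-way between the poles, `gammaExp` tends to zero uniformly on
bounded sets of real parts. -/
lemma norm_gammaExp_le_between_poles {α a : ℝ} (hα : 0 < α) (ha : 0 < a) {w : ℝ} {ζ : ℂ}
    (hre : |ζ.re| ≤ w) (N : ℕ) (him : ζ.im = -(1 + α / a * (N + 1 / 2))) :
    ‖gammaExp α a ζ‖ ≤ 2 * Real.pi * Real.exp (Real.pi * (a / α * w) / 2) *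
      Real.exp (a ^ 2 / (2 * α) * (w ^ 2 - ζ.im ^ 2 + 1 / 2)) := by
  have h1 : ζ.im ≤ -1 := by
    rw [him]
    have : 0 ≤ α / a * ((N : ℝ) + 1 / 2) := by positivity
    linarith
  have h2 : 1 ≤ ‖Complex.sin (Real.pi * ((a / α : ℂ) * (1 - I * ζ)))‖ := by
    refine one_le_norm_sin N ?_
    rw [Complex.re_ofReal_mul, gammaArg_re, him]
    field_simp
    ring
  refine (norm_gammaExp_le hα ha h1 one_pos h2).trans ?_
  rw [div_one]
  have : ζ.re ^ 2 ≤ w ^ 2 := sq_le_sq' (by linarith [(abs_le.1 hre).1]) (abs_le.1 hre).2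
  gcongr

lemma tendsto_exp_quadratic {α a : ℝ} (hα : 0 < α) (ha : 0 < a) (w C : ℝ) :
    Tendsto (fun N : ℕ => C * Real.exp (a ^ 2 / (2 * α) *
      (w ^ 2 - (-(1 + α / a * ((N : ℝ) + 1 / 2))) ^ 2 + 1 / 2))) atTop (𝓝 0) := by
  rw [← mul_zero C]
  refine Tendsto.const_mul C (Real.tendsto_exp_atBot.comp ?_)
  refine Tendsto.const_mul_atBot (by positivity) ?_
  refine tendsto_atBot_add_const_right _ _ ?_
  refine tendsto_atBot_add_const_left _ _ (tendsto_neg_atTop_atBot.comp ?_)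
  simp only [neg_sq]
  refine (tendsto_pow_atTop two_ne_zero).comp ?_
  exact tendsto_atTop_add_const_left _ _ (Tendsto.const_mul_atTop (by positivity)
    (tendsto_atTop_add_const_right _ _ tendsto_natCast_atTop_atTop))

lemma notMem_range_pole_of_re_ne {κ : ℝ} {ζ : ℂ} (h : ζ.re ≠ 0) : ζ ∉ range (pole κ) := by
  rintro ⟨k, rfl⟩
  exact h (pole_re κ k)

lemma notMem_range_pole_of_im_lt {κ : ℝ} (hκ : 0 < κ) {ζ : ℂ} (h : -1 < ζ.im) :
    ζ ∉ range (pole κ) := by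
  rintro ⟨k, rfl⟩
  rw [pole_im] at h
  have : 0 ≤ κ * k := by positivity
  linarith

/-- `gammaExp` is integrable along the downward half-lines off the imaginary axis. -/
lemma integrableOn_gammaExp_vertical {α a : ℝ} (hα : 0 < α) (ha : 0 < a) {x : ℝ} (hx : x ≠ 0)
    (T : ℝ) : IntegrableOn (fun y : ℝ => gammaExp α a (x + y * I)) (Iic T) := by
  have hcont : Continuous fun y : ℝ => gammaExp α a (x + y * I) := by
    rw [continuous_iff_continuousAt]
    intro y
    refine ContinuousAt.comp (g := gammaExp α a)
      (differentiableAt_gammaExp hα ha ?_).continuousAt (by fun_prop)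
    exact notMem_range_pole_of_re_ne (by simpa using hx)
  have hfar : IntegrableOn (fun y : ℝ => gammaExp α a (x + y * I)) (Iic (-1)) := by
    set m := |Real.sinh (Real.pi * (a / α * x))| with hm
    have hm0 : 0 < m := by
      rw [hm, abs_pos, Real.sinh_ne_zero]
      have := Real.pi_pos
      positivity
    have hg : Integrable fun y : ℝ => 2 * Real.pi * Real.exp (Real.pi * (a / α * |x|) / 2) / m *
        (Real.exp (a ^ 2 / (2 * α) * (x ^ 2 + 1 / 2)) *
          Real.exp (-(a ^ 2 / (2 * α)) * y ^ 2)) :=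
      ((integrable_exp_neg_mul_sq (by positivity)).const_mul _).const_mul _
    refine Integrable.mono' hg.integrableOn hcont.aestronglyMeasurable ?_
    refine (ae_restrict_iff' measurableSet_Iic).2 (Eventually.of_forall fun y hy => ?_)
    have h1 := norm_gammaExp_le hα ha (ζ := x + y * I) (by simpa using hy) hm0 ?_
    · refine h1.trans (le_of_eq ?_)
      rw [← Real.exp_add]
      simp only [Complex.add_re, Complex.add_im, Complex.ofReal_re, Complex.ofReal_im,
        Complex.mul_re, Complex.mul_im, Complex.I_re, Complex.I_im]
      ring_nf
    · refine le_trans (le_of_eq ?_) (abs_sinh_le_norm_sin _)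
      rw [Complex.im_ofReal_mul, gammaArg_im, hm]
      simp
  refine (hfar.union (hcont.integrableOn_Icc (a := -1) (b := T))).mono_set fun y hy => ?_
  rcases le_total y (-1) with h | h
  exacts [Or.inl h, Or.inr ⟨h, hy⟩]

lemma continuous_gammaInvExp (α a : ℝ) : Continuous (gammaInvExp α a) := by
  unfold gammaInvExp
  exact (Complex.differentiable_one_div_Gamma.continuous.comp (by fun_prop)).mul (by fun_prop)

/-- The exponential growth of `1 / Γ` along the real line is absorbed by half of the Gaussian. -/
lemma norm_gammaInvExp_le {α a : ℝ} (hα : 0 < α) (ha : α ≤ a) (s : ℝ) :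
    ‖gammaInvExp α a s‖ ≤ 2 * Real.exp (Real.pi ^ 2 / (4 * α)) * Real.exp (-(a ^ 2 / (4 * α))) *
      Real.exp (-(a ^ 2 / (4 * α)) * s ^ 2) := by
  have ha0 : 0 < a := hα.trans_le ha
  unfold gammaInvExp
  have h1 := norm_inv_Gamma_le_two_mul (z := (a / α : ℂ) * (1 - I * s)) (by
    rw [gammaArg_re]
    simpa using (one_le_div hα).2 ha)
  rw [gammaArg_im, abs_neg, Complex.ofReal_re, abs_mul, abs_of_pos (show 0 < a / α by positivity)]
    at h1
  have h2 : ‖Complex.exp (-(a ^ 2 / (2 * α)) * ((s : ℂ) ^ 2 + 1 / 2))‖ =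
      Real.exp (-(a ^ 2 / (2 * α)) * (s ^ 2 + 1 / 2)) := by
    rw [Complex.norm_exp]
    congr 1
    have : (-(a ^ 2 / (2 * α)) * ((s : ℂ) ^ 2 + 1 / 2)) =
        ((-(a ^ 2 / (2 * α)) * (s ^ 2 + 1 / 2) : ℝ) : ℂ) := by push_cast; ring
    rw [this, Complex.ofReal_re]
  rw [norm_mul, h2]
  refine (mul_le_mul_of_nonneg_right h1 (Real.exp_pos _).le).trans ?_
  rw [mul_assoc, mul_assoc, mul_assoc, ← Real.exp_add, ← Real.exp_add, ← Real.exp_add]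
  refine mul_le_mul_of_nonneg_left (Real.exp_le_exp.2 ?_) zero_le_two
  -- Completing the square in `a |s|` compares the two exponents.
  have h3 := sq_nonneg (a * |s| - Real.pi)
  have h4 : (a * |s|) ^ 2 = a ^ 2 * s ^ 2 := by rw [mul_pow, sq_abs]
  rw [sub_sq, h4] at h3
  have h5 : Real.pi * (a / α * |s|) / 2 + -(a ^ 2 / (2 * α)) * (s ^ 2 + 1 / 2) =
      (2 * (a * |s|) * Real.pi - 2 * a ^ 2 * s ^ 2 - a ^ 2) / (4 * α) := by
    field_simp; ring
  have h6 : Real.pi ^ 2 / (4 * α) + (-(a ^ 2 / (4 * α)) + -(a ^ 2 / (4 * α)) * s ^ 2) =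
      (Real.pi ^ 2 - a ^ 2 - a ^ 2 * s ^ 2) / (4 * α) := by
    field_simp; ring
  rw [h5, h6]
  refine div_le_div_of_nonneg_right ?_ (by positivity)
  linarith

lemma integrable_gammaInvExp {α a : ℝ} (hα : 0 < α) (ha : α ≤ a) :
    Integrable fun s : ℝ => gammaInvExp α a s := by
  have ha0 : 0 < a := hα.trans_le ha
  have hg : Integrable fun s : ℝ => 2 * Real.exp (Real.pi ^ 2 / (4 * α)) *
      Real.exp (-(a ^ 2 / (4 * α))) * Real.exp (-(a ^ 2 / (4 * α)) * s ^ 2) :=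
    (integrable_exp_neg_mul_sq (by positivity)).const_mul _
  exact hg.mono' ((continuous_gammaInvExp α a).comp Complex.continuous_ofReal).aestronglyMeasurable
    (Eventually.of_forall (norm_gammaInvExp_le hα ha))

lemma integral_norm_gammaInvExp_le {α a : ℝ} (hα : 0 < α) (ha : α ≤ a) (ha1 : 1 ≤ a) :
    ∫ s : ℝ, ‖gammaInvExp α a s‖ ≤
      2 * Real.exp (Real.pi ^ 2 / (4 * α)) * √(Real.pi * (4 * α)) *
        Real.exp (-(a ^ 2 / (4 * α))) := by
  have ha0 : 0 < a := hα.trans_le ha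
  have hg : Integrable fun s : ℝ => 2 * Real.exp (Real.pi ^ 2 / (4 * α)) *
      Real.exp (-(a ^ 2 / (4 * α))) * Real.exp (-(a ^ 2 / (4 * α)) * s ^ 2) :=
    (integrable_exp_neg_mul_sq (by positivity)).const_mul _
  refine (integral_mono (integrable_gammaInvExp hα ha).norm hg (norm_gammaInvExp_le hα ha)).trans ?_
  rw [integral_const_mul, integral_gaussian, mul_right_comm]
  have : Real.pi / (a ^ 2 / (4 * α)) ≤ Real.pi * (4 * α) := by
    rw [div_div_eq_mul_div]
    exact div_le_self (by positivity) (one_le_pow₀ ha1)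
  gcongr

/-! ### The integral along the contour as a sum of residues -/

lemma cap_mem_slit {L : LambdaContour} {a : ℝ} (ha : 0 < a) (hL : L.CrossesAtTheta a) (x : ℝ) :
    x ≠ 0 ∨ -1 < L.φ x := by
  rcases eq_or_ne x 0 with rfl | h
  · right
    rw [hL]
    have : 0 < 1 / a ^ 2 := by positivity
    linarith
  · exact Or.inl h

lemma notMem_range_pole {κ : ℝ} (hκ : 0 < κ) {ζ : ℂ} (h : ζ.re ≠ 0 ∨ -1 < ζ.im) :
    ζ ∉ range (pole κ) :=
  h.elim notMem_range_pole_of_re_ne (notMem_range_pole_of_im_lt hκ)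

lemma continuousOn_cap (L : LambdaContour) :
    ContinuousOn (fun x : ℝ => (x + L.φ x * I : ℂ)) (Icc (-L.w) L.w) :=
  Complex.continuous_ofReal.continuousOn.add
    ((Complex.continuous_ofReal.comp_continuousOn L.continuousOn).mul continuousOn_const)

lemma integrableAlong_gammaExp {α a : ℝ} (hα : 0 < α) (ha : 0 < a) {L : LambdaContour}
    (hL : L.CrossesAtTheta a) : L.IntegrableAlong (gammaExp α a) := by
  have hw := L.w_pos
  refine ⟨(integrableOn_gammaExp_vertical hα ha hw.ne' _).mul_const _, ?_, ?_⟩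
  · refine IntervalIntegrable.continuousOn_mul ?_ ?_
    · refine (intervalIntegrable_const (c := (1 : ℂ))).add ?_
      exact IntervalIntegrable.mul_const (c := I)
        ⟨L.integrable_deriv.1.ofReal, L.integrable_deriv.2.ofReal⟩
    · rw [uIcc_of_le (by linarith)]
      intro x hx
      refine ContinuousAt.comp_continuousWithinAt (g := gammaExp α a)
        (differentiableAt_gammaExp hα ha (notMem_range_pole (by positivity) ?_)).continuousAt
        (continuousOn_cap L x hx)
      simpa using cap_mem_slit ha hL x
  · have := (integrableOn_gammaExp_vertical hα ha (neg_ne_zero.2 hw.ne') (L.φ (-L.w))).mul_const I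
    simpa [IntegrableOn] using this

/-- Off the part `{-i t : t ≥ 1}` of the imaginary axis, `gammaExp` has a primitive on large discs:
its principal parts are integrated to logarithms. -/
lemma exists_primitive_gammaExp {α a : ℝ} (hα : 0 < α) (ha : 0 < a) (N : ℕ) :
    ∃ Ψ : ℂ → ℂ, ∀ ζ : ℂ, ‖ζ‖ < 1 + α / a * (N + 1) → (ζ.re ≠ 0 ∨ -1 < ζ.im) →
      HasDerivAt Ψ (gammaExp α a ζ) ζ := by
  have hκ : 0 < α / a := by positivity
  obtain ⟨E, hE, hEF⟩ := exists_holomorphic_of_simple_poles hκ (differentiableOn_gammaExp hα ha)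
    (tendsto_sub_pole_mul_gammaExp hα ha) N
  have hball : ∀ ζ : ℂ, ‖ζ‖ < 1 + α / a * (N + 1) → -(1 + α / a * (N + 1)) < ζ.im := fun ζ hζ =>
    (abs_lt.1 ((Complex.abs_im_le_norm ζ).trans_lt hζ)).1
  obtain ⟨Φ, hΦ⟩ := DifferentiableOn.isExactOn_ball (c := 0) (r := 1 + α / a * (N + 1))
    (hE.mono fun ζ hζ => hball ζ (by simpa using hζ))
  refine ⟨fun ζ => Φ ζ + ∑ k ∈ Finset.range (N + 1),
    gammaRes α a k * Complex.log (-I * (ζ - pole (α / a) k)), fun ζ hζ hs => ?_⟩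
  have hlog : ∀ k : ℕ, HasDerivAt (fun ζ : ℂ => Complex.log (-I * (ζ - pole (α / a) k)))
      (1 / (ζ - pole (α / a) k)) ζ := by
    intro k
    have hslit : -I * (ζ - pole (α / a) k) ∈ Complex.slitPlane := by
      rcases hs with h | h
      · right; simpa [pole_re] using h
      · left
        have : 0 ≤ α / a * (k : ℝ) := by positivity
        simp [pole_im]
        linarith
    have hne : ζ - pole (α / a) k ≠ 0 := fun h =>
      Complex.slitPlane_ne_zero hslit (by rw [h, mul_zero])
    refine ((Complex.hasDerivAt_log hslit).comp ζ
      (((hasDerivAt_id ζ).sub_const _).const_mul (-I))).congr_deriv ?_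
    have := Complex.I_ne_zero
    field_simp
  have h1 := (hΦ ζ (by simpa using hζ)).add (HasDerivAt.fun_sum (u := Finset.range (N + 1))
    fun k _ => (hlog k).const_mul (gammaRes α a k))
  refine h1.congr_deriv ?_
  rw [hEF ζ (hball ζ hζ) (notMem_range_pole hκ hs)]
  simp [div_eq_mul_inv]

lemma rectIntegral_sum {ι : Type*} (s : Finset ι) (f : ι → ℂ → ℂ) {u v y₀ y₁ : ℝ} (huv : u ≤ v)
    (hy : y₀ ≤ y₁) (hf : ∀ i ∈ s, ContinuousOn (f i) (rectBoundary u v y₀ y₁)) :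
    rectIntegral (fun z => ∑ i ∈ s, f i z) u v y₀ y₁ = ∑ i ∈ s, rectIntegral (f i) u v y₀ y₁ := by
  classical
  induction s using Finset.induction_on with
  | empty => simp [rectIntegral]
  | insert i s his ih =>
    simp only [Finset.sum_insert his]
    rw [rectIntegral_add huv hy (hf i (Finset.mem_insert_self _ _))
      (continuousOn_finsetSum _ fun j hj => hf j (Finset.mem_insert_of_mem hj)),
      ih fun j hj => hf j (Finset.mem_insert_of_mem hj)]

/-- The residue theorem for `gammaExp` on a rectangle that ends half-way between two poles. -/
lemma rectIntegral_gammaExp {α a w : ℝ} (hα : 0 < α) (ha : 0 < a) (hw : 0 < w) (N : ℕ) :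
    rectIntegral (gammaExp α a) (-w) w (-(1 + α / a * (N + 1 / 2))) (-1 / 2) =
      2 * Real.pi * I * ∑ k ∈ Finset.range (N + 1), gammaRes α a k := by
  have hκ : 0 < α / a := by positivity
  obtain ⟨E, hE, hEF⟩ := exists_holomorphic_of_simple_poles hκ (differentiableOn_gammaExp hα ha)
    (tendsto_sub_pole_mul_gammaExp hα ha) N
  set Y := -(1 + α / a * ((N : ℝ) + 1 / 2)) with hY
  have hYpos : 0 ≤ α / a * ((N : ℝ) + 1 / 2) := by positivity
  have hYN : -(1 + α / a * ((N : ℝ) + 1)) < Y := by rw [hY]; nlinarith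
  have huv : -w ≤ w := by linarith
  have hy : Y ≤ -1 / 2 := by rw [hY]; linarith
  have hpole : ∀ k ∈ Finset.range (N + 1), Y < (pole (α / a) k).im ∧
      (pole (α / a) k).im < -1 / 2 := by
    intro k hk
    have hk' : (k : ℝ) ≤ N := by exact_mod_cast Nat.lt_succ_iff.1 (Finset.mem_range.1 hk)
    rw [pole_im, hY]
    have : 0 ≤ α / a * (k : ℝ) := by positivity
    constructor <;> nlinarith
  have hbd : ∀ k ∈ Finset.range (N + 1), ∀ z ∈ rectBoundary (-w) w Y (-1 / 2),
      z ≠ pole (α / a) k := by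
    rintro k hk z ⟨_, _, h⟩ rfl
    have := hpole k hk
    rw [pole_re] at h
    rcases h with h | h | h | h <;> linarith
  have hbd' : ∀ z ∈ rectBoundary (-w) w Y (-1 / 2), z ∉ range (pole (α / a)) := by
    rintro _ hz ⟨k, rfl⟩
    by_cases hk : k ∈ Finset.range (N + 1)
    · exact hbd k hk _ hz rfl
    · have h1 : (N : ℝ) + 1 ≤ k := by
        have := not_lt.1 (mt Finset.mem_range.2 hk)
        exact_mod_cast this
      have h2 := hz.2.1.1
      rw [pole_im] at h2
      nlinarith
  have hterm : ∀ k ∈ Finset.range (N + 1), ContinuousOn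
      (fun z => gammaRes α a k * (1 / (z - pole (α / a) k))) (rectBoundary (-w) w Y (-1 / 2)) :=
    fun k hk => continuousOn_const.mul (continuousOn_const.div (by fun_prop)
      fun z hz => sub_ne_zero.2 (hbd k hk z hz))
  have hEc : ∀ z ∈ Icc (-w) w ×ℂ Icc Y (-1 / 2), DifferentiableAt ℂ E z := fun z hz =>
    hE.differentiableAt ((isOpen_lt continuous_const Complex.continuous_im).mem_nhds
      (hYN.trans_le hz.2.1))
  have hEcont : ContinuousOn E (Icc (-w) w ×ℂ Icc Y (-1 / 2)) := fun z hz =>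
    (hEc z hz).continuousAt.continuousWithinAt
  rw [rectIntegral_congr (g := fun z => E z + ∑ k ∈ Finset.range (N + 1),
      gammaRes α a k * (1 / (z - pole (α / a) k))) huv hy,
    rectIntegral_add huv hy (hEcont.mono fun z hz => ⟨hz.1, hz.2.1⟩)
      (continuousOn_finsetSum _ hterm), rectIntegral_sum _ _ huv hy hterm,
    rectIntegral_eq_zero huv hy hEcont fun z hz =>
      hEc z ⟨Ioo_subset_Icc_self hz.1, Ioo_subset_Icc_self hz.2⟩, zero_add, Finset.mul_sum]
  · refine Finset.sum_congr rfl fun k hk => ?_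
    obtain ⟨h1, h2⟩ := hpole k hk
    rw [rectIntegral_const_mul, rectIntegral_inv_sub (by simpa [pole_re] using hw)
      (by simpa [pole_re] using hw) h1 h2]
    ring
  · intro z hz
    simp only
    rw [hEF z (hYN.trans_le hz.2.1.1) (hbd' z hz)]
    simp [div_eq_mul_inv]

/-- `∫_λ Γ((a/α)(1 - is)) e^{(a²/2α)(s² + 1/2)} ds` is `2πi` times the sum of the residues enclosed by
`λ`. The shape of the cap is irrelevant since the integrand has a primitive near it. -/
lemma integral_gammaExp {α a : ℝ} (hα : 0 < α) (ha : 0 < a) {L : LambdaContour}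
    (hL : L.CrossesAtTheta a) :
    L.integral (gammaExp α a) = 2 * Real.pi * I * ∑' k, gammaRes α a k := by
  have hκ : 0 < α / a := by positivity
  have hw := L.w_pos
  set w := L.w with hwdef
  have hint := integrableAlong_gammaExp hα ha hL
  set Y : ℕ → ℝ := fun N => -(1 + α / a * ((N : ℝ) + 1 / 2)) with hY
  have hYlim : Tendsto Y atTop atBot := tendsto_neg_atTop_atBot.comp
    (tendsto_atTop_add_const_left _ _ (Tendsto.const_mul_atTop hκ
      (tendsto_atTop_add_const_right _ _ tendsto_natCast_atTop_atTop)))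
  set T : ℕ → ℂ := fun N => (∫ y in (Y N)..(L.φ w), gammaExp α a (w + y * I) * I)
    - (∫ x in (-w)..w, gammaExp α a (x + L.φ x * I) * (1 + deriv L.φ x * I))
    - (∫ y in (Y N)..(L.φ (-w)), gammaExp α a (-w + y * I) * I) with hT
  set B : ℕ → ℂ := fun N => ∫ x in (-w)..w, gammaExp α a (x + Y N * I) with hB
  have hTlim : Tendsto T atTop (𝓝 (L.integral (gammaExp α a))) :=
    ((intervalIntegral_tendsto_integral_Iic _ hint.1 hYlim).sub_const _).sub
      (intervalIntegral_tendsto_integral_Iic _ hint.2.2 hYlim)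
  have hBlim : Tendsto B atTop (𝓝 0) := by
    refine squeeze_zero_norm (fun N => ?_) (tendsto_exp_quadratic hα ha w
      (2 * Real.pi * Real.exp (Real.pi * (a / α * w) / 2) * (2 * w)))
    have := intervalIntegral.norm_integral_le_of_norm_le_const (a := -w) (b := w)
      (f := fun x : ℝ => gammaExp α a (x + Y N * I))
      (C := 2 * Real.pi * Real.exp (Real.pi * (a / α * w) / 2) *
        Real.exp (a ^ 2 / (2 * α) * (w ^ 2 - Y N ^ 2 + 1 / 2))) fun x hx => by
        rw [uIoc_of_le (by linarith)] at hx
        have := norm_gammaExp_le_between_poles hα ha (ζ := x + Y N * I) (w := w)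
          (by simpa using abs_le.2 ⟨hx.1.le, hx.2⟩) N (by simp [hY])
        simpa using this
    refine this.trans (le_of_eq ?_)
    rw [abs_of_pos (by linarith)]
    ring
  have hTB : ∀ᶠ N in atTop, T N + B N =
      2 * Real.pi * I * ∑ k ∈ Finset.range (N + 1), gammaRes α a k := by
    -- From some point on, the truncated contour lies in the disc where the primitive exists.
    obtain ⟨m, hm⟩ := (isCompact_Icc.image_of_continuousOn L.continuousOn).isBounded.bddBelow
    filter_upwards [hYlim.eventually_le_atBot m, hYlim.eventually_le_atBot (-(w ^ 2 / (α / a)))]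
      with N hN1 hN2
    obtain ⟨Ψ, hΨ⟩ := exists_primitive_gammaExp hα ha N
    have hφY : ∀ x ∈ Icc (-w) w, Y N ≤ L.φ x := fun x hx => hN1.trans (hm ⟨x, hx, rfl⟩)
    have hY1 : Y N ≤ -1 := by
      have : 0 ≤ α / a * ((N : ℝ) + 1 / 2) := by positivity
      simp only [hY]
      linarith
    have hdisc : ∀ x ∈ Icc (-w) w, ∀ y ∈ Icc (Y N) 0, ‖(x + y * I : ℂ)‖ < 1 + α / a * (N + 1) := by
      intro x hx y hy
      have h1 : x ^ 2 ≤ w ^ 2 := sq_le_sq' hx.1 hx.2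
      have h2 : y ^ 2 ≤ (Y N) ^ 2 := by nlinarith [hy.1, hy.2]
      have h3 : w ^ 2 ≤ α / a * -(Y N) := by
        rw [mul_comm, ← div_le_iff₀ hκ]
        linarith
      have h4 : 1 + α / a * ((N : ℝ) + 1) = -(Y N) + α / a / 2 := by
        simp only [hY]; ring
      rw [h4]
      refine lt_of_pow_lt_pow_left₀ 2 (by linarith) ?_
      rw [← Complex.normSq_eq_norm_sq, Complex.normSq_add_mul_I]
      nlinarith
    have hΨ' : ∀ x ∈ Icc (-w) w, ∀ y ∈ Icc (Y N) 0, (x ≠ 0 ∨ -1 < y) →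
        HasDerivAt Ψ (gammaExp α a (x + y * I)) (x + y * I) := fun x hx y hy h =>
      hΨ _ (hdisc x hx y hy) (by simpa using h)
    have hwm : w ∈ Icc (-w) w := ⟨by linarith, le_rfl⟩
    have hwm' : -w ∈ Icc (-w) w := ⟨le_rfl, by linarith⟩
    have hver : ∀ x ∈ Icc (-w) w, x ≠ 0 → ∀ t ∈ Icc (Y N) 0,
        ∫ y in (Y N)..t, gammaExp α a (x + y * I) * I = Ψ (x + t * I) - Ψ (x + Y N * I) := by
      intro x hx hx0 t ht
      refine intervalIntegral.integral_eq_sub_of_hasDerivAt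
        (f := fun y : ℝ => Ψ (x + y * I)) (fun y hy => ?_) ?_
      · rw [uIcc_of_le ht.1] at hy
        have := HasDerivAt.comp (y : ℂ) (h₂ := Ψ) (hΨ' x hx y ⟨hy.1, hy.2.trans ht.2⟩ (Or.inl hx0))
          (((hasDerivAt_id (y : ℂ)).mul_const I).const_add (x : ℂ))
        simpa using this.comp_ofReal
      · have h : IntegrableOn (fun y : ℝ => gammaExp α a (x + y * I) * I) (Iic t) :=
          (integrableOn_gammaExp_vertical hα ha hx0 t).mul_const I
        exact (intervalIntegrable_iff_integrableOn_Icc_of_le ht.1).2 (h.mono_set Icc_subset_Iic_self)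
    have hφ0 : ∀ x ∈ Icc (-w) w, L.φ x ∈ Icc (Y N) 0 := fun x hx => ⟨hφY x hx, (L.neg x hx).le⟩
    have hcap : ∫ x in (-w)..w, gammaExp α a (x + L.φ x * I) * (1 + deriv L.φ x * I) =
        Ψ (w + L.φ w * I) - Ψ ((-w : ℝ) + L.φ (-w) * I) := by
      obtain ⟨S, hS, hdiff⟩ := L.differentiable
      refine integral_eq_of_hasDerivAt_off_countable (fun x : ℝ => Ψ (x + L.φ x * I)) _
        hS.countable ?_ ?_ hint.2.1
      · rw [uIcc_of_le hwm'.2]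
        intro x hx
        exact ContinuousAt.comp_continuousWithinAt (g := Ψ)
          (hΨ' x hx _ (hφ0 x hx) (cap_mem_slit ha hL x)).continuousAt (continuousOn_cap L x hx)
      · rw [min_eq_left hwm'.2, max_eq_right hwm'.2]
        intro x hx
        have hx' : x ∈ Icc (-w) w := Ioo_subset_Icc_self hx.1
        have h1 : HasDerivAt (fun x : ℝ => (x + L.φ x * I : ℂ)) (1 + deriv L.φ x * I) x :=
          (Complex.ofRealCLM.hasDerivAt (x := x)).add
            ((hdiff x hx).hasDerivAt.ofReal_comp.mul_const I)
        exact (hΨ' x hx' _ (hφ0 x hx') (cap_mem_slit ha hL x)).comp x h1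
    have htop : ∫ x in (-w)..w, gammaExp α a (x + (-1 / 2 : ℝ) * I) =
        Ψ (w + (-1 / 2 : ℝ) * I) - Ψ ((-w : ℝ) + (-1 / 2 : ℝ) * I) := by
      refine intervalIntegral.integral_eq_sub_of_hasDerivAt
        (f := fun x : ℝ => Ψ (x + (-1 / 2 : ℝ) * I)) (fun x hx => ?_) ?_
      · rw [uIcc_of_le hwm'.2] at hx
        have := HasDerivAt.comp (x : ℂ) (h₂ := Ψ)
          (hΨ' x hx (-1 / 2) ⟨by linarith, by norm_num⟩ (Or.inr (by norm_num)))
          ((hasDerivAt_id (x : ℂ)).add_const ((-1 / 2 : ℝ) * I))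
        simpa using this.comp_ofReal
      · refine ContinuousOn.intervalIntegrable fun x _ => ContinuousAt.continuousWithinAt ?_
        refine ContinuousAt.comp (g := gammaExp α a) (differentiableAt_gammaExp hα ha
          (notMem_range_pole_of_im_lt hκ ?_)).continuousAt (by fun_prop)
        simp
        norm_num
    have hrect := rectIntegral_gammaExp hα ha hw N
    change rectIntegral _ _ _ (Y N) _ = _ at hrect
    have hhalf : (-1 / 2 : ℝ) ∈ Icc (Y N) 0 := ⟨by linarith, by norm_num⟩
    have hr1 := hver w hwm hw.ne' _ hhalf
    have hr2 := hver (-w) hwm' (neg_ne_zero.2 hw.ne') _ hhalf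
    have hv1 := hver w hwm hw.ne' _ (hφ0 w hwm)
    have hv2 := hver (-w) hwm' (neg_ne_zero.2 hw.ne') _ (hφ0 (-w) hwm')
    rw [intervalIntegral.integral_mul_const] at hr1 hr2
    rw [← hrect]
    simp only [hT, hB, rectIntegral]
    rw [hcap, hv1, htop]
    simp only [Complex.ofReal_neg] at hv2 hr1 hr2 ⊢
    rw [hv2]
    linear_combination -hr1 + hr2
  have hsum := (summable_norm_gammaRes hα ha).of_norm.hasSum.tendsto_sum_nat.comp
    (tendsto_add_atTop_nat 1)
  have h1 := (hTlim.add hBlim).congr' hTB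
  rw [add_zero] at h1
  exact tendsto_nhds_unique h1 (hsum.const_mul _)

/-! ### Topology of the contour, and continuation of the columns -/

namespace LambdaContour

variable (L : LambdaContour)

/-- The cap function `φ`, extended to the real line by its values at `±w`. -/
def capExt (x : ℝ) : ℝ := L.φ (max (-L.w) (min L.w x))

lemma capExt_mem (x : ℝ) : max (-L.w) (min L.w x) ∈ Icc (-L.w) L.w :=
  ⟨le_max_left _ _, max_le (by linarith [L.w_pos]) (min_le_left _ _)⟩

lemma continuous_capExt : Continuous L.capExt :=
  L.continuousOn.comp_continuous (by fun_prop) L.capExt_mem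

lemma capExt_neg (x : ℝ) : L.capExt x < 0 := L.neg _ (L.capExt_mem x)

lemma capExt_of_abs_le {x : ℝ} (hx : |x| ≤ L.w) : L.capExt x = L.φ x := by
  rw [abs_le] at hx
  rw [capExt, min_eq_right hx.2, max_eq_right hx.1]

/-- The region enclosed by the contour together with the contour. -/
def closedInner : Set ℂ := {ζ | |ζ.re| ≤ L.w ∧ ζ.im ≤ L.φ ζ.re}

lemma mem_closedInner_iff {ζ : ℂ} :
    ζ ∈ L.closedInner ↔ |ζ.re| ≤ L.w ∧ ζ.im ≤ L.capExt ζ.re :=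
  and_congr_right fun h => by rw [L.capExt_of_abs_le h]

lemma mem_inner_iff {ζ : ℂ} : ζ ∈ L.inner ↔ |ζ.re| < L.w ∧ ζ.im < L.capExt ζ.re :=
  and_congr_right fun h => by rw [L.capExt_of_abs_le h.le]

lemma isClosed_closedInner : IsClosed L.closedInner := by
  have : L.closedInner = {ζ | |ζ.re| ≤ L.w} ∩ {ζ | ζ.im ≤ L.capExt ζ.re} := by
    ext ζ; exact L.mem_closedInner_iff
  rw [this]
  exact (isClosed_le (by fun_prop) continuous_const).inter
    (isClosed_le Complex.continuous_im (L.continuous_capExt.comp Complex.continuous_re))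

lemma isOpen_inner : IsOpen L.inner := by
  have : L.inner = {ζ | |ζ.re| < L.w} ∩ {ζ | ζ.im < L.capExt ζ.re} := by
    ext ζ; exact L.mem_inner_iff
  rw [this]
  exact (isOpen_lt (by fun_prop) continuous_const).inter
    (isOpen_lt Complex.continuous_im (L.continuous_capExt.comp Complex.continuous_re))

lemma inner_subset_closedInner : L.inner ⊆ L.closedInner := fun _ h => ⟨h.1.le, h.2.le⟩

lemma carrier_eq : L.carrier = L.closedInner \ L.inner := by
  ext ζ
  constructor
  · rintro (⟨h1, h2⟩ | ⟨h1, h2⟩)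
    · exact ⟨⟨h1.le, h2⟩, fun h => h.1.ne h1⟩
    · exact ⟨⟨h1, h2.le⟩, fun h => h.2.ne h2⟩
  · rintro ⟨⟨h1, h2⟩, h3⟩
    rcases h1.eq_or_lt with h | h
    · exact Or.inl ⟨h, h2⟩
    · exact Or.inr ⟨h1, h2.eq_or_lt.resolve_right fun h' => h3 ⟨h, h'⟩⟩

lemma im_neg_of_mem_closedInner {ζ : ℂ} (h : ζ ∈ L.closedInner) : ζ.im < 0 :=
  (L.mem_closedInner_iff.1 h).2.trans_lt (L.capExt_neg _)

lemma isClosed_carrier : IsClosed L.carrier := by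
  rw [carrier_eq]
  exact L.isClosed_closedInner.sdiff L.isOpen_inner

lemma minusSide_eq : minusSide L = {ζ | ζ.im < 0} \ L.closedInner := by
  ext ζ
  simp only [minusSide, carrier_eq, mem_ofPred_eq, Set.mem_sdiff, not_and, not_not]
  refine and_congr_right fun _ => ⟨fun h h' => h.1 (h.2 h'), fun h => ⟨fun h' => h
    (L.inner_subset_closedInner h'), fun h' => absurd h' h⟩⟩

lemma isOpen_minusSide : IsOpen (minusSide L) := by
  rw [minusSide_eq]
  exact (isOpen_lt Complex.continuous_im continuous_const).sdiff L.isClosed_closedInner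

/-- A point that is the limit at `0+` of a continuous path in `A` lies in the closure of `A`. -/
lemma _root_.GapRH.mem_closure_of_path {A : Set ℂ} {γ : ℝ → ℂ} (hγ : Continuous γ)
    (h : ∀ᶠ t in 𝓝[>] 0, γ t ∈ A) : γ 0 ∈ closure A :=
  mem_closure_of_tendsto ((hγ.tendsto 0).mono_left nhdsWithin_le_nhds) h

lemma closedInner_subset_closure : L.closedInner ⊆ closure L.inner := by
  intro ζ hζ
  rw [mem_closedInner_iff] at hζ
  have hc := L.continuous_capExt
  set γ : ℝ → ℂ := fun t => ((1 - t) * ζ.re : ℝ) +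
    (min ζ.im (L.capExt ((1 - t) * ζ.re)) - t : ℝ) * I with hγ
  have hγ0 : γ 0 = ζ := by
    apply Complex.ext <;> simp [hγ, hζ.2]
  rw [← hγ0]
  refine mem_closure_of_path (by fun_prop) ?_
  filter_upwards [Ioo_mem_nhdsGT (zero_lt_one' ℝ)] with t ht
  rw [mem_inner_iff]
  have h1 : (γ t).re = (1 - t) * ζ.re := by simp [hγ]
  have h2 : (γ t).im = min ζ.im (L.capExt ((1 - t) * ζ.re)) - t := by simp [hγ]
  rw [h1, h2, abs_mul, abs_of_pos (by linarith [ht.2])]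
  refine ⟨?_, ?_⟩
  · have := abs_nonneg ζ.re
    nlinarith [ht.1, ht.2, hζ.1, L.w_pos]
  · have := min_le_right ζ.im (L.capExt ((1 - t) * ζ.re))
    linarith [ht.1]

lemma carrier_subset_closure_minusSide : L.carrier ⊆ closure (minusSide L) := by
  rintro ζ (⟨h1, h2⟩ | ⟨h1, h2⟩)
  · have him := L.im_neg_of_mem_closedInner (ζ := ζ) ⟨h1.le, h2⟩
    set γ : ℝ → ℂ := fun t => ((1 + t) * ζ.re : ℝ) + (ζ.im : ℝ) * I with hγ
    have hγ0 : γ 0 = ζ := by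
      apply Complex.ext <;> simp [hγ]
    rw [← hγ0]
    refine mem_closure_of_path (by fun_prop) ?_
    filter_upwards [self_mem_nhdsWithin] with t ht
    have ht : 0 < t := ht
    rw [minusSide_eq]
    refine ⟨by simpa [hγ] using him, fun h => ?_⟩
    have h3 := h.1
    have h4 : (γ t).re = (1 + t) * ζ.re := by simp [hγ]
    rw [h4, abs_mul, abs_of_pos (by linarith), h1] at h3
    nlinarith [L.w_pos]
  · have him := L.im_neg_of_mem_closedInner (ζ := ζ) ⟨h1, h2.le⟩
    set γ : ℝ → ℂ := fun t => (ζ.re : ℝ) + (ζ.im + t : ℝ) * I with hγ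
    have hγ0 : γ 0 = ζ := by
      apply Complex.ext <;> simp [hγ]
    rw [← hγ0]
    refine mem_closure_of_path (by fun_prop) ?_
    filter_upwards [Ioo_mem_nhdsGT (neg_pos.2 him)] with t ht
    rw [minusSide_eq]
    refine ⟨?_, fun h => ?_⟩
    · have : (γ t).im = ζ.im + t := by simp [hγ]
      rw [mem_ofPred_eq, this]
      linarith [ht.2]
    · have h3 := h.2
      have h4 : (γ t).im = ζ.im + t := by simp [hγ]
      have h5 : (γ t).re = ζ.re := by simp [hγ]
      rw [h4, h5, ← h2] at h3
      linarith [ht.1]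

lemma realLine_subset_closure_minusSide : realLine ⊆ closure (minusSide L) := by
  intro ζ hζ
  have hζ : ζ.im = 0 := hζ
  set γ : ℝ → ℂ := fun t => (ζ.re : ℝ) + (-t : ℝ) * I with hγ
  have hγ0 : γ 0 = ζ := by
    apply Complex.ext <;> simp [hγ, hζ]
  rw [← hγ0]
  refine mem_closure_of_path (by fun_prop) ?_
  have hneg := L.capExt_neg ζ.re
  filter_upwards [Ioo_mem_nhdsGT (neg_pos.2 hneg)] with t ht
  have h4 : (γ t).im = -t := by simp [hγ]
  have h5 : (γ t).re = ζ.re := by simp [hγ]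
  rw [minusSide_eq]
  refine ⟨?_, fun h => ?_⟩
  · rw [mem_ofPred_eq, h4]
    linarith [ht.1]
  · have := (L.mem_closedInner_iff.1 h).2
    rw [h4, h5] at this
    linarith [ht.2]

end LambdaContour

lemma upper_subset_closure : {ζ : ℂ | 0 ≤ ζ.im} ⊆ closure {ζ : ℂ | 0 < ζ.im} := by
  rw [Complex.closure_setOfPred_lt_im]

/-- The contour `λ` is removable for continuous functions that are holomorphic off it. -/
lemma differentiableOn_of_carrier (L : LambdaContour) {h : ℂ → ℂ} {D : Set ℂ} (hD : IsOpen D)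
    (hc : ContinuousOn h D) (hd : ∀ z ∈ D, z ∉ L.carrier → DifferentiableAt ℂ h z) :
    DifferentiableOn ℂ h D := by
  refine differentiableOn_of_rectIntegral_eq_zero hD hc ?_
  have hout : ∀ u v y₀ y₁ : ℝ, u ≤ v → y₀ ≤ y₁ → Icc u v ×ℂ Icc y₀ y₁ ⊆ D →
      (v ≤ -L.w ∨ L.w ≤ u) → rectIntegral h u v y₀ y₁ = 0 := by
    intro u v y₀ y₁ huv hy hsub hw
    refine rectIntegral_eq_zero huv hy (hc.mono hsub) fun z hz => hd z
      (hsub ⟨Ioo_subset_Icc_self hz.1, Ioo_subset_Icc_self hz.2⟩) fun hzL => ?_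
    rw [L.carrier_eq] at hzL
    have h1 := abs_le.1 hzL.1.1
    have h2 : z.re ∈ Ioo u v := hz.1
    rcases hw with hw | hw <;> linarith [h2.1, h2.2, h1.1, h1.2]
  have hin : ∀ u v y₀ y₁ : ℝ, u ≤ v → y₀ ≤ y₁ → Icc u v ×ℂ Icc y₀ y₁ ⊆ D → -L.w ≤ u → v ≤ L.w →
      rectIntegral h u v y₀ y₁ = 0 := by
    intro u v y₀ y₁ huv hy hsub hu hv
    have hIcc : Icc u v ⊆ Icc (-L.w) L.w := Icc_subset_Icc hu hv
    have hint : ∀ s ∈ Icc u v, ∀ t ∈ Icc u v, IntervalIntegrable (deriv L.φ) volume s t :=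
      fun s hs t ht => L.integrable_deriv.mono_set (by
        rw [uIcc_of_le (by linarith [L.w_pos] : -L.w ≤ L.w)]
        exact uIcc_subset_Icc (hIcc hs) (hIcc ht))
    refine rectIntegral_eq_zero_of_graph (φ := L.φ) (g := fun x => |deriv L.φ x|) huv hy
      (hc.mono hsub) (fun z hz hne => hd z
        (hsub ⟨Ioo_subset_Icc_self hz.1, Ioo_subset_Icc_self hz.2⟩) fun hzL => ?_)
      (L.continuousOn.mono hIcc)
      (hint u (left_mem_Icc.2 huv) v (right_mem_Icc.2 huv)).abs (fun _ => abs_nonneg _) ?_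
    · have h2 : z.re ∈ Ioo u v := hz.1
      rcases hzL with h1 | h1
      · have : |z.re| < L.w := abs_lt.2 ⟨by linarith [h2.1], by linarith [h2.2]⟩
        exact this.ne h1.1
      · exact hne h1.2
    · intro s hs t ht hst
      obtain ⟨S, hS, hdiff⟩ := L.differentiable
      have := integral_eq_of_hasDerivAt_off_countable L.φ (deriv L.φ) (a := s) (b := t)
        hS.countable ?_ ?_ (hint s hs t ht)
      · rw [← this, ← Real.norm_eq_abs]
        exact intervalIntegral.norm_integral_le_integral_norm hst
      · rw [uIcc_of_le hst]
        exact L.continuousOn.mono ((Icc_subset_Icc hs.1 ht.2).trans hIcc)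
      · rw [min_eq_left hst, max_eq_right hst]
        exact fun x hx => (hdiff x ⟨⟨(hIcc hs).1.trans_lt hx.1.1, hx.1.2.trans_le (hIcc ht).2⟩,
          hx.2⟩).hasDerivAt
  have hleft : ∀ u v y₀ y₁ : ℝ, u ≤ v → y₀ ≤ y₁ → Icc u v ×ℂ Icc y₀ y₁ ⊆ D → v ≤ L.w →
      rectIntegral h u v y₀ y₁ = 0 := by
    intro u v y₀ y₁ huv hy hsub hv
    rcases le_total v (-L.w) with h1 | h1
    · exact hout u v y₀ y₁ huv hy hsub (Or.inl h1)
    rcases le_total (-L.w) u with h2 | h2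
    · exact hin u v y₀ y₁ huv hy hsub h2 hv
    rw [rectIntegral_add_re (hc.mono hsub) ⟨h2, h1⟩ hy,
      hout u (-L.w) y₀ y₁ h2 hy (fun z hz => hsub ⟨Icc_subset_Icc le_rfl h1 hz.1, hz.2⟩)
        (Or.inl le_rfl),
      hin (-L.w) v y₀ y₁ h1 hy (fun z hz => hsub ⟨Icc_subset_Icc h2 le_rfl hz.1, hz.2⟩) le_rfl hv,
      zero_add]
  intro u v y₀ y₁ huv hy hsub
  rcases le_total v L.w with h1 | h1
  · exact hleft u v y₀ y₁ huv hy hsub h1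
  rcases le_total L.w u with h2 | h2
  · exact hout u v y₀ y₁ huv hy hsub (Or.inr h2)
  rw [rectIntegral_add_re (hc.mono hsub) ⟨h2, h1⟩ hy,
    hleft u L.w y₀ y₁ h2 hy (fun z hz => hsub ⟨Icc_subset_Icc le_rfl h1 hz.1, hz.2⟩) le_rfl,
    hout L.w v y₀ y₁ h1 hy (fun z hz => hsub ⟨Icc_subset_Icc h2 le_rfl hz.1, hz.2⟩)
      (Or.inr le_rfl), zero_add]

/-- The limit at infinity carries over to boundary values. -/
lemma tendsto_extendFrom_cobounded {f : ℂ → ℂ} {A B : Set ℂ} {δ : ℂ} (hB : B ⊆ closure A)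
    (hlim : ∀ x ∈ B, ∃ y, Tendsto f (𝓝[A] x) (𝓝 y))
    (hinf : Tendsto f (Bornology.cobounded ℂ ⊓ 𝓟 A) (𝓝 δ)) :
    Tendsto (extendFrom A f) (Bornology.cobounded ℂ ⊓ 𝓟 B) (𝓝 δ) := by
  rw [Metric.tendsto_nhds]
  intro ε hε
  obtain ⟨r, hr⟩ := exists_norm_sub_le_of_tendsto hinf (half_pos hε)
  refine (hasBasis_cobounded_norm.inf_principal B).eventually_iff.2 ⟨r + 1, trivial, fun x hx => ?_⟩
  have hx1 : r + 1 ≤ ‖x‖ := hx.1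
  have hne : (𝓝[A] x).NeBot := mem_closure_iff_nhdsWithin_neBot.1 (hB hx.2)
  have h1 := tendsto_extendFrom (hlim x hx.2)
  have h2 : ∀ᶠ z in 𝓝[A] x, f z ∈ Metric.closedBall δ (ε / 2) := by
    have h3 : ∀ᶠ z : ℂ in 𝓝 x, r < ‖z‖ :=
      continuous_norm.continuousAt.eventually (lt_mem_nhds (by linarith))
    filter_upwards [self_mem_nhdsWithin, nhdsWithin_le_nhds h3] with z hz hz'
    simpa [dist_eq_norm] using hr z hz hz'.le
  have h4 := Metric.isClosed_closedBall.mem_of_tendsto h1 h2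
  exact (Metric.mem_closedBall.1 h4).trans_lt (by linarith)

lemma continuousOn_piecewise_of_eqOn {A B D : Set ℂ} (hA : IsClosed A) (hB : IsClosed B)
    (hD : D ⊆ A ∪ B) {f g : ℂ → ℂ} [∀ x, Decidable (x ∈ A)] (hf : ContinuousOn f (A ∩ D))
    (hg : ContinuousOn g (B ∩ D)) (hfg : ∀ x ∈ A ∩ B ∩ D, f x = g x) :
    ContinuousOn (A.piecewise f g) D := by
  intro x hx
  have hDU : D ⊆ A ∩ D ∪ B ∩ D := fun y hy => (hD hy).imp (fun h => ⟨h, hy⟩) fun h => ⟨h, hy⟩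
  refine ContinuousWithinAt.mono (ContinuousWithinAt.union ?_ ?_) hDU
  · by_cases hxA : x ∈ A
    · refine (hf x ⟨hxA, hx⟩).congr (fun y hy => piecewise_eq_of_mem _ _ _ hy.1)
        (piecewise_eq_of_mem _ _ _ hxA)
    · exact continuousWithinAt_of_notMem_closure fun h =>
        hxA (hA.closure_subset_iff.2 inter_subset_left h)
  · have heq : ∀ y ∈ B ∩ D, A.piecewise f g y = g y := fun y hy => by
      by_cases hyA : y ∈ A
      · rw [piecewise_eq_of_mem _ _ _ hyA, hfg y ⟨⟨hyA, hy.1⟩, hy.2⟩]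
      · rw [piecewise_eq_of_notMem _ _ _ hyA]
    by_cases hxB : x ∈ B
    · exact (hg x ⟨hxB, hx⟩).congr heq (heq x ⟨hxB, hx⟩)
    · exact continuousWithinAt_of_notMem_closure fun h =>
        hxB (hB.closure_subset_iff.2 inter_subset_left h)

lemma isClosed_range_pole {κ : ℝ} (hκ : 0 < κ) : IsClosed (range (pole κ)) := by
  refine (Metric.isClosedEmbedding_of_pairwise_le_dist hκ fun j k hjk => ?_).isClosed_range
  have h1 : (1 : ℝ) ≤ |(j : ℝ) - k| := by
    have : (1 : ℤ) ≤ |(j : ℤ) - k| := Int.one_le_abs (by simpa [sub_eq_zero] using hjk)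
    exact_mod_cast this
  change κ ≤ dist _ _
  rw [dist_eq_norm]
  refine le_trans ?_ (Complex.abs_im_le_norm _)
  rw [Complex.sub_im, pole_im, pole_im,
    show -(1 + κ * (j : ℝ)) - -(1 + κ * k) = -(κ * (j - k)) by ring, abs_neg, abs_mul,
    abs_of_pos hκ]
  nlinarith

/-- The data extracted from a row `(u₁, u₂)` of a solution of the Riemann–Hilbert problem. The
function `G` is `u₂` in the lower half-plane, continued across `λ`; `H` is `u₂` in the upper
half-plane; `F` is `u₁` outside of `λ` and `u₁ + gammaExp · u₂` inside, continued across `λ` and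
across the real line. Both `G` and `H` are continuous up to the real line. -/
structure IsRowExtension (α a : ℝ) (L : LambdaContour) (U : ℂ → Matrix (Fin 2) (Fin 2) ℂ)
    (i : Fin 2) (F G H : ℂ → ℂ) : Prop where
  continuousOn_G : ContinuousOn G {z | z.im ≤ 0}
  differentiableOn_G : DifferentiableOn ℂ G {z | z.im < 0}
  tendsto_G : Tendsto G (Bornology.cobounded ℂ ⊓ 𝓟 {z | z.im ≤ 0})
    (𝓝 ((1 : Matrix (Fin 2) (Fin 2) ℂ) i 1))
  continuousOn_H : ContinuousOn H {z | 0 ≤ z.im}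
  differentiableOn_H : DifferentiableOn ℂ H {z | 0 < z.im}
  tendsto_H : Tendsto H (Bornology.cobounded ℂ ⊓ 𝓟 {z | 0 ≤ z.im})
    (𝓝 ((1 : Matrix (Fin 2) (Fin 2) ℂ) i 1))
  differentiableOn_F : DifferentiableOn ℂ F (range (pole (α / a)))ᶜ
  jump_real : ∀ s : ℝ, H s - G s = -(gammaInvExp α a s * F s)
  residue_F : ∀ k, Tendsto (fun z => (z - pole (α / a) k) * F z) (𝓝[≠] pole (α / a) k)
    (𝓝 (gammaRes α a k * G (pole (α / a) k)))
  tendsto_F_outside : Tendsto F (Bornology.cobounded ℂ ⊓ 𝓟 L.closedInnerᶜ)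
    (𝓝 ((1 : Matrix (Fin 2) (Fin 2) ℂ) i 0))
  tendsto_F_inside : Tendsto (fun z => F z - gammaExp α a z * G z)
    (Bornology.cobounded ℂ ⊓ 𝓟 L.closedInner) (𝓝 ((1 : Matrix (Fin 2) (Fin 2) ℂ) i 0))
  eq_F : ∀ z : ℂ, 0 < z.im → F z = U z i 0
  eq_G : ∀ z ∈ L.inner, G z = U z i 1

lemma tendsto_entry {ι : Type*} {l : Filter ι} {U : ι → Matrix (Fin 2) (Fin 2) ℂ}
    {V : Matrix (Fin 2) (Fin 2) ℂ} (h : Tendsto U l (𝓝 V)) (i j : Fin 2) :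
    Tendsto (fun z => U z i j) l (𝓝 (V i j)) :=
  ((continuous_apply_apply i j).tendsto V).comp h

lemma pole_mem_inner {α a : ℝ} (hα : 0 < α) (ha : 0 < a) {L : LambdaContour}
    (hL : L.CrossesAtTheta a) (k : ℕ) : pole (α / a) k ∈ L.inner := by
  have h1 := (cap_mem_slit ha hL 0).resolve_left (by simp)
  have h2 : 0 ≤ α / a * (k : ℝ) := by positivity
  refine ⟨by rw [pole_re, abs_zero]; exact L.w_pos, ?_⟩
  rw [pole_re, pole_im]
  linarith

/-- The jump relation allows the two columns of a solution to be continued across the contours. -/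
lemma exists_isRowExtension {α a : ℝ} (hα : 0 < α) (ha : 0 < a) {L : LambdaContour}
    (hL : L.CrossesAtTheta a) {U : ℂ → Matrix (Fin 2) (Fin 2) ℂ} (hU : IsSolution α a L U)
    (i : Fin 2) : ∃ F G H : ℂ → ℂ, IsRowExtension α a L U i F G H := by
  classical
  have hκ : 0 < α / a := by positivity
  set u : Fin 2 → ℂ → ℂ := fun j z => U z i j with hu
  have hrealcl : IsClosed realLine := isClosed_eq Complex.continuous_im continuous_const
  have hopen : IsOpen (sigma L)ᶜ := (L.isClosed_carrier.union hrealcl).isOpen_compl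
  have hdiff : ∀ j, ∀ z ∉ sigma L, DifferentiableAt ℂ (u j) z := fun j z hz =>
    (hU.analytic i j).differentiableAt (hopen.mem_nhds hz)
  have hUpos : IsOpen {z : ℂ | 0 < z.im} := isOpen_lt continuous_const Complex.continuous_im
  have hUneg : IsOpen {z : ℂ | z.im < 0} := isOpen_lt Complex.continuous_im continuous_const
  have hclneg : IsClosed {z : ℂ | z.im ≤ 0} := isClosed_le Complex.continuous_im continuous_const
  have hPcl := isClosed_range_pole hκ
  -- The three regions are disjoint from the contours.
  have hinner : ∀ z ∈ L.inner, z ∉ sigma L := by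
    rintro z hz (h | h)
    · rw [L.carrier_eq] at h; exact h.2 hz
    · exact (L.im_neg_of_mem_closedInner (L.inner_subset_closedInner hz)).ne h
  have hminus : ∀ z ∈ minusSide L, z ∉ sigma L := by
    rintro z hz (h | h)
    · exact hz.2.2 h
    · exact hz.1.ne h
  have hupper : ∀ z : ℂ, 0 < z.im → z ∉ sigma L := by
    rintro z hz (h | h)
    · rw [L.carrier_eq] at h
      exact (L.im_neg_of_mem_closedInner h.1).not_gt hz
    · exact hz.ne' h
  -- One-sided limits exist everywhere.
  have hself : ∀ (A : Set ℂ) (j : Fin 2) (z : ℂ), z ∉ sigma L →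
      ∃ y, Tendsto (u j) (𝓝[A] z) (𝓝 y) := fun A j z hz =>
    ⟨u j z, (hdiff j z hz).continuousAt.tendsto.mono_left nhdsWithin_le_nhds⟩
  have hK : L.closedInner ⊆ L.inner ∪ L.carrier := fun z hz => by
    by_cases h : z ∈ L.inner
    · exact Or.inl h
    · exact Or.inr (L.carrier_eq ▸ ⟨hz, h⟩)
  have hM : {z : ℂ | z.im ≤ 0} \ L.inner ⊆ minusSide L ∪ sigma L := by
    rintro z ⟨hz, hz'⟩
    rcases (show z.im ≤ 0 from hz).eq_or_lt with h | h
    · exact Or.inr (Or.inr h)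
    · by_cases hc : z ∈ L.carrier
      · exact Or.inr (Or.inl hc)
      · exact Or.inl ⟨h, hz', hc⟩
  have hMcl : {z : ℂ | z.im ≤ 0} \ L.inner ⊆ closure (minusSide L) := fun z hz => by
    rcases hM hz with h | h | h
    · exact subset_closure h
    · exact L.carrier_subset_closure_minusSide h
    · exact L.realLine_subset_closure_minusSide h
  have hlimlo : ∀ j, ∀ z ∈ {z : ℂ | z.im ≤ 0} \ L.inner,
      ∃ y, Tendsto (u j) (𝓝[minusSide L] z) (𝓝 y) := fun j z hz => by
    rcases hM hz with h | h
    · exact hself _ j z (hminus z h)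
    · obtain ⟨Up, Um, _, h2, _⟩ := hU.jump z h
      exact ⟨Um i j, tendsto_entry h2 i j⟩
  have hlimin : ∀ j, ∀ z ∈ L.closedInner, ∃ y, Tendsto (u j) (𝓝[L.inner] z) (𝓝 y) :=
    fun j z hz => by
    rcases hK hz with h | h
    · exact hself _ j z (hinner z h)
    · obtain ⟨Up, Um, h1, _, _⟩ := hU.jump z (Or.inl h)
      exact ⟨Up i j, tendsto_entry (h1.mono_left (nhdsWithin_mono _ subset_union_right)) i j⟩
  have hlimup : ∀ j, ∀ z ∈ {z : ℂ | 0 ≤ z.im}, ∃ y, Tendsto (u j) (𝓝[{z | 0 < z.im}] z) (𝓝 y) :=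
    fun j z hz => by
    rcases (show 0 ≤ z.im from hz).eq_or_lt with h | h
    · obtain ⟨Up, Um, h1, _, _⟩ := hU.jump z (Or.inr h.symm)
      exact ⟨Up i j, tendsto_entry (h1.mono_left (nhdsWithin_mono _ subset_union_left)) i j⟩
    · exact hself _ j z (hupper z h)
  -- The boundary values from the three regions.
  set lo : Fin 2 → ℂ → ℂ := fun j => extendFrom (minusSide L) (u j) with hlo
  set inn : Fin 2 → ℂ → ℂ := fun j => extendFrom L.inner (u j) with hinn
  set up : Fin 2 → ℂ → ℂ := fun j => extendFrom {z | 0 < z.im} (u j) with hup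
  have hloc : ∀ j, ContinuousOn (lo j) ({z : ℂ | z.im ≤ 0} \ L.inner) := fun j =>
    continuousOn_extendFrom hMcl (hlimlo j)
  have hinnc : ∀ j, ContinuousOn (inn j) L.closedInner := fun j =>
    continuousOn_extendFrom L.closedInner_subset_closure (hlimin j)
  have hupc : ∀ j, ContinuousOn (up j) {z | 0 ≤ z.im} := fun j =>
    continuousOn_extendFrom upper_subset_closure (hlimup j)
  have hloeq : ∀ j, ∀ z ∈ minusSide L, lo j z = u j z := fun j z hz =>
    extendFrom_eq (subset_closure hz)
      ((hdiff j z (hminus z hz)).continuousAt.tendsto.mono_left nhdsWithin_le_nhds)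
  have hinneq : ∀ j, ∀ z ∈ L.inner, inn j z = u j z := fun j z hz =>
    extendFrom_eq (subset_closure hz)
      ((hdiff j z (hinner z hz)).continuousAt.tendsto.mono_left nhdsWithin_le_nhds)
  have hupeq : ∀ j, ∀ z : ℂ, 0 < z.im → up j z = u j z := fun j z hz =>
    extendFrom_eq (subset_closure (show z ∈ {z : ℂ | 0 < z.im} from hz))
      ((hdiff j z (hupper z hz)).continuousAt.tendsto.mono_left nhdsWithin_le_nhds)
  -- The jump relations.
  have hjc : ∀ z ∈ L.carrier, inn 1 z = lo 1 z ∧ inn 0 z + gammaExp α a z * inn 1 z = lo 0 z := by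
    intro z hz
    obtain ⟨Up, Um, h1, h2, h3⟩ := hU.jump z (Or.inl hz)
    have hz' := hz
    rw [L.carrier_eq] at hz'
    have e1 : ∀ j, inn j z = Up i j := fun j =>
      extendFrom_eq (L.closedInner_subset_closure hz'.1)
        (tendsto_entry (h1.mono_left (nhdsWithin_mono _ subset_union_right)) i j)
    have e2 : ∀ j, lo j z = Um i j := fun j =>
      extendFrom_eq (L.carrier_subset_closure_minusSide hz) (tendsto_entry h2 i j)
    have hz0 : z ∉ realLine := fun h => (L.im_neg_of_mem_closedInner hz'.1).ne h
    simp only [e1, e2, h3, jump, Matrix.mul_apply, Fin.sum_univ_two, indicator_of_notMem hz0,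
      indicator_of_mem hz]
    simp
    ring
  have hjr : ∀ z ∈ realLine, up 0 z = lo 0 z ∧ up 1 z = lo 1 z - gammaInvExp α a z * lo 0 z := by
    intro z hz
    obtain ⟨Up, Um, h1, h2, h3⟩ := hU.jump z (Or.inr hz)
    have hz' : z.im = 0 := hz
    have e1 : ∀ j, up j z = Up i j := fun j =>
      extendFrom_eq (upper_subset_closure hz'.ge)
        (tendsto_entry (h1.mono_left (nhdsWithin_mono _ subset_union_left)) i j)
    have e2 : ∀ j, lo j z = Um i j := fun j =>
      extendFrom_eq (L.realLine_subset_closure_minusSide hz) (tendsto_entry h2 i j)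
    have hz0 : z ∉ L.carrier := fun h => by
      rw [L.carrier_eq] at h
      exact (L.im_neg_of_mem_closedInner h.1).ne hz'
    simp only [e1, e2, h3, jump, Matrix.mul_apply, Fin.sum_univ_two, indicator_of_notMem hz0,
      indicator_of_mem hz]
    simp
    ring
  -- Limits at infinity.
  have hinf : ∀ j, ∀ A ⊆ (sigma L)ᶜ, Tendsto (u j) (Bornology.cobounded ℂ ⊓ 𝓟 A)
      (𝓝 ((1 : Matrix (Fin 2) (Fin 2) ℂ) i j)) := fun j A hA =>
    (tendsto_entry hU.infinity i j).mono_left (inf_le_inf_left _ (principal_mono.2 hA))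
  have hloinf := fun j => tendsto_extendFrom_cobounded hMcl (hlimlo j) (hinf j _ hminus)
  have hinninf := fun j =>
    tendsto_extendFrom_cobounded L.closedInner_subset_closure (hlimin j) (hinf j _ hinner)
  have hupinf := fun j =>
    tendsto_extendFrom_cobounded upper_subset_closure (hlimup j) (hinf j _ hupper)
  have hMclosed : IsClosed ({z : ℂ | z.im ≤ 0} \ L.inner) := hclneg.sdiff L.isOpen_inner
  have hKneg : ∀ z ∈ L.closedInner, z.im < 0 := fun z => L.im_neg_of_mem_closedInner
  have hcont_c : ContinuousOn (gammaExp α a) (range (pole (α / a)))ᶜ :=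
    (differentiableOn_gammaExp hα ha).continuousOn
  set G : ℂ → ℂ := L.closedInner.piecewise (inn 1) (lo 1) with hG
  set F₁ : ℂ → ℂ := L.closedInner.piecewise (fun z => inn 0 z + gammaExp α a z * inn 1 z) (lo 0)
    with hF₁
  set F : ℂ → ℂ := {z : ℂ | z.im ≤ 0}.piecewise F₁ (up 0) with hF
  have hFle : ∀ z : ℂ, z.im ≤ 0 → F z = F₁ z := fun z hz =>
    piecewise_eq_of_mem {z : ℂ | z.im ≤ 0} F₁ (up 0) hz
  have hFgt : ∀ z : ℂ, 0 < z.im → F z = up 0 z := fun z hz =>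
    piecewise_eq_of_notMem {z : ℂ | z.im ≤ 0} F₁ (up 0) (not_le.2 hz)
  have hGc : ContinuousOn G {z | z.im ≤ 0} := by
    refine continuousOn_piecewise_of_eqOn L.isClosed_closedInner hMclosed (fun z hz => ?_)
      ((hinnc 1).mono inter_subset_left) ((hloc 1).mono inter_subset_left) fun z hz => ?_
    · by_cases h : z ∈ L.inner
      · exact Or.inl (L.inner_subset_closedInner h)
      · exact Or.inr ⟨hz, h⟩
    · exact (hjc z (L.carrier_eq ▸ ⟨hz.1.1, hz.1.2.2⟩)).1
  have hF₁c : ContinuousOn F₁ ({z | z.im ≤ 0} ∩ (range (pole (α / a)))ᶜ) := by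
    refine continuousOn_piecewise_of_eqOn L.isClosed_closedInner hMclosed (fun z hz => ?_)
      (((hinnc 0).mono inter_subset_left).add ((hcont_c.mono fun z hz => hz.2.2).mul
        ((hinnc 1).mono inter_subset_left))) ((hloc 0).mono inter_subset_left) fun z hz => ?_
    · by_cases h : z ∈ L.inner
      · exact Or.inl (L.inner_subset_closedInner h)
      · exact Or.inr ⟨hz.1, h⟩
    · exact (hjc z (L.carrier_eq ▸ ⟨hz.1.1, hz.1.2.2⟩)).2
  have hFc : ContinuousOn F (range (pole (α / a)))ᶜ := by
    refine continuousOn_piecewise_of_eqOn hclneg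
      (isClosed_le continuous_const Complex.continuous_im) (fun z _ => le_total z.im 0) hF₁c
      ((hupc 0).mono inter_subset_left) fun z hz => ?_
    have hz0 : z.im = 0 := le_antisymm hz.1.1 hz.1.2
    have hzK : z ∉ L.closedInner := fun h => (hKneg z h).ne hz0
    rw [hF₁, piecewise_eq_of_notMem _ _ _ hzK]
    exact (hjr z hz0).1.symm
  have hGinn : ∀ z ∈ L.inner, G z = u 1 z := fun z hz => by
    rw [hG, piecewise_eq_of_mem _ _ _ (L.inner_subset_closedInner hz), hinneq 1 z hz]
  have hGlo : ∀ z ∈ minusSide L, G z = u 1 z := fun z hz => by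
    rw [hG, piecewise_eq_of_notMem _ _ _ (L.minusSide_eq ▸ hz).2, hloeq 1 z hz]
  have hFinn : ∀ z ∈ L.inner, F z = u 0 z + gammaExp α a z * u 1 z := fun z hz => by
    have hzK := L.inner_subset_closedInner hz
    rw [hFle z (hKneg z hzK).le, hF₁, piecewise_eq_of_mem _ _ _ hzK,
      hinneq 1 z hz, hinneq 0 z hz]
  have hFlo : ∀ z ∈ minusSide L, F z = u 0 z := fun z hz => by
    have hz' : z ∈ {z : ℂ | z.im < 0} \ L.closedInner := L.minusSide_eq ▸ hz
    rw [hFle z hz.1.le, hF₁, piecewise_eq_of_notMem _ _ _ hz'.2,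
      hloeq 0 z hz]
  have hFup : ∀ z : ℂ, 0 < z.im → F z = u 0 z := fun z hz => by
    rw [hFgt z hz, hupeq 0 z hz]
  have hlow : ∀ z : ℂ, z.im < 0 → z ∉ L.carrier → z ∈ L.inner ∨ z ∈ minusSide L :=
    fun z hz hzc => by
    by_cases h : z ∈ L.inner
    · exact Or.inl h
    · exact Or.inr ⟨hz, h, hzc⟩
  have hGd : DifferentiableOn ℂ G {z | z.im < 0} := by
    refine differentiableOn_of_carrier L hUneg (hGc.mono fun z (hz : z.im < 0) => hz.le)
      fun z hz hzc => ?_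
    rcases hlow z hz hzc with h | h
    · exact (hdiff 1 z (hinner z h)).congr_of_eventuallyEq
        (eventually_of_mem (L.isOpen_inner.mem_nhds h) hGinn)
    · exact (hdiff 1 z (hminus z h)).congr_of_eventuallyEq
        (eventually_of_mem (L.isOpen_minusSide.mem_nhds h) hGlo)
  have hFd : DifferentiableOn ℂ F (range (pole (α / a)))ᶜ := by
    have h1 : DifferentiableOn ℂ F ({z | z.im < 0} ∩ (range (pole (α / a)))ᶜ) := by
      refine differentiableOn_of_carrier L (hUneg.inter hPcl.isOpen_compl)
        (hFc.mono inter_subset_right) fun z hz hzc => ?_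
      rcases hlow z hz.1 hzc with h | h
      · refine ((hdiff 0 z (hinner z h)).add ((differentiableAt_gammaExp hα ha hz.2).mul
          (hdiff 1 z (hinner z h)))).congr_of_eventuallyEq
          (eventually_of_mem (L.isOpen_inner.mem_nhds h) hFinn)
      · exact (hdiff 0 z (hminus z h)).congr_of_eventuallyEq
          (eventually_of_mem (L.isOpen_minusSide.mem_nhds h) hFlo)
    refine differentiableOn_of_horizontal_line hPcl.isOpen_compl 0 hFc fun z hz hz0 => ?_
    rcases lt_or_gt_of_ne hz0 with h | h
    · exact h1.differentiableAt ((hUneg.inter hPcl.isOpen_compl).mem_nhds ⟨h, hz⟩)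
    · exact (hdiff 0 z (hupper z h)).congr_of_eventuallyEq
        (eventually_of_mem (hUpos.mem_nhds h) hFup)
  refine ⟨F, G, up 1, hGc, hGd, ?_, hupc 1, ?_, hupinf 1, hFd, ?_, ?_, ?_, ?_, hFup, hGinn⟩
  · have hcover : Bornology.cobounded ℂ ⊓ 𝓟 {z : ℂ | z.im ≤ 0} ≤
        (Bornology.cobounded ℂ ⊓ 𝓟 L.closedInner) ⊔
          (Bornology.cobounded ℂ ⊓ 𝓟 (({z : ℂ | z.im ≤ 0} \ L.inner) \ L.closedInner)) := by
      rw [← inf_sup_left, sup_principal]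
      refine inf_le_inf_left _ (principal_mono.2 fun z hz => ?_)
      by_cases h : z ∈ L.closedInner
      · exact Or.inl h
      · exact Or.inr ⟨⟨hz, fun h' => h (L.inner_subset_closedInner h')⟩, h⟩
    refine Tendsto.mono_left (tendsto_sup.2 ⟨?_, ?_⟩) hcover
    · refine (hinninf 1).congr' ?_
      filter_upwards [mem_inf_of_right (mem_principal_self _)] with z hz
      rw [hG, piecewise_eq_of_mem _ _ _ hz]
    · refine ((hloinf 1).mono_left (inf_le_inf_left _ (principal_mono.2 sdiff_subset))).congr' ?_
      filter_upwards [mem_inf_of_right (mem_principal_self _)] with z hz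
      rw [hG, piecewise_eq_of_notMem _ _ _ hz.2]
  · intro z hz
    exact ((hdiff 1 z (hupper z hz)).congr_of_eventuallyEq
      (eventually_of_mem (hUpos.mem_nhds hz) (hupeq 1))).differentiableWithinAt
  · intro s
    have hs : (s : ℂ) ∈ realLine := Complex.ofReal_im s
    have hsK : (s : ℂ) ∉ L.closedInner := fun h => (hKneg _ h).ne hs
    rw [(hjr s hs).2, hG, piecewise_eq_of_notMem _ _ _ hsK, hFle s (le_of_eq hs), hF₁,
      piecewise_eq_of_notMem _ _ _ hsK]
    ring
  · intro k
    have hp := pole_mem_inner hα ha hL k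
    have hps := hinner _ hp
    have h0 : Tendsto (fun z => (z - pole (α / a) k) * u 0 z) (𝓝[≠] pole (α / a) k) (𝓝 0) := by
      have h := ((continuous_sub_right (pole (α / a) k)).tendsto (pole (α / a) k)).mul
        (hdiff 0 _ hps).continuousAt.tendsto
      rw [sub_self, zero_mul] at h
      exact h.mono_left nhdsWithin_le_nhds
    have h1 := (tendsto_sub_pole_mul_gammaExp hα ha k).mul
      ((hdiff 1 _ hps).continuousAt.tendsto.mono_left nhdsWithin_le_nhds)
    have h2 := h0.add h1
    rw [zero_add] at h2
    rw [hGinn _ hp]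
    refine h2.congr' ?_
    filter_upwards [nhdsWithin_le_nhds (L.isOpen_inner.mem_nhds hp)] with z hz
    rw [hFinn z hz]
    ring
  · have hcover : Bornology.cobounded ℂ ⊓ 𝓟 L.closedInnerᶜ ≤
        (Bornology.cobounded ℂ ⊓ 𝓟 (({z : ℂ | z.im ≤ 0} \ L.inner) \ L.closedInner)) ⊔
          (Bornology.cobounded ℂ ⊓ 𝓟 {z : ℂ | 0 < z.im}) := by
      rw [← inf_sup_left, sup_principal]
      refine inf_le_inf_left _ (principal_mono.2 fun z hz => ?_)
      rcases le_or_gt z.im 0 with h | h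
      · exact Or.inl ⟨⟨h, fun h' => hz (L.inner_subset_closedInner h')⟩, hz⟩
      · exact Or.inr h
    refine Tendsto.mono_left (tendsto_sup.2 ⟨?_, ?_⟩) hcover
    · refine ((hloinf 0).mono_left (inf_le_inf_left _ (principal_mono.2 sdiff_subset))).congr' ?_
      filter_upwards [mem_inf_of_right (mem_principal_self _)] with z hz
      rw [hFle z hz.1.1, hF₁, piecewise_eq_of_notMem _ _ _ hz.2]
    · refine (hinf 0 _ hupper).congr' ?_
      filter_upwards [mem_inf_of_right (mem_principal_self _)] with z hz
      rw [hFup z hz]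
  · refine (hinninf 0).congr' ?_
    filter_upwards [mem_inf_of_right (mem_principal_self _)] with z hz
    rw [hFle z (hKneg z hz).le, hF₁, hG, piecewise_eq_of_mem _ _ _ hz,
      piecewise_eq_of_mem _ _ _ hz]
    ring

/-! ### The coupled system for the two columns -/

lemma tendsto_div_sub_cobounded (p : ℂ) :
    Tendsto (fun z => z / (z - p)) (Bornology.cobounded ℂ) (𝓝 1) := by
  have h1 : Tendsto (fun z : ℂ => z - p) (Bornology.cobounded ℂ) (Bornology.cobounded ℂ) :=
    tendsto_sub_const_cobounded p
  have h2 := ((tendsto_inv₀_cobounded.comp h1).const_mul p).const_add 1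
  rw [mul_zero, add_zero] at h2
  refine h2.congr' ?_
  filter_upwards [h1.eventually_ne_cobounded 0] with z hz
  simp only [Function.comp_apply]
  field_simp
  ring

lemma norm_div_sub_le_one {z p : ℂ} (h : ‖z‖ ≤ ‖z - p‖) : ‖z / (z - p)‖ ≤ 1 := by
  rw [norm_div]
  exact div_le_one_of_le₀ h (norm_nonneg _)

lemma HasExpansion.tendsto_mul_sub {L : LambdaContour} {U : ℂ → Matrix (Fin 2) (Fin 2) ℂ}
    {U₁ : Matrix (Fin 2) (Fin 2) ℂ} (h : HasExpansion L U U₁) (i j : Fin 2) :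
    Tendsto (fun ζ => ζ * (U ζ i j - (1 : Matrix (Fin 2) (Fin 2) ℂ) i j)) (atInfinity L)
      (𝓝 (U₁ i j)) := by
  have hle : atInfinity L ≤ Bornology.cobounded ℂ := inf_le_left
  have hne : ∀ᶠ ζ in atInfinity L, ζ ≠ 0 := (tendsto_id'.2 hle).eventually_ne_cobounded 0
  have h1 := (isBigO_refl (fun ζ : ℂ => ζ) (atInfinity L)).mul (h i j)
  have h2 : Tendsto (fun ζ : ℂ => ζ * (1 / ζ ^ 2)) (atInfinity L) (𝓝 0) := by
    refine (tendsto_inv₀_cobounded.mono_left hle).congr' ?_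
    filter_upwards [hne] with ζ hζ
    field_simp
  have h3 := (h1.trans_tendsto h2).add_const (U₁ i j)
  rw [zero_add] at h3
  refine h3.congr' ?_
  filter_upwards [hne] with ζ hζ
  field_simp
  ring

lemma tendsto_mul_I_cobounded {σ : ℝ} (hσ : σ ≠ 0) :
    Tendsto (fun t : ℝ => (σ * t : ℝ) * I) atTop (Bornology.cobounded ℂ) := by
  rw [← tendsto_norm_atTop_iff_cobounded]
  have : ∀ t : ℝ, ‖((σ * t : ℝ) : ℂ) * I‖ = |σ| * |t| := fun t => by
    rw [norm_mul, Complex.norm_I, mul_one, Complex.norm_real, Real.norm_eq_abs, abs_mul]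
  simp only [this]
  exact tendsto_abs_atTop_atTop.const_mul_atTop (abs_pos.2 hσ)

namespace IsRowExtension

variable {α a : ℝ} {L : LambdaContour} {U : ℂ → Matrix (Fin 2) (Fin 2) ℂ} {i : Fin 2}
  {F G H : ℂ → ℂ}

lemma bddAbove_norm_G_pole (hα : 0 < α) (ha : 0 < a) (h : IsRowExtension α a L U i F G H) :
    BddAbove (range fun k => ‖G (pole (α / a) k)‖) := by
  have hκ : 0 < α / a := by positivity
  refine Tendsto.bddAbove_range (u := fun k => ‖G (pole (α / a) k)‖)
    (a := ‖(1 : Matrix (Fin 2) (Fin 2) ℂ) i 1‖) ?_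
  refine (h.tendsto_G.comp (tendsto_inf.2 ⟨tendsto_pole_cobounded hκ, ?_⟩)).norm
  refine tendsto_principal.2 (Eventually.of_forall fun k => ?_)
  have : 0 ≤ α / a * (k : ℝ) := by positivity
  change (pole (α / a) k).im ≤ 0
  rw [pole_im]
  linarith

lemma summable_norm_residues (hα : 0 < α) (ha : 0 < a) (h : IsRowExtension α a L U i F G H) :
    Summable fun k => ‖gammaRes α a k * G (pole (α / a) k)‖ := by
  refine Summable.of_nonneg_of_le (fun _ => norm_nonneg _) (fun k => ?_)
    ((summable_norm_gammaRes hα ha).mul_right (⨆ k, ‖G (pole (α / a) k)‖))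
  rw [norm_mul]
  exact mul_le_mul_of_nonneg_left (le_ciSup (h.bddAbove_norm_G_pole hα ha) k) (norm_nonneg _)

/-- The first column in terms of the values of the second one at the poles. -/
lemma F_eq (hα : 0 < α) (ha : 0 < a) (h : IsRowExtension α a L U i F G H) {ζ : ℂ}
    (hζ : ζ ∉ range (pole (α / a))) :
    F ζ = (1 : Matrix (Fin 2) (Fin 2) ℂ) i 0 +
      ∑' k, gammaRes α a k * G (pole (α / a) k) / (ζ - pole (α / a) k) := by
  have hκ : 0 < α / a := by positivity
  set δ₁ := (1 : Matrix (Fin 2) (Fin 2) ℂ) i 0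
  set δ₂ := (1 : Matrix (Fin 2) (Fin 2) ℂ) i 1
  refine eq_add_tsum_of_simple_poles hκ (h.summable_norm_residues hα ha) h.differentiableOn_F
    h.residue_F (fun ε hε => ?_) hζ
  obtain ⟨r₁, hr₁⟩ := exists_norm_sub_le_of_tendsto h.tendsto_F_outside (half_pos hε)
  obtain ⟨r₂, hr₂⟩ := exists_norm_sub_le_of_tendsto h.tendsto_F_inside (half_pos hε)
  obtain ⟨r₃, hr₃⟩ := exists_norm_sub_le_of_tendsto h.tendsto_G one_pos
  have hlim : Tendsto (fun N : ℕ => 1 + α / a * ((N : ℝ) + 1 / 2)) atTop atTop :=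
    tendsto_atTop_add_const_left _ _ (Tendsto.const_mul_atTop hκ
      (tendsto_atTop_add_const_right _ _ tendsto_natCast_atTop_atTop))
  have hsmall := (tendsto_exp_quadratic hα ha L.w
    (2 * Real.pi * Real.exp (Real.pi * (a / α * L.w) / 2) * (‖δ₂‖ + 1))).eventually_le_const
      (half_pos hε)
  filter_upwards [hlim.eventually_gt_atTop r₁, hlim.eventually_gt_atTop r₂,
    hlim.eventually_gt_atTop r₃, hlim.eventually_gt_atTop L.w, hsmall] with N h1 h2 h3 hw hs z hz
  have hzn : 1 + α / a * ((N : ℝ) + 1 / 2) ≤ ‖z‖ := by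
    rw [← hz]
    exact max_le (Complex.abs_re_le_norm z) (Complex.abs_im_le_norm z)
  by_cases hzK : z ∈ L.closedInner
  · -- Here `z` lies on the lower side of the square, half-way between two poles.
    have him := L.im_neg_of_mem_closedInner hzK
    have hre : |z.re| ≤ L.w := hzK.1
    have himeq : z.im = -(1 + α / a * ((N : ℝ) + 1 / 2)) := by
      rcases max_choice |z.re| |z.im| with hm | hm
      · rw [hm] at hz
        linarith
      · rw [hm, abs_of_neg him] at hz
        linarith
    have hc := norm_gammaExp_le_between_poles hα ha hre N himeq
    have hGn : ‖G z‖ ≤ ‖δ₂‖ + 1 := by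
      have h5 := hr₃ z him.le (h3.le.trans hzn)
      have h6 := norm_add_le (G z - δ₂) δ₂
      rw [sub_add_cancel] at h6
      linarith
    have hcG : ‖gammaExp α a z * G z‖ ≤ ε / 2 := by
      rw [norm_mul]
      refine (mul_le_mul hc hGn (norm_nonneg _) (by positivity)).trans ?_
      rw [himeq]
      refine le_trans (le_of_eq ?_) hs
      ring
    have hd := hr₂ z hzK (h2.le.trans hzn)
    have h7 := norm_add_le (F z - gammaExp α a z * G z - δ₁) (gammaExp α a z * G z)
    rw [show F z - gammaExp α a z * G z - δ₁ + gammaExp α a z * G z = F z - δ₁ by ring] at h7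
    linarith
  · have := hr₁ z hzK (h1.le.trans hzn)
    linarith

lemma norm_F_sub_le (hα : 0 < α) (ha : 0 < a) (h : IsRowExtension α a L U i F G H) (s : ℝ) :
    ‖F s - (1 : Matrix (Fin 2) (Fin 2) ℂ) i 0‖ ≤
      (∑' k, ‖gammaRes α a k‖) * ⨆ k, ‖G (pole (α / a) k)‖ := by
  have hκ : 0 < α / a := by positivity
  rw [h.F_eq hα ha (notMem_range_pole_of_im_lt hκ (by simp)), add_sub_cancel_left, ← tsum_mul_right]
  refine tsum_of_norm_bounded
    ((summable_norm_gammaRes hα ha).mul_right (⨆ k, ‖G (pole (α / a) k)‖)).hasSum fun k => ?_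
  have h1 : 1 ≤ ‖(s : ℂ) - pole (α / a) k‖ := by
    refine le_trans ?_ (Complex.abs_im_le_norm _)
    have : 0 ≤ α / a * (k : ℝ) := by positivity
    rw [Complex.sub_im, pole_im, Complex.ofReal_im, zero_sub, neg_neg, abs_of_nonneg (by linarith)]
    linarith
  rw [norm_div, norm_mul]
  refine (div_le_self (by positivity) h1).trans ?_
  exact mul_le_mul_of_nonneg_left (le_ciSup (h.bddAbove_norm_G_pole hα ha) k) (norm_nonneg _)

lemma continuous_F (hα : 0 < α) (ha : 0 < a) (h : IsRowExtension α a L U i F G H) :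
    Continuous fun s : ℝ => F s :=
  h.differentiableOn_F.continuousOn.comp_continuous Complex.continuous_ofReal fun s =>
    notMem_range_pole_of_im_lt (by positivity) (by simp)

lemma integrable_gammaInvExp_mul_F (hα : 0 < α) (ha : α ≤ a)
    (h : IsRowExtension α a L U i F G H) : Integrable fun s : ℝ => gammaInvExp α a s * F s := by
  have ha0 : 0 < a := hα.trans_le ha
  refine (integrable_gammaInvExp hα ha).mul_bdd
    (c := (∑' k, ‖gammaRes α a k‖) * (⨆ k, ‖G (pole (α / a) k)‖) +
      ‖(1 : Matrix (Fin 2) (Fin 2) ℂ) i 0‖)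
    (h.continuous_F hα ha0).aestronglyMeasurable (Eventually.of_forall fun s => ?_)
  have h1 := h.norm_F_sub_le hα ha0 s
  have h2 := norm_add_le (F s - (1 : Matrix (Fin 2) (Fin 2) ℂ) i 0)
    ((1 : Matrix (Fin 2) (Fin 2) ℂ) i 0)
  rw [sub_add_cancel] at h2
  linarith

/-- The second column in terms of the values of the first one on the real line. -/
lemma G_eq (hα : 0 < α) (ha : α ≤ a) (h : IsRowExtension α a L U i F G H) {ζ : ℂ}
    (hζ : ζ.im < 0) :
    G ζ = (1 : Matrix (Fin 2) (Fin 2) ℂ) i 1 -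
      1 / (2 * Real.pi * I) * ∫ s : ℝ, gammaInvExp α a s * F s / (s - ζ) := by
  have hden : ∀ s : ℝ, -ζ.im ≤ ‖(s - ζ : ℂ)‖ := fun s => by
    have := Complex.abs_im_le_norm (s - ζ : ℂ)
    rw [Complex.sub_im, Complex.ofReal_im, zero_sub, abs_of_pos (by linarith)] at this
    exact this
  have hne : ∀ s : ℝ, (s - ζ : ℂ) ≠ 0 := fun s h0 => by
    have := hden s
    rw [h0, norm_zero] at this
    linarith
  have hint : Integrable fun s : ℝ => gammaInvExp α a s * F s / (s - ζ) := by
    simp only [div_eq_mul_inv]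
    refine (h.integrable_gammaInvExp_mul_F hα ha).mul_bdd (c := (-ζ.im)⁻¹)
      (Continuous.aestronglyMeasurable ?_) (Eventually.of_forall fun s => ?_)
    · exact (by fun_prop : Continuous fun s : ℝ => (s - ζ : ℂ)).inv₀ hne
    · rw [norm_inv]
      exact inv_anti₀ (by linarith) (hden s)
  have hjump : ∀ s : ℝ, (H s - G s) / (s - ζ) = -(gammaInvExp α a s * F s / (s - ζ)) := fun s => by
    rw [h.jump_real, neg_div]
  have := eq_add_integral_of_half_planes h.continuousOn_G h.differentiableOn_G h.tendsto_G
    h.continuousOn_H h.differentiableOn_H h.tendsto_H hζ (by simp only [hjump]; exact hint.neg)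
  rw [this]
  simp only [hjump, integral_neg]
  ring

lemma norm_G_pole_sub_le (hα : 0 < α) (ha : α ≤ a) (h : IsRowExtension α a L U i F G H) (k : ℕ) :
    ‖G (pole (α / a) k) - (1 : Matrix (Fin 2) (Fin 2) ℂ) i 1‖ ≤
      (∫ s : ℝ, ‖gammaInvExp α a s‖) / (2 * Real.pi) *
        (‖(1 : Matrix (Fin 2) (Fin 2) ℂ) i 0‖ +
          (∑' k, ‖gammaRes α a k‖) * ⨆ k, ‖G (pole (α / a) k)‖) := by
  have ha0 : 0 < a := hα.trans_le ha
  have hk : 0 ≤ α / a * (k : ℝ) := by positivity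
  have him : (pole (α / a) k).im < 0 := by rw [pole_im]; linarith
  set M := ‖(1 : Matrix (Fin 2) (Fin 2) ℂ) i 0‖ +
    (∑' k, ‖gammaRes α a k‖) * ⨆ k, ‖G (pole (α / a) k)‖ with hM
  have hle : ‖∫ s : ℝ, gammaInvExp α a s * F s / (s - pole (α / a) k)‖ ≤
      (∫ s : ℝ, ‖gammaInvExp α a s‖) * M := by
    rw [← integral_mul_const]
    refine norm_integral_le_of_norm_le ((integrable_gammaInvExp hα ha).norm.mul_const M)
      (Eventually.of_forall fun s => ?_)
    have h1 : 1 ≤ ‖(s : ℂ) - pole (α / a) k‖ := by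
      refine le_trans ?_ (Complex.abs_im_le_norm _)
      rw [Complex.sub_im, pole_im, Complex.ofReal_im, zero_sub, neg_neg,
        abs_of_nonneg (by linarith)]
      linarith
    rw [norm_div, norm_mul]
    refine (div_le_self (by positivity) h1).trans ?_
    refine mul_le_mul_of_nonneg_left ?_ (norm_nonneg _)
    have h2 := h.norm_F_sub_le hα ha0 s
    have h3 := norm_add_le ((1 : Matrix (Fin 2) (Fin 2) ℂ) i 0)
      (F s - (1 : Matrix (Fin 2) (Fin 2) ℂ) i 0)
    rw [add_sub_cancel] at h3
    linarith
  rw [h.G_eq hα ha him, sub_sub_cancel_left, norm_neg, norm_mul]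
  have hn : ‖(1 / (2 * Real.pi * I) : ℂ)‖ = 1 / (2 * Real.pi) := by
    simp [abs_of_pos Real.pi_pos]
  rw [hn]
  refine (mul_le_mul_of_nonneg_left hle (by positivity)).trans (le_of_eq ?_)
  ring

/-- The coefficient of `1/ζ` in the first column, read off along the positive imaginary axis. -/
lemma coeff_zero_eq (hα : 0 < α) (ha : 0 < a) (h : IsRowExtension α a L U i F G H)
    {U₁ : Matrix (Fin 2) (Fin 2) ℂ} (hU₁ : HasExpansion L U U₁) :
    U₁ i 0 = ∑' k, gammaRes α a k * G (pole (α / a) k) := by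
  have hκ : 0 < α / a := by positivity
  set ζ : ℝ → ℂ := fun t => (1 * t : ℝ) * I with hζ
  have hζim : ∀ t, (ζ t).im = t := fun t => by simp [hζ]
  have hζc : Tendsto ζ atTop (Bornology.cobounded ℂ) := tendsto_mul_I_cobounded one_ne_zero
  have hζinf : Tendsto ζ atTop (atInfinity L) := by
    refine tendsto_inf.2 ⟨hζc, tendsto_principal.2 ?_⟩
    filter_upwards [eventually_gt_atTop 0] with t ht hmem
    rcases hmem with hm | hm
    · rw [L.carrier_eq] at hm
      have := L.im_neg_of_mem_closedInner hm.1
      rw [hζim] at this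
      linarith
    · have : (ζ t).im = 0 := hm
      rw [hζim] at this
      linarith
  have h1 := (hU₁.tendsto_mul_sub i 0).comp hζinf
  have h2 : Tendsto (fun t => ∑' k, gammaRes α a k * G (pole (α / a) k) *
      (ζ t / (ζ t - pole (α / a) k))) atTop
      (𝓝 (∑' k, gammaRes α a k * G (pole (α / a) k))) := by
    refine tendsto_tsum_of_dominated_convergence (h.summable_norm_residues hα ha) (fun k => ?_) ?_
    · simpa using ((tendsto_div_sub_cobounded (pole (α / a) k)).comp hζc).const_mul
        (gammaRes α a k * G (pole (α / a) k))
    · filter_upwards [eventually_gt_atTop 0] with t ht k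
      rw [norm_mul]
      refine mul_le_of_le_one_right (norm_nonneg _) (norm_div_sub_le_one ?_)
      have hk : 0 ≤ α / a * (k : ℝ) := by positivity
      have h3 : ‖ζ t‖ = t := by
        simp [hζ, abs_of_pos ht]
      rw [h3]
      refine le_trans ?_ (Complex.abs_im_le_norm _)
      rw [Complex.sub_im, pole_im, hζim, abs_of_pos (by linarith)]
      linarith
  refine tendsto_nhds_unique h1 (h2.congr' ?_)
  filter_upwards [eventually_gt_atTop 0] with t ht
  have him : 0 < (ζ t).im := by rwa [hζim]
  simp only [Function.comp_apply]
  rw [← h.eq_F _ him, h.F_eq hα ha (notMem_range_pole_of_im_lt hκ (by linarith)),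
    add_sub_cancel_left, ← tsum_mul_left]
  refine tsum_congr fun k => ?_
  ring

/-- The coefficient of `1/ζ` in the second column, read off along the negative imaginary axis. -/
lemma coeff_one_eq (hα : 0 < α) (ha : α ≤ a) (h : IsRowExtension α a L U i F G H)
    {U₁ : Matrix (Fin 2) (Fin 2) ℂ} (hU₁ : HasExpansion L U U₁) :
    U₁ i 1 = 1 / (2 * Real.pi * I) * ∫ s : ℝ, gammaInvExp α a s * F s := by
  set ζ : ℝ → ℂ := fun t => (-1 * t : ℝ) * I with hζ
  have hζim : ∀ t, (ζ t).im = -t := fun t => by simp [hζ]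
  have hζre : ∀ t, (ζ t).re = 0 := fun t => by simp [hζ]
  have hζc : Tendsto ζ atTop (Bornology.cobounded ℂ) := tendsto_mul_I_cobounded (by norm_num)
  have hinner : ∀ᶠ t in atTop, ζ t ∈ L.inner := by
    filter_upwards [eventually_gt_atTop (-L.φ 0)] with t ht
    refine ⟨by rw [hζre, abs_zero]; exact L.w_pos, ?_⟩
    rw [hζre, hζim]
    linarith
  have hζinf : Tendsto ζ atTop (atInfinity L) := by
    refine tendsto_inf.2 ⟨hζc, tendsto_principal.2 ?_⟩
    filter_upwards [hinner] with t ht hmem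
    rcases hmem with hm | hm
    · rw [L.carrier_eq] at hm
      exact hm.2 ht
    · exact (L.im_neg_of_mem_closedInner (L.inner_subset_closedInner ht)).ne hm
  have h1 := (hU₁.tendsto_mul_sub i 1).comp hζinf
  have h2 : Tendsto (fun t => ∫ s : ℝ, gammaInvExp α a s * F s * (ζ t / (ζ t - s))) atTop
      (𝓝 (∫ s : ℝ, gammaInvExp α a s * F s)) := by
    refine tendsto_integral_filter_of_dominated_convergence
      (fun s => ‖gammaInvExp α a s * F s‖) ?_ ?_ (h.integrable_gammaInvExp_mul_F hα ha).norm ?_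
    · filter_upwards [eventually_gt_atTop 0] with t ht
      refine (h.integrable_gammaInvExp_mul_F hα ha).aestronglyMeasurable.mul
        (Continuous.aestronglyMeasurable ?_)
      refine continuous_const.div (by fun_prop) fun s h0 => ?_
      have := congrArg Complex.im h0
      rw [Complex.sub_im, hζim, Complex.ofReal_im, Complex.zero_im] at this
      linarith
    · refine Eventually.of_forall fun t => Eventually.of_forall fun s => ?_
      rw [norm_mul]
      refine mul_le_of_le_one_right (norm_nonneg _) (norm_div_sub_le_one ?_)
      have h3 : ‖ζ t‖ = |(ζ t - s).im| := by
        simp [hζ]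
      rw [h3]
      exact Complex.abs_im_le_norm _
    · refine Eventually.of_forall fun s => ?_
      simpa using ((tendsto_div_sub_cobounded (s : ℂ)).comp hζc).const_mul (gammaInvExp α a s * F s)
  refine tendsto_nhds_unique h1 ((h2.const_mul _).congr' ?_)
  filter_upwards [hinner] with t ht
  have him := L.im_neg_of_mem_closedInner (L.inner_subset_closedInner ht)
  simp only [Function.comp_apply]
  have hker : ∫ s : ℝ, gammaInvExp α a s * F s * (ζ t / (ζ t - s)) =
      -(ζ t * ∫ s : ℝ, gammaInvExp α a s * F s / (s - ζ t)) := by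
    rw [← integral_const_mul, ← integral_neg]
    congr 1
    ext s
    rw [← neg_sub (ζ t) (s : ℂ), div_neg]
    ring
  rw [← h.eq_G _ ht, h.G_eq hα ha him, hker]
  ring

/-- The two columns determine each other up to the small factors `R` and `β`, so that after one
iteration the error is of order `R β`. -/
lemma norm_coeff_sub_le (hα : 0 < α) (ha : α ≤ a) (h : IsRowExtension α a L U i F G H)
    {U₁ : Matrix (Fin 2) (Fin 2) ℂ} (hU₁ : HasExpansion L U U₁) {R β : ℝ}
    (hR : ∑' k, ‖gammaRes α a k‖ ≤ R) (hR1 : R ≤ 1 / 2)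
    (hβ : (∫ s : ℝ, ‖gammaInvExp α a s‖) / (2 * Real.pi) ≤ β) (hβ1 : β ≤ 1) :
    ‖U₁ i 0 - (1 : Matrix (Fin 2) (Fin 2) ℂ) i 1 * ∑' k, gammaRes α a k‖ ≤ 5 * (R * β) ∧
    ‖U₁ i 1 - (1 : Matrix (Fin 2) (Fin 2) ℂ) i 0 *
      (1 / (2 * Real.pi * I) * ∫ s : ℝ, gammaInvExp α a s)‖ ≤ 5 * (R * β) := by
  have ha0 : 0 < a := hα.trans_le ha
  set M := ⨆ k, ‖G (pole (α / a) k)‖ with hM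
  set δ₁ := (1 : Matrix (Fin 2) (Fin 2) ℂ) i 0 with hδ₁
  set δ₂ := (1 : Matrix (Fin 2) (Fin 2) ℂ) i 1 with hδ₂
  have hd1 : ‖δ₁‖ ≤ 1 := by
    rw [hδ₁, Matrix.one_apply]; split_ifs <;> simp
  have hd2 : ‖δ₂‖ ≤ 1 := by
    rw [hδ₂, Matrix.one_apply]; split_ifs <;> simp
  have hM0 : 0 ≤ M := Real.iSup_nonneg fun _ => norm_nonneg _
  have hS0 : 0 ≤ ∑' k, ‖gammaRes α a k‖ := tsum_nonneg fun _ => norm_nonneg _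
  have hR0 : 0 ≤ R := hS0.trans hR
  have hI0 : 0 ≤ (∫ s : ℝ, ‖gammaInvExp α a s‖) / (2 * Real.pi) :=
    div_nonneg (integral_nonneg fun _ => norm_nonneg _) (by positivity)
  have hβ0 : 0 ≤ β := hI0.trans hβ
  have hF : ∀ s : ℝ, ‖F s - δ₁‖ ≤ R * M := fun s =>
    (h.norm_F_sub_le hα ha0 s).trans (mul_le_mul_of_nonneg_right hR hM0)
  have hG : ∀ k, ‖G (pole (α / a) k) - δ₂‖ ≤ β * (‖δ₁‖ + R * M) := fun k =>
    (h.norm_G_pole_sub_le hα ha k).trans (mul_le_mul hβ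
      (add_le_add le_rfl (mul_le_mul_of_nonneg_right hR hM0)) (by positivity) hβ0)
  -- A priori bound on the values at the poles.
  have hM4 : M ≤ 4 := by
    have h1 : M ≤ ‖δ₂‖ + β * (‖δ₁‖ + R * M) := ciSup_le fun k => by
      have h2 := norm_add_le δ₂ (G (pole (α / a) k) - δ₂)
      rw [add_sub_cancel] at h2
      linarith [hG k]
    have h3 : ‖δ₁‖ + R * M ≤ 1 + 1 / 2 * M := by nlinarith
    have h4 : β * (‖δ₁‖ + R * M) ≤ 1 * (1 + 1 / 2 * M) :=
      mul_le_mul hβ1 h3 (by positivity) zero_le_one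
    linarith
  constructor
  · have hs1 := (h.summable_norm_residues hα ha0).of_norm
    have hs2 := (summable_norm_gammaRes hα ha0).of_norm
    rw [h.coeff_zero_eq hα ha0 hU₁, ← tsum_mul_left, ← hs1.tsum_sub (hs2.mul_left _)]
    have h5 : β * (‖δ₁‖ + R * M) ≤ 5 * β := by
      have h7 : ‖δ₁‖ + R * M ≤ 5 := by nlinarith
      linarith [mul_le_mul_of_nonneg_left h7 hβ0]
    have h6 : ‖∑' k, (gammaRes α a k * G (pole (α / a) k) - δ₂ * gammaRes α a k)‖ ≤
        (∑' k, ‖gammaRes α a k‖) * (5 * β) := by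
      rw [← tsum_mul_right]
      refine tsum_of_norm_bounded ((summable_norm_gammaRes hα ha0).mul_right _).hasSum fun k => ?_
      rw [mul_comm δ₂, ← mul_sub, norm_mul]
      exact mul_le_mul_of_nonneg_left ((hG k).trans h5) (norm_nonneg _)
    nlinarith
  · have hint := integrable_gammaInvExp hα ha
    have hdiff : (∫ s : ℝ, gammaInvExp α a s * F s) - δ₁ * ∫ s : ℝ, gammaInvExp α a s =
        ∫ s : ℝ, gammaInvExp α a s * (F s - δ₁) := by
      rw [← integral_const_mul, ← integral_sub (h.integrable_gammaInvExp_mul_F hα ha)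
        (hint.const_mul _)]
      congr 1
      ext s
      ring
    have h6 : ‖∫ s : ℝ, gammaInvExp α a s * (F s - δ₁)‖ ≤
        (∫ s : ℝ, ‖gammaInvExp α a s‖) * (R * M) := by
      rw [← integral_mul_const]
      refine norm_integral_le_of_norm_le (hint.norm.mul_const _) (Eventually.of_forall fun s => ?_)
      rw [norm_mul]
      exact mul_le_mul_of_nonneg_left (hF s) (norm_nonneg _)
    have hn : ‖(1 / (2 * Real.pi * I) : ℂ)‖ = 1 / (2 * Real.pi) := by
      simp [abs_of_pos Real.pi_pos]
    rw [h.coeff_one_eq hα ha hU₁, mul_left_comm, ← mul_sub, hdiff, norm_mul, hn]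
    calc 1 / (2 * Real.pi) * ‖∫ s : ℝ, gammaInvExp α a s * (F s - δ₁)‖
        ≤ 1 / (2 * Real.pi) * ((∫ s : ℝ, ‖gammaInvExp α a s‖) * (R * M)) :=
          mul_le_mul_of_nonneg_left h6 (by positivity)
      _ = (∫ s : ℝ, ‖gammaInvExp α a s‖) / (2 * Real.pi) * (R * M) := by ring
      _ ≤ β * (R * 4) := by gcongr
      _ ≤ 5 * (R * β) := by nlinarith [mul_nonneg hR0 hβ0]

end IsRowExtension

end GapRH

end

/-! ### The asymptotics -/

theorem proposition8p1 (α : ℝ) (hα : 0 < α)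
    (L : ℝ → GapRH.LambdaContour)
    (U : ℝ → ℂ → Matrix (Fin 2) (Fin 2) ℂ)
    (U₁ : ℝ → Matrix (Fin 2) (Fin 2) ℂ)
    (hL : ∀ᶠ a in atTop, (L a).CrossesAtTheta a)
    (hU : ∀ᶠ a in atTop, GapRH.IsSolution α a (L a) (U a))
    (hU₁ : ∀ᶠ a in atTop, GapRH.HasExpansion (L a) (U a) (U₁ a)) :
    (∀ᶠ a in atTop, (L a).IntegrableAlong (GapRH.gammaExp α a) ∧
      Integrable (fun s : ℝ => GapRH.gammaInvExp α a s)) ∧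
    (fun a => U₁ a 0 0) =O[atTop] (fun a : ℝ => Real.exp (-(a ^ 2 / (2 * α)))) ∧
    (fun a => U₁ a 1 1) =O[atTop] (fun a : ℝ => Real.exp (-(a ^ 2 / (2 * α)))) ∧
    (fun a => U₁ a 1 0 - 1 / (2 * Real.pi * Complex.I) * (L a).integral (GapRH.gammaExp α a))
      =O[atTop] (fun a : ℝ => Real.exp (-(a ^ 2 / (2 * α)))) ∧
    (fun a => U₁ a 0 1 -
        1 / (2 * Real.pi * Complex.I) * ∫ s : ℝ, GapRH.gammaInvExp α a s)
      =O[atTop] (fun a : ℝ => Real.exp (-(a ^ 2 / (2 * α)))) := by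
  set X : ℝ → ℝ := fun a => Real.exp (-(a ^ 2 / (4 * α))) with hX
  -- The bounds for `R` and `β` are `C₁ X a` and `C₂ X a`, whose product has the claimed order.
  set C₁ := α * Real.exp 1
  set C₂ := 2 * Real.exp (Real.pi ^ 2 / (4 * α)) * √(Real.pi * (4 * α)) / (2 * Real.pi)
  have hXlim : Tendsto X atTop (𝓝 0) :=
    Real.tendsto_exp_atBot.comp (tendsto_neg_atTop_atBot.comp
      ((tendsto_pow_atTop two_ne_zero).atTop_div_const (by positivity)))
  have hXsq : ∀ a, X a * X a = Real.exp (-(a ^ 2 / (2 * α))) := fun a => by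
    rw [hX]
    simp only
    rw [← Real.exp_add]
    congr 1
    field_simp
    ring
  have hlimR : Tendsto (fun a => C₁ * X a) atTop (𝓝 0) := by simpa using hXlim.const_mul C₁
  have hlimβ : Tendsto (fun a => C₂ * X a) atTop (𝓝 0) := by simpa using hXlim.const_mul C₂
  -- The entries, up to the claimed main terms, for one large value of `a`.
  have key : ∀ᶠ a in atTop, ∀ i : Fin 2,
      ‖U₁ a i 0 - (1 : Matrix (Fin 2) (Fin 2) ℂ) i 1 * ∑' k, GapRH.gammaRes α a k‖ ≤
        5 * (C₁ * C₂) * ‖Real.exp (-(a ^ 2 / (2 * α)))‖ ∧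
      ‖U₁ a i 1 - (1 : Matrix (Fin 2) (Fin 2) ℂ) i 0 *
        (1 / (2 * Real.pi * Complex.I) * ∫ s : ℝ, GapRH.gammaInvExp α a s)‖ ≤
        5 * (C₁ * C₂) * ‖Real.exp (-(a ^ 2 / (2 * α)))‖ := by
    filter_upwards [hL, hU, hU₁, eventually_ge_atTop α, eventually_ge_atTop 1,
      hlimR.eventually_le_const (show (0 : ℝ) < 1 / 2 by norm_num),
      hlimβ.eventually_le_const one_pos] with a h1 h2 h3 ha ha1 hR hβ i
    obtain ⟨F, G, H, hrow⟩ := GapRH.exists_isRowExtension hα (hα.trans_le ha) h1 h2 i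
    have hβ' : (∫ s : ℝ, ‖GapRH.gammaInvExp α a s‖) / (2 * Real.pi) ≤ C₂ * X a := by
      refine (div_le_div_of_nonneg_right (GapRH.integral_norm_gammaInvExp_le hα ha ha1)
        (by positivity)).trans (le_of_eq ?_)
      simp only [C₂, hX]
      ring
    have := hrow.norm_coeff_sub_le hα ha h3 (GapRH.tsum_norm_gammaRes_le hα ha1) hR hβ' hβ
    rw [Real.norm_of_nonneg (Real.exp_pos _).le, ← hXsq,
      show 5 * (C₁ * C₂) * (X a * X a) = 5 * (C₁ * X a * (C₂ * X a)) by ring]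
    exact this
  have hint : ∀ᶠ a in atTop, 1 / (2 * Real.pi * Complex.I) * (L a).integral (GapRH.gammaExp α a) =
      ∑' k, GapRH.gammaRes α a k := by
    filter_upwards [hL, eventually_gt_atTop 0] with a h1 ha
    have hpi : (2 * Real.pi * Complex.I : ℂ) ≠ 0 := by simp [Real.pi_ne_zero]
    rw [GapRH.integral_gammaExp hα ha h1, one_div, inv_mul_cancel_left₀ hpi]
  refine ⟨?_, ?_, ?_, ?_, ?_⟩
  · filter_upwards [hL, eventually_ge_atTop α] with a h1 ha
    exact ⟨GapRH.integrableAlong_gammaExp hα (hα.trans_le ha) h1,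
      GapRH.integrable_gammaInvExp hα ha⟩
  · refine IsBigO.of_bound (5 * (C₁ * C₂)) (key.mono fun a h => ?_)
    simpa using (h 0).1
  · refine IsBigO.of_bound (5 * (C₁ * C₂)) (key.mono fun a h => ?_)
    simpa using (h 1).2
  · refine IsBigO.of_bound (5 * (C₁ * C₂)) ?_
    filter_upwards [key, hint] with a h h'
    rw [h']
    simpa only [Matrix.one_apply_eq, one_mul] using (h 1).1
  · refine IsBigO.of_bound (5 * (C₁ * C₂)) (key.mono fun a h => ?_)
    simpa only [Matrix.one_apply_eq, one_mul] using (h 0).2
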